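/- Let $N$ be a non-negative integer, let $\mathfrak{b}^+\subset\mathfrak{gl}_N$ be the span of the matrix units $E_{ij}$ with $i\le j$, and let $\widehat{\mathfrak g}^{+}=\mathfrak{b}^+\oplus t^{-1}\mathfrak{gl}_N[t^{-1}]$, a Lie subalgebra of $\mathfrak{gl}_N[t^{-1}]$ over $\mathbb{C}$. Let $\mathcal{L}^+(u)=[\mathcal{L}^+_{ij}(u)]_{i,j=1}^N$ be the matrix with entries $$\mathcal{L}^+_{ij}(u)=\sum_{n=0}^{\infty}\mathcal{L}^+_{ij}[-n]\,u^n\in \mathrm{U}(\widehat{\mathfrak g}^{+})[[u]],\qquad \mathcal{L}^+_{ij}[-n]=-2E_{ij}t^{-n}\ (n\ge 1),\qquad \mathcal{L}^+_{ij}[0]=-(1+\mathrm{sgn}(j-i))E_{ij},$$ where $\mathrm{sgn}(0)=0$. Let $\rho=\mathrm{diag}[N-1,N-3,\dots,-N+1]$, let $\overline{\mathcal{L}}=2u\partial_u-\rho-\mathcal{L}^+(u)$, an $N\times N$ matrix of differential operators in $u$ with coefficients in $\mathrm{U}(\widehat{\mathfrak g}^{+})[[u]]$, and let $$T(y)=\sum_{i}e_{ii}\otimes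 e_{ii}+\frac{1}{1-y}\sum_{i<j}e_{ij}\otimes e_{ji}+\frac{1}{1+y}\sum_{i>j}e_{ij}\otimes e_{ji}\in \mathrm{End}\,\mathbb{C}^N\otimes \mathrm{End}\,\mathbb{C}^N[[y]].$$ Define differential operators $\vartheta_m$, $m\ge 1$, by the generating function $$\sum_{m=1}^{\infty}\vartheta_m\,y^m=\sum_{s=1}^{\infty}y^s\,\mathrm{tr}_{1,\dots,s}\,T_{s-1\,s}(y)\cdots T_{1\,2}(y)\,\overline{\mathcal{L}}_1\cdots\overline{\mathcal{L}}_s,$$ where subscripts indicate the copies of $\mathrm{End}\,\mathbb{C}^N$ in the $s$-fold tensor product on which a matrix acts, and the trace is taken over all $s$ copies. Then each $\vartheta_m$ can be written in a unique way as $$\vartheta_m=\vartheta_m^{(0)}\partial_u^m+\dots+\vartheta_m^{(m-1)}\partial_u+\vartheta_m^{(m)},\qquad \vartheta_m^{(k)}\in \mathrm{U}(\widehat{\mathfrak g}^{+})[[u]],$$ and the coefficients of all power series $\vartheta_m^{(k)}$ with $m\ge1$ and $0\le k\le m$ generate a commutative subalgebra of $\mathrm{U}(\widehat{\mathfrak g}^{+})$.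 -/

import Mathlib

open scoped Kronecker

attribute [local instance] LieRing.ofAssociativeRing

noncomputable section

namespace TrigGaudin

/-- The Lie algebra `ĝ⁺ = 𝔟⁺ ⊕ t⁻¹ 𝔤𝔩_N[t⁻¹]`, as a Lie subalgebra of
`𝔤𝔩_N[t⁻¹] = Mat_N(ℂ[t⁻¹])` (the polynomial variable is `t⁻¹`) with the commutator bracket:
the matrices whose constant term is upper triangular. -/
def gHatPlus (N : ℕ) : LieSubalgebra ℂ (Matrix (Fin N) (Fin N) (Polynomial ℂ)) where
  carrier := {A | ∀ i j, j < i → (A i j).coeff 0 = 0}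
  zero_mem' := by intro i j _; simp
  add_mem' := by
    intro A B hA hB i j h
    simp [hA i j h, hB i j h]
  smul_mem' := by
    intro c A hA i j h
    simp [hA i j h]
  lie_mem' := by
    intro A B hA hB i j h
    have key : ∀ C D : Matrix (Fin N) (Fin N) (Polynomial ℂ),
        (∀ i j, j < i → (C i j).coeff 0 = 0) → (∀ i j, j < i → (D i j).coeff 0 = 0) →
        ((C * D) i j).coeff 0 = 0 := by
      intro C D hC hD
      rw [Matrix.mul_apply, Polynomial.finsetSum_coeff]
      refine Finset.sum_eq_zero fun k _ => ?_
      rw [Polynomial.mul_coeff_zero]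
      rcases lt_or_ge k i with hk | hk
      · simp [hC i k hk]
      · simp [hD k j (lt_of_lt_of_le h hk)]
    rw [Ring.lie_def, Matrix.sub_apply, Polynomial.coeff_sub, key A B hA hB, key B A hB hA,
      sub_zero]

/-- The universal enveloping algebra `U(ĝ⁺)`. -/
abbrev UPlus (N : ℕ) : Type := UniversalEnvelopingAlgebra ℂ (gHatPlus N)

/-- The scalar by which `E_{ij} t⁻ⁿ` is multiplied in `𝓛⁺_{ij}[-n]`:
`-2` for `n ≥ 1`, and `-(1 + sgn(j - i))` for `n = 0`. -/
def lScalar {N : ℕ} (i j : Fin N) (n : ℕ) : ℂ :=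
  if n = 0 then -(1 + ((Int.sign ((j : ℤ) - (i : ℤ)) : ℤ) : ℂ)) else -2

theorem lScalar_mem {N : ℕ} (i j : Fin N) (n : ℕ) :
    lScalar i j n • Matrix.single i j ((Polynomial.X : Polynomial ℂ) ^ n) ∈ gHatPlus N := by
  intro k l h
  rw [Matrix.smul_apply, Polynomial.coeff_smul]
  by_cases hkl : i = k ∧ j = l
  · obtain ⟨rfl, rfl⟩ := hkl
    rcases Nat.eq_zero_or_pos n with rfl | hn
    · have : Int.sign ((j : ℤ) - (i : ℤ)) = -1 :=
        Int.sign_eq_neg_one_of_neg (by have : (j : ℕ) < i := h; omega)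
      simp [lScalar, this]
    · simp [Polynomial.coeff_X_pow, hn.ne]
  · rw [Matrix.single_apply_of_ne (h := hkl)]
    simp

/-- `𝓛⁺_{ij}[-n]`, as an element of `ĝ⁺`. -/
def lMode {N : ℕ} (i j : Fin N) (n : ℕ) : gHatPlus N :=
  ⟨lScalar i j n • Matrix.single i j ((Polynomial.X : Polynomial ℂ) ^ n), lScalar_mem i j n⟩

/-- The matrix `𝓛⁺(u)`, with entries `𝓛⁺_{ij}(u) = ∑_{n ≥ 0} 𝓛⁺_{ij}[-n] uⁿ` in `U(ĝ⁺)[[u]]`. -/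
def Lplus (N : ℕ) : Matrix (Fin N) (Fin N) (PowerSeries (UPlus N)) :=
  Matrix.of fun i j => PowerSeries.mk fun n => UniversalEnvelopingAlgebra.ι ℂ (lMode i j n)

section DiffOp

variable (A : Type) [Ring A] [Algebra ℂ A]

/-- Differential operators in `u` with coefficients in `A[[u]]` are realized by their (faithful)
action on `A[[u]]`; they are multiplied in the algebra of `ℂ`-linear operators on `A[[u]]`. -/
abbrev Op : Type := Module.End ℂ (PowerSeries A)

/-- The operator of left multiplication by a power series `f(u)`. -/
def mulOp (f : PowerSeries A) : Op A := LinearMap.mulLeft ℂ f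

/-- The derivation `∂_u`. -/
def dOp : Op A where
  toFun f := PowerSeries.mk fun n => (n + 1) • PowerSeries.coeff (n + 1) f
  map_add' f g := by ext n; simp [smul_add]
  map_smul' c f := by ext n; simp [smul_comm]

/-- The differential operator `c₀(u) ∂_u^m + ⋯ + c_{m-1}(u) ∂_u + c_m(u)`. -/
def diffOp {m : ℕ} (c : Fin (m + 1) → PowerSeries A) : Op A :=
  ∑ k : Fin (m + 1), mulOp A (c k) * dOp A ^ (m - (k : ℕ))

end DiffOp

/-- The diagonal entries `N-1, N-3, …, -N+1` of `ρ` (the indices of `Fin N` start from `0`). -/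
def rho (N : ℕ) (i : Fin N) : ℂ := (N : ℂ) - 1 - 2 * ((i : ℕ) : ℂ)

/-- The matrix `𝓛̄ = 2u∂_u - ρ - 𝓛⁺(u)` of differential operators. -/
def Lbar (N : ℕ) : Matrix (Fin N) (Fin N) (Op (UPlus N)) :=
  Matrix.diagonal (fun _ => (2 : ℂ) • (mulOp (UPlus N) PowerSeries.X * dOp (UPlus N)))
    - Matrix.diagonal (fun i => algebraMap ℂ (Op (UPlus N)) (rho N i))
    - (Lplus N).map (mulOp (UPlus N))

/-- The function `T(y)`, expanded as a power series in `y`, with values in `End ℂ^N ⊗ End ℂ^N`. -/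
def T (N : ℕ) : Matrix (Fin N × Fin N) (Fin N × Fin N) (PowerSeries ℂ) :=
  (∑ i : Fin N, Matrix.single i i 1 ⊗ₖ Matrix.single i i 1)
  + (1 - PowerSeries.X : PowerSeries ℂ)⁻¹ •
      (∑ p : Fin N × Fin N with p.1 < p.2,
        Matrix.single p.1 p.2 1 ⊗ₖ Matrix.single p.2 p.1 1)
  + (1 + PowerSeries.X : PowerSeries ℂ)⁻¹ •
      (∑ p : Fin N × Fin N with p.2 < p.1,
        Matrix.single p.1 p.2 1 ⊗ₖ Matrix.single p.2 p.1 1)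

section Sites

variable {R : Type} [Semiring R] {N s : ℕ}

/-- `M_a`: the matrix `M` acting in the `a`-th tensor factor of `(ℂ^N)^{⊗s}`, and as the identity
in the other factors. Elements of `(End ℂ^N)^{⊗s} ⊗ R` are matrices over `R` indexed by the basis
`e_{p 0} ⊗ ⋯ ⊗ e_{p (s-1)}` of `(ℂ^N)^{⊗s}`. -/
def site (a : Fin s) (M : Matrix (Fin N) (Fin N) R) :
    Matrix (Fin s → Fin N) (Fin s → Fin N) R :=
  Matrix.of fun p q => if ∀ c, c ≠ a → p c = q c then M (p a) (q a) else 0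

/-- `M_{ab}`: the element `M` of `End ℂ^N ⊗ End ℂ^N ⊗ R` acting in the `a`-th and `b`-th tensor
factors, and as the identity in the other factors. -/
def site₂ (a b : Fin s) (M : Matrix (Fin N × Fin N) (Fin N × Fin N) R) :
    Matrix (Fin s → Fin N) (Fin s → Fin N) R :=
  Matrix.of fun p q =>
    if ∀ c, c ≠ a → c ≠ b → p c = q c then M (p a, p b) (q a, q b) else 0

end Sites

/-- For `s = r + 1` tensor factors, the power series in `y`
`tr_{1,…,s} T_{s-1 s}(y) ⋯ T_{12}(y) 𝓛̄_1 ⋯ 𝓛̄_s`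
whose coefficients are differential operators. -/
def traceSeries (N r : ℕ) : PowerSeries (Op (UPlus N)) :=
  Matrix.trace
    ((((List.finRange r).reverse.map fun a : Fin r =>
        site₂ a.castSucc a.succ
          ((T N).map (PowerSeries.map (algebraMap ℂ (Op (UPlus N)))))).prod)
      * ((List.finRange (r + 1)).map fun a : Fin (r + 1) =>
        site a ((Lbar N).map (PowerSeries.C (R := Op (UPlus N))))).prod)

/-- The differential operator `ϑ_m`: the coefficient of `y^m` in the generating function
`∑_{s ≥ 1} y^s tr_{1,…,s} T_{s-1 s}(y) ⋯ T_{12}(y) 𝓛̄_1 ⋯ 𝓛̄_s`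
(the terms with `s > m` do not contribute). -/
def vartheta (N m : ℕ) : Op (UPlus N) :=
  ∑ s ∈ Finset.Icc 1 m,
    PowerSeries.coeff m (PowerSeries.X ^ s * traceSeries N (s - 1))

end TrigGaudin

end

/-! The operators ϑ_m are limits at h = 0 of commuting operators built from the trigonometric
R-matrix R(x, y) over ℂ[[h]], with q = 1 + h.

Suppose R(x, y) X_1(x) X_2(y) = X_2(y) X_1(x) R(x, y), and let A_m be the antisymmetrizer made of
the q-permutations P^q. The traces of A_m X_1(u) X_2(q²u) ⋯ X_m(q^{2(m-1)}u) commute with their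
analogues in a second variable v. Indeed the product of all R-matrices between two groups of sites
intertwines the two orders of multiplication, is invertible after localization, and is compatible
with both antisymmetrizers because R(x, q²x) is proportional to 1 - P^q (`commute_elemE`). Newton's
identities transfer commutativity to the power sums, where A_m is replaced by P^q_{m-1,m} ⋯ P^q_{12}
(`newton`, `commute_powSum_powSum`). If S is the shift g(u) ↦ g(q²u), then S X(u) = X(q²u) S, so the
power sums are traces of twisted powers of the operator matrix X(u)S.

Write S = 1 + hθ and X = 1 + hY, where θ specializes to 2u∂_u and Y to -ρ - 𝓛⁺(u). Then XS = 1 + hL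
with L = YS + θ, and L specializes to 𝓛̄. A resolvent identity writes h^m times the deformed ϑ_m as
a ℂ[[h]]-linear combination of the identity and the traces for 1 + hL (`smul_thetaGen_mem`); it
converts the twists q^{±1} of P^q into the factors 1/(1 ∓ y) of T(y). Cancelling h^m and setting h =
0 gives commutativity.

No quantization of U(ĝ⁺) itself is needed. A matrix X is exhibited in enough representations, the
tensor products of duals of evaluation representations: there X is a normalized product of
R-matrices R(a_i u, 1), with rows rescaled to produce ρ (`Quantization.fuse`,
`Quantization.seriesExchange`). These representations separate points of U(ĝ⁺)
(`eq_zero_of_quantized`). The proof avoids the Poincaré–Birkhoff–Witt theorem: the reduced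
coproduct, contracted with the generators, acts on elements of order d as -d modulo lower order
(`filt_le_goodSub`).

Commutativity is obtained for the coefficients of the values ϑ_m(u^j). Triangularity of these values
expresses the coefficients of every ϑ_m^{(k)} linearly through them (`coeff_mem_of_diffOp`). -/

namespace TrigGaudin

/-! ### Ordered products in a noncommutative ring -/

section OrderedProducts

variable {W : Type*} [Ring W]

/-- The ordered product `x 0 * x 1 * ⋯ * x (m - 1)`. -/
def prodUp (x : ℕ → W) : ℕ → W
  | 0 => 1
  | m + 1 => prodUp x m * x m

/-- The ordered product `x (m - 1) * ⋯ * x 1 * x 0`. -/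
def prodDown (x : ℕ → W) : ℕ → W
  | 0 => 1
  | m + 1 => x m * prodDown x m

theorem prodUp_congr {x y : ℕ → W} {m : ℕ} (h : ∀ a < m, x a = y a) :
    prodUp x m = prodUp y m := by
  induction m with
  | zero => rfl
  | succ m ih => rw [prodUp, prodUp, ih fun a ha => h a (by omega), h m (by omega)]

theorem prodDown_congr {x y : ℕ → W} {m : ℕ} (h : ∀ a < m, x a = y a) :
    prodDown x m = prodDown y m := by
  induction m with
  | zero => rfl
  | succ m ih => rw [prodDown, prodDown, ih fun a ha => h a (by omega), h m (by omega)]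

theorem prodUp_add (x : ℕ → W) (m l : ℕ) :
    prodUp x (m + l) = prodUp x m * prodUp (fun a => x (m + a)) l := by
  induction l with
  | zero => simp [prodUp]
  | succ l ih => rw [← add_assoc, prodUp, ih, prodUp, mul_assoc]

theorem map_prodUp {W' : Type*} [Ring W'] (f : W →+* W') (x : ℕ → W) (m : ℕ) :
    f (prodUp x m) = prodUp (fun a => f (x a)) m := by
  induction m with
  | zero => simp [prodUp]
  | succ m ih => simp [prodUp, ih]

theorem map_prodDown {W' : Type*} [Ring W'] (f : W →+* W') (x : ℕ → W) (m : ℕ) :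
    f (prodDown x m) = prodDown (fun a => f (x a)) m := by
  induction m with
  | zero => simp [prodDown]
  | succ m ih => simp [prodDown, ih]

theorem commute_prodUp {x : ℕ → W} {z : W} {m : ℕ} (h : ∀ a < m, Commute z (x a)) :
    Commute z (prodUp x m) := by
  induction m with
  | zero => exact Commute.one_right z
  | succ m ih => exact (ih fun a ha => h a (by omega)).mul_right (h m (by omega))

theorem commute_prodDown {x : ℕ → W} {z : W} {m : ℕ} (h : ∀ a < m, Commute z (x a)) :
    Commute z (prodDown x m) := by
  induction m with
  | zero => exact Commute.one_right z
  | succ m ih => exact (h m (by omega)).mul_right (ih fun a ha => h a (by omega))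

/-- A relation between neighbouring factors extends to the whole ordered product. -/
theorem sub_prodUp_add {x : ℕ → W} {s : W} {m j : ℕ} (hj : j + 1 < m)
    (hc : ∀ a < m, a ≠ j → a ≠ j + 1 → Commute s (x a))
    (h : (1 - s) * (x j * x (j + 1)) * (1 + s) = 0) :
    (1 - s) * prodUp x m * (1 + s) = 0 := by
  induction m with
  | zero => omega
  | succ m ih =>
    rcases Nat.lt_or_ge (j + 1) m with hm | hm
    · have hx : Commute (1 + s) (x m) :=
        (Commute.one_left _).add_left (hc m (by omega) (by omega) (by omega))
      rw [prodUp, mul_assoc, mul_assoc, ← hx.eq, ← mul_assoc, ← mul_assoc,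
        ih hm fun a ha => hc a (by omega), zero_mul]
    · obtain rfl : m = j + 1 := by omega
      have hx : Commute (1 - s) (prodUp x j) :=
        (Commute.one_left _).sub_left
          (commute_prodUp fun a ha => hc a (by omega) (by omega) (by omega))
      rw [prodUp, prodUp, mul_assoc (prodUp x j), ← mul_assoc (1 - s), hx.eq, mul_assoc, mul_assoc,
        ← mul_assoc (1 - s), h, mul_zero]

theorem sub_prodDown_add {x : ℕ → W} {s : W} {m j : ℕ} (hj : j + 1 < m)
    (hc : ∀ a < m, a ≠ j → a ≠ j + 1 → Commute s (x a))
    (h : (1 - s) * (x (j + 1) * x j) * (1 + s) = 0) :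
    (1 - s) * prodDown x m * (1 + s) = 0 := by
  induction m with
  | zero => omega
  | succ m ih =>
    rcases Nat.lt_or_ge (j + 1) m with hm | hm
    · have hx : Commute (1 - s) (x m) :=
        (Commute.one_left _).sub_left (hc m (by omega) (by omega) (by omega))
      rw [prodDown, ← mul_assoc, hx.eq, mul_assoc, mul_assoc, ← mul_assoc (1 - s),
        ih hm fun a ha => hc a (by omega), mul_zero]
    · obtain rfl : m = j + 1 := by omega
      have hx : Commute (1 + s) (prodDown x j) :=
        (Commute.one_left _).add_left
          (commute_prodDown fun a ha => hc a (by omega) (by omega) (by omega))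
      rw [prodDown, prodDown, ← mul_assoc (x (j + 1)), ← mul_assoc (1 - s), mul_assoc, ← hx.eq,
        ← mul_assoc, h, zero_mul]

/-- One factor `y` is carried past a whole row: each `r a` exchanges `y` with `x a` and commutes
with the other `x c`, so the exchanges can be performed one at a time. -/
theorem prodUp_intertwine {r x : ℕ → W} {y : W} {m : ℕ}
    (h : ∀ a < m, r a * x a * y = y * x a * r a)
    (hc : ∀ a < m, ∀ c < m, c ≠ a → Commute (r a) (x c)) :
    prodUp r m * prodUp x m * y = y * prodUp x m * prodUp r m := by
  induction m with
  | zero => simp [prodUp]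
  | succ m ih =>
    have ih' := ih (fun a ha => h a (by omega)) fun a ha c hc' => hc a (by omega) c (by omega)
    have h1 : Commute (r m) (prodUp x m) :=
      commute_prodUp fun a ha => hc m (by omega) a (by omega) (by omega)
    have h2 : Commute (x m) (prodUp r m) :=
      commute_prodUp fun a ha => (hc a (by omega) m (by omega) (by omega)).symm
    calc prodUp r m * r m * (prodUp x m * x m) * y
        = prodUp r m * (r m * prodUp x m) * x m * y := by noncomm_ring
      _ = prodUp r m * prodUp x m * (r m * x m * y) := by rw [h1.eq]; noncomm_ring
      _ = prodUp r m * prodUp x m * y * (x m * r m) := by rw [h m (by omega)]; noncomm_ring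
      _ = y * prodUp x m * (prodUp r m * x m) * r m := by rw [ih']; noncomm_ring
      _ = y * (prodUp x m * x m) * (prodUp r m * r m) := by rw [← h2.eq]; noncomm_ring

/-- The companion of `prodUp_intertwine`, with `z` a whole row and the `y b` crossing it one after
another. Together they produce the double product of R-matrices that exchanges two groups of sites.
-/
theorem prodDown_intertwine {r y : ℕ → W} {z : W} {l : ℕ}
    (h : ∀ b < l, r b * z * y b = y b * z * r b)
    (hc : ∀ b < l, ∀ d < l, d ≠ b → Commute (r b) (y d)) :
    prodDown r l * z * prodUp y l = prodUp y l * z * prodDown r l := by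
  induction l with
  | zero => simp [prodUp, prodDown]
  | succ l ih =>
    have ih' := ih (fun a ha => h a (by omega)) fun a ha c hc' => hc a (by omega) c (by omega)
    have h1 : Commute (r l) (prodUp y l) :=
      commute_prodUp fun a ha => hc l (by omega) a (by omega) (by omega)
    have h2 : Commute (y l) (prodDown r l) :=
      commute_prodDown fun a ha => (hc a (by omega) l (by omega) (by omega)).symm
    calc r l * prodDown r l * z * (prodUp y l * y l)
        = r l * (prodDown r l * z * prodUp y l) * y l := by noncomm_ring
      _ = r l * prodUp y l * z * (prodDown r l * y l) := by rw [ih']; noncomm_ring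
      _ = prodUp y l * (r l * z * y l) * prodDown r l := by rw [h1.eq, ← h2.eq]; noncomm_ring
      _ = prodUp y l * y l * z * (r l * prodDown r l) := by rw [h l (by omega)]; noncomm_ring

/-- If the `r`'s with distinct indices commute with the `t`'s, the product of two ordered products
is the ordered product of the products. -/
theorem prodUp_mul_prodUp {r t : ℕ → W} {m : ℕ}
    (hc : ∀ a < m, ∀ c < m, c ≠ a → Commute (r a) (t c)) :
    prodUp r m * prodUp t m = prodUp (fun a => r a * t a) m := by
  induction m with
  | zero => simp [prodUp]
  | succ m ih =>
    have h1 : Commute (r m) (prodUp t m) :=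
      commute_prodUp fun a ha => hc m (by omega) a (by omega) (by omega)
    rw [prodUp, prodUp, prodUp, ← ih fun a ha c hc' => hc a (by omega) c (by omega), mul_assoc,
      ← mul_assoc (r m), h1.eq]
    noncomm_ring

theorem prodUp_semiconj {s : W} {x y : ℕ → W} {m : ℕ} (h : ∀ a < m, s * x a = y a * s) :
    s * prodUp x m = prodUp y m * s := by
  induction m with
  | zero => simp [prodUp]
  | succ m ih =>
    rw [prodUp, prodUp, ← mul_assoc, ih fun a ha => h a (by omega), mul_assoc, h m (by omega),
      mul_assoc]

end OrderedProducts

/-! ### The antisymmetrizer from Coxeter relations, and fusion -/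

section Antisymmetrizer

variable {W : Type*} [Ring W] [Algebra ℚ W]

/-- The defining relations of the symmetric group on `n` letters for the adjacent
transpositions `s 0, …, s (n - 2)`. -/
structure IsCoxeter (s : ℕ → W) (n : ℕ) : Prop where
  sq : ∀ j, j + 1 < n → s j * s j = 1
  braid : ∀ j, j + 2 < n → s j * s (j + 1) * s j = s (j + 1) * s j * s (j + 1)
  comm : ∀ i j, i + 1 < j → j + 1 < n → Commute (s i) (s j)

/-- The image of the (normalized) antisymmetrizer of the symmetric group on `k` letters. -/
def asym (s : ℕ → W) : ℕ → W
  | 0 => 1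
  | k + 1 => ((k : ℚ) + 1)⁻¹ • (asym s k - (k : ℚ) • (asym s k * s (k - 1) * asym s k))

theorem asym_one (s : ℕ → W) : asym s 1 = 1 := by simp [asym]

theorem succ_smul_asym (s : ℕ → W) (k : ℕ) :
    ((k : ℚ) + 1) • asym s (k + 1) =
      asym s k - (k : ℚ) • (asym s k * s (k - 1) * asym s k) := by
  rw [asym, smul_smul, mul_inv_cancel₀ (by positivity), one_smul]

theorem map_asym {W' : Type*} [Ring W'] [Algebra ℚ W'] (f : W →+* W') (s : ℕ → W) (k : ℕ) :
    f (asym s k) = asym (fun j => f (s j)) k := by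
  induction k with
  | zero => simp [asym]
  | succ k ih =>
    rw [asym, asym, map_rat_smul, map_sub, map_rat_smul, map_mul, map_mul, ih]

theorem asym_congr {s t : ℕ → W} {k : ℕ} (h : ∀ j, j + 1 < k → s j = t j) :
    asym s k = asym t k := by
  induction k with
  | zero => rfl
  | succ k ih =>
    rw [asym, asym, ih fun j hj => h j (by omega)]
    rcases k with _ | k
    · simp
    · rw [Nat.add_sub_cancel, h k (by omega)]

theorem commute_asym {s : ℕ → W} {z : W} {k : ℕ} (h : ∀ j, j + 1 < k → Commute z (s j)) :
    Commute z (asym s k) := by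
  induction k with
  | zero => exact Commute.one_right z
  | succ k ih =>
    have ih' := ih fun j hj => h j (by omega)
    rw [asym]
    rcases k with _ | k
    · simp [asym]
    · refine ((ih'.sub_right ?_).smul_right _)
      exact ((ih'.mul_right (h k (by omega))).mul_right ih').smul_right _

theorem inv_smul_add_smul (k : ℕ) (z : W) : ((k : ℚ) + 1)⁻¹ • (z + (k : ℚ) • z) = z := by
  rw [← one_smul ℚ z, smul_smul, mul_one, ← add_smul, smul_smul, add_comm (1 : ℚ),
    inv_mul_cancel₀ (by positivity)]

/-- Once `z` absorbs the antisymmetrizer on `k` letters, the sign turns the recursion into `(z + k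
z)/(k + 1) = z`. This fixes the normalization and yields idempotency. -/
theorem mul_asym_of_mul_eq_neg {s : ℕ → W} {z : W} {k : ℕ}
    (h : ∀ j, j + 1 < k → z * s j = -z) : z * asym s k = z := by
  induction k with
  | zero => simp [asym]
  | succ k ih =>
    have ih' := ih fun j hj => h j (by omega)
    rw [asym, mul_smul_comm, mul_sub, mul_smul_comm, ← mul_assoc, ← mul_assoc, ih']
    rcases k with _ | k
    · simp
    · rw [Nat.add_sub_cancel, h k (by omega), neg_mul, ih', smul_neg, sub_neg_eq_add,
        inv_smul_add_smul]

theorem asym_mul_of_mul_eq_neg {s : ℕ → W} {z : W} {k : ℕ}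
    (h : ∀ j, j + 1 < k → s j * z = -z) : asym s k * z = z := by
  induction k with
  | zero => simp [asym]
  | succ k ih =>
    have ih' := ih fun j hj => h j (by omega)
    rw [asym, smul_mul_assoc, sub_mul, smul_mul_assoc, mul_assoc, ih', mul_assoc]
    rcases k with _ | k
    · simp [asym]
    · rw [Nat.add_sub_cancel, h k (by omega), mul_neg, ih', smul_neg, sub_neg_eq_add,
        inv_smul_add_smul]

/-- The recursion only involves the newest transposition, so antisymmetry in the old ones is
inherited from the outer factors, and the newest needs the braid relation. The left and right
statements are proved together, since absorption on both sides is used in the induction. -/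
theorem IsCoxeter.asym_mul_and_mul_asym {s : ℕ → W} {n : ℕ} (hs : IsCoxeter s n) {k : ℕ}
    (hk : k ≤ n) :
    ∀ j, j + 1 < k → asym s k * s j = -asym s k ∧ s j * asym s k = -asym s k := by
  induction k using Nat.strong_induction_on with
  | _ k ih =>
    rcases k with _ | _ | l
    · intro j hj; omega
    · intro j hj; omega
    have ihA := ih (l + 1) (by omega) (by omega)
    have ihB := ih l (by omega) (by omega)
    set A := asym s (l + 1) with hA
    set B := asym s l with hB
    have hrec := succ_smul_asym s l
    rw [← hA, ← hB] at hrec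
    have hrec2 := succ_smul_asym s (l + 1)
    rw [← hA, Nat.add_sub_cancel, Nat.cast_add, Nat.cast_one] at hrec2
    have hAA : A * A = A := mul_asym_of_mul_eq_neg fun j hj => (ihA j hj).1
    have hAB : A * B = A := mul_asym_of_mul_eq_neg fun j hj => (ihA j (by omega)).1
    have hBA : B * A = A := asym_mul_of_mul_eq_neg fun j hj => (ihA j (by omega)).2
    have hinj : ∀ z w : W, ((l : ℚ) + 1 + 1) • z = ((l : ℚ) + 1 + 1) • w → z = w := fun z w h => by
      have := congrArg (fun t => ((l : ℚ) + 1 + 1)⁻¹ • t) h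
      simpa [smul_smul, inv_mul_cancel₀ (show (l : ℚ) + 1 + 1 ≠ 0 by positivity)] using this
    intro j hj
    rcases Nat.lt_or_ge (j + 1) (l + 1) with hjl | hjl
    · obtain ⟨h1, h2⟩ := ihA j hjl
      constructor
      · apply hinj
        rw [← smul_mul_assoc, smul_neg, hrec2, sub_mul, smul_mul_assoc, mul_assoc (A * s l), h1]
        simp only [mul_neg, smul_neg]
        abel
      · apply hinj
        rw [← mul_smul_comm, smul_neg, hrec2, mul_sub, mul_smul_comm, ← mul_assoc, ← mul_assoc, h2]
        simp only [neg_mul, smul_neg]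
        abel
    · obtain rfl : j = l := by omega
      set t := s j
      have hsq : t * t = 1 := hs.sq j (by omega)
      have hcB : t * B = B * t :=
        (commute_asym fun i hi => (hs.comm i j (by omega) (by omega)).symm).eq
      -- The right-hand `A` is expanded one level down; `B` commutes with `t` and is absorbed by the
      -- `A` on the left.
      have key1 : ((j : ℚ) + 1) • (A * t * A) =
          A * t - (j : ℚ) • (A * t * s (j - 1) * B) := by
        rw [← mul_smul_comm, hrec, mul_sub, mul_smul_comm, mul_assoc A t, hcB, ← mul_assoc, hAB]
        congr 2
        rw [← mul_assoc, ← mul_assoc, mul_assoc A t, hcB, ← mul_assoc, hAB]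
      have key1' : ((j : ℚ) + 1) • (A * t * A) =
          t * A - (j : ℚ) • (B * s (j - 1) * t * A) := by
        rw [mul_assoc, ← smul_mul_assoc, hrec, sub_mul, smul_mul_assoc, ← mul_assoc, ← hcB,
          mul_assoc t, hBA]
        congr 2
        rw [mul_assoc _ B, ← mul_assoc B t, ← hcB, mul_assoc t, hBA, mul_assoc (B * s (j - 1))]
      -- By the braid relation the extra `t` becomes an `s (j - 1)` next to `A`, which gives a sign.
      -- For `j = 0` the coefficient vanishes, so the truncated subtraction does no harm.
      have key2 : (j : ℚ) • (A * t * s (j - 1) * B * t) = -((j : ℚ) • (A * t * s (j - 1) * B)) := by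
        rcases j with _ | i
        · simp
        · have hb := hs.braid i (by omega)
          have hi := (ihA i (by omega)).1
          rw [Nat.add_sub_cancel, mul_assoc _ B, ← hcB, ← mul_assoc, mul_assoc A, mul_assoc A,
            ← hb, ← mul_assoc A, ← mul_assoc A, hi, ← smul_neg]
          simp only [neg_mul, mul_assoc]
          rfl
      have key2' : (j : ℚ) • (t * (B * s (j - 1) * t * A)) = -((j : ℚ) • (B * s (j - 1) * t * A)) := by
        rcases j with _ | i
        · simp
        · have hb := hs.braid i (by omega)
          have hi := (ihA i (by omega)).2
          rw [Nat.add_sub_cancel]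
          have : t * (B * s i * t * A) = B * (t * s i * t) * A := by
            rw [← mul_assoc, ← mul_assoc, ← mul_assoc, hcB]; noncomm_ring
          rw [this, ← hb, mul_assoc B, mul_assoc _ _ A, hi, ← smul_neg]
          congr 1
          simp only [mul_neg, ← mul_assoc]
          rfl
      constructor
      · apply hinj
        rw [← smul_mul_assoc, smul_neg, hrec2, sub_mul, key1, sub_mul, smul_mul_assoc, key2,
          mul_assoc A t t, hsq, mul_one]
        abel
      · apply hinj
        rw [← mul_smul_comm, smul_neg, hrec2, mul_sub, key1', mul_sub, mul_smul_comm, key2',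
          ← mul_assoc t t, hsq, one_mul]
        abel

theorem IsCoxeter.asym_mul {s : ℕ → W} {n k : ℕ} (hs : IsCoxeter s n) (hk : k ≤ n) {j : ℕ}
    (hj : j + 1 < k) : asym s k * s j = -asym s k :=
  (hs.asym_mul_and_mul_asym hk j hj).1

theorem IsCoxeter.asym_mul_asym {s : ℕ → W} {n k : ℕ} (hs : IsCoxeter s n) (hk : k ≤ n) :
    asym s k * asym s k = asym s k :=
  mul_asym_of_mul_eq_neg fun _ hj => hs.asym_mul hk hj

/-- The fusion property of the antisymmetrizer. -/
theorem IsCoxeter.asym_mul_eq {s : ℕ → W} {n k : ℕ} (hs : IsCoxeter s n) (hk : k ≤ n) {x : W}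
    (h : ∀ j, j + 1 < k → (1 - s j) * x * (1 + s j) = 0) :
    asym s k * x = asym s k * x * asym s k := by
  refine (mul_asym_of_mul_eq_neg fun j hj => ?_).symm
  -- Since `asym s k` is half of `asym s k * (1 - s j)`, the hypothesis kills `asym s k * x * (1 + s
  -- j)`; hence `asym s k * x` is itself antisymmetric on the right and absorbs the antisymmetrizer.
  have h1 : (2 : ℚ) • asym s k = asym s k * (1 - s j) := by
    rw [mul_sub, hs.asym_mul hk hj, mul_one, sub_neg_eq_add, two_smul]
  have h2 : (2 : ℚ) • (asym s k * x * (1 + s j)) = 0 := by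
    rw [← smul_mul_assoc, ← smul_mul_assoc, h1, mul_assoc, mul_assoc, ← mul_assoc (1 - s j), h j hj,
      mul_zero]
  have h3 : asym s k * x * (1 + s j) = 0 := by
    simpa [smul_smul] using congrArg (fun t => (2 : ℚ)⁻¹ • t) h2
  rw [mul_add, mul_one] at h3
  exact eq_neg_of_add_eq_zero_right h3

end Antisymmetrizer

end TrigGaudin

namespace TrigGaudin

/-! ### Operators on tensor products, acting by updates of coordinates -/

section Sites

variable {N n : ℕ}

/-- Identities between site operators are checked on vectors: a site operator then only updates a
few coordinates of the multi-index, and no large matrix product has to be expanded. -/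
theorem ext_of_mulVec {ι B : Type*} [Fintype ι] [DecidableEq ι] [Ring B] {M M' : Matrix ι ι B}
    (h : ∀ f : ι → B, M.mulVec f = M'.mulVec f) : M = M' := by
  ext p q
  simpa using congrFun (h (Pi.single q 1)) p

variable {B : Type} [Ring B]

theorem site_mulVec (a : Fin n) (X : Matrix (Fin N) (Fin N) B) (f : (Fin n → Fin N) → B)
    (p : Fin n → Fin N) :
    (site a X).mulVec f p = ∑ k, X (p a) k * f (Function.update p a k) := by
  rw [Matrix.mulVec, dotProduct]
  symm
  refine Finset.sum_of_injOn (fun k => Function.update p a k)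
    (fun k _ l _ h => Function.update_injective p a h) (fun _ _ => Finset.mem_coe.2 (Finset.mem_univ _)) ?_ ?_
  · intro r _ hr
    rw [site, Matrix.of_apply, if_neg, zero_mul]
    intro h
    refine hr ⟨r a, by simp, ?_⟩
    ext1 c
    by_cases hc : c = a
    · subst hc; simp
    · simp [hc, h c hc]
  · intro k _
    rw [site, Matrix.of_apply, if_pos]
    · simp
    · intro c hc
      simp [hc]

theorem site₂_mulVec {a b : Fin n} (hab : a ≠ b) (M : Matrix (Fin N × Fin N) (Fin N × Fin N) B)
    (f : (Fin n → Fin N) → B) (p : Fin n → Fin N) :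
    (site₂ a b M).mulVec f p = ∑ k : Fin N × Fin N,
      M (p a, p b) k * f (Function.update (Function.update p a k.1) b k.2) := by
  rw [Matrix.mulVec, dotProduct]
  symm
  refine Finset.sum_of_injOn (fun k : Fin N × Fin N => Function.update (Function.update p a k.1) b k.2)
    ?_ (fun _ _ => Finset.mem_coe.2 (Finset.mem_univ _)) ?_ ?_
  · intro k _ l _ h
    have h1 := congrFun h a
    have h2 := congrFun h b
    simp only [Function.update_of_ne hab, Function.update_self] at h1 h2
    exact Prod.ext h1 h2
  · intro r _ hr
    rw [site₂, Matrix.of_apply, if_neg, zero_mul]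
    intro h
    refine hr ⟨(r a, r b), by simp, ?_⟩
    ext1 c
    by_cases hc : c = b
    · subst hc; simp
    by_cases hc' : c = a
    · subst hc'; simp [hc]
    · simp [hc, hc', h c hc' hc]
  · intro k _
    rw [site₂, Matrix.of_apply, if_pos]
    · simp [Function.update_of_ne hab]
    · intro c hc hc'
      simp [hc', hc]

/-- The two-site operator `e_i ⊗ e_j ↦ A_{ij} e_i ⊗ e_j + ⋯` of six-vertex type. -/
def ice (A C : Fin N → Fin N → B) : Matrix (Fin N × Fin N) (Fin N × Fin N) B :=
  Matrix.of fun p r =>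
    (if r = p then A p.1 p.2 else 0) + (if r = p.swap then C p.1 p.2 else 0)

theorem ice_mulVec {a b : Fin n} (hab : a ≠ b) (A C : Fin N → Fin N → B)
    (f : (Fin n → Fin N) → B) (p : Fin n → Fin N) :
    (site₂ a b (ice A C)).mulVec f p = A (p a) (p b) * f p +
      C (p a) (p b) * f (Function.update (Function.update p a (p b)) b (p a)) := by
  rw [site₂_mulVec hab]
  simp only [ice, Matrix.of_apply, add_mul, Finset.sum_add_distrib, ite_mul, zero_mul,
    Finset.sum_ite_eq', Finset.mem_univ, if_true, Prod.fst_swap, Prod.snd_swap]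
  simp

/-- The sites are disjoint, but over a noncommutative ring this is not enough: the six-vertex
coefficients must also commute with the entries of `X`. -/
theorem commute_ice_site {a b c : Fin n} (hab : a ≠ b) (hca : c ≠ a) (hcb : c ≠ b)
    {A C : Fin N → Fin N → B} (hA : ∀ i j z, Commute (A i j) z) (hC : ∀ i j z, Commute (C i j) z)
    (X : Matrix (Fin N) (Fin N) B) : Commute (site₂ a b (ice A C)) (site c X) := by
  refine ext_of_mulVec fun f => funext fun p => ?_
  rw [← Matrix.mulVec_mulVec, ← Matrix.mulVec_mulVec]
  simp only [site_mulVec, ice_mulVec hab, Function.update_of_ne hca.symm,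
    Function.update_of_ne hcb.symm, Function.update_of_ne hca, Function.update_of_ne hcb,
    mul_add, Finset.sum_add_distrib, Finset.mul_sum]
  congr 1 <;> refine Finset.sum_congr rfl fun k _ => ?_
  · rw [← mul_assoc, (hA _ _ _).eq, mul_assoc]
  · rw [← mul_assoc, (hC _ _ _).eq, mul_assoc, Function.update_comm hca,
      Function.update_comm hcb]

/-- The exchange relation `R X_1 Y_2 = Y_2 X_1 R` in terms of matrix entries. -/
def Exchange (A C : Fin N → Fin N → B) (X Y : Matrix (Fin N) (Fin N) B) : Prop :=
  ∀ i j k l, A i j * (X i k * Y j l) + C i j * (X j k * Y i l) =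
    A k l * (Y j l * X i k) + C l k * (Y j k * X i l)

theorem Exchange.site {a b : Fin n} (hab : a ≠ b)
    {A C : Fin N → Fin N → B} (hA : ∀ i j z, Commute (A i j) z) (hC : ∀ i j z, Commute (C i j) z)
    {X Y : Matrix (Fin N) (Fin N) B} (h : Exchange A C X Y) :
    site₂ a b (ice A C) * site a X * site b Y = site b Y * site a X * site₂ a b (ice A C) := by
  refine ext_of_mulVec fun f => funext fun p => ?_
  simp only [← Matrix.mulVec_mulVec, site_mulVec, ice_mulVec hab, Function.update_of_ne hab,
    Function.update_of_ne hab.symm, Function.update_self, Finset.mul_sum]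
  have e1 : ∀ k l, Function.update (Function.update (Function.update
      (Function.update p a (p b)) b (p a)) a k) b l = Function.update (Function.update p a k) b l := by
    intro k l
    rw [Function.update_comm hab.symm, Function.update_idem, Function.update_idem]
  have e2 : ∀ k l, Function.update (Function.update p b l) a k =
      Function.update (Function.update p a k) b l := fun k l => Function.update_comm hab.symm _ _ _
  simp only [e1, e2]
  have e3 : ∀ k l, Function.update (Function.update (Function.update (Function.update p a k) b l) a l) b k
      = Function.update (Function.update p a l) b k := by
    intro k l
    rw [Function.update_comm hab.symm, Function.update_idem, Function.update_idem]
  simp only [e3]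
  rw [Finset.sum_comm (s := Finset.univ) (t := Finset.univ) (f := fun l k => Y (p b) l * _)]
  rw [← Finset.sum_add_distrib]
  simp only [← Finset.sum_add_distrib]
  set F : Fin N → Fin N → B := fun k l => f (Function.update (Function.update p a k) b l) with hF
  have e4 : ∀ k l, f (Function.update (Function.update p a k) b l) = F k l := fun _ _ => rfl
  simp only [e4, mul_add, Finset.sum_add_distrib]
  rw [Finset.sum_comm (s := Finset.univ) (t := Finset.univ)
    (f := fun k l => Y (p b) l * (X (p a) k * (C k l * F l k)))]
  rw [← Finset.sum_add_distrib, ← Finset.sum_add_distrib]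
  refine Finset.sum_congr rfl fun k _ => ?_
  rw [← Finset.sum_add_distrib, ← Finset.sum_add_distrib]
  refine Finset.sum_congr rfl fun l _ => ?_
  have := congrArg (· * F k l) (h (p a) (p b) k l)
  simp only [add_mul] at this
  calc _ = A (p a) (p b) * (X (p a) k * Y (p b) l) * F k l
        + C (p a) (p b) * (X (p b) k * Y (p a) l) * F k l := by simp only [mul_assoc]
    _ = _ := by
      rw [this, (hA k l _).eq, (hC l k _).eq]
      simp only [mul_assoc]

end Sites

/-! ### The trigonometric R-matrix and the q-permutation operator -/

section RMatrix

variable {N n : ℕ} {S : Type} [CommRing S]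

/-- The diagonal coefficients of the trigonometric `R`-matrix. -/
def rA (q qi x y : S) (i j : Fin N) : S := if i = j then qi * y - q * x else y - x

/-- The off-diagonal coefficients of the trigonometric `R`-matrix. -/
def rC (q qi x y : S) (i j : Fin N) : S :=
  if i = j then 0 else if i < j then (qi - q) * y else (qi - q) * x

/-- The coefficients of the `q`-permutation operator. -/
def tC (q qi : S) (i j : Fin N) : S := if i = j then 1 else if i < j then q else qi

/-- The trigonometric `R`-matrix acting on the sites `a` and `b`. -/
def rSite (q qi : S) (a b : Fin n) (x y : S) : Matrix (Fin n → Fin N) (Fin n → Fin N) S :=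
  site₂ a b (ice (rA q qi x y) (rC q qi x y))

/-- The `q`-permutation operator acting on the sites `a` and `b`. -/
def sSite (q qi : S) (a b : Fin n) : Matrix (Fin n → Fin N) (Fin n → Fin N) S :=
  site₂ a b (ice (fun _ _ => 0) (tC q qi))

theorem sSite_mulVec (q qi : S) {a b : Fin n} (hab : a ≠ b) (f : (Fin n → Fin N) → S)
    (p : Fin n → Fin N) :
    (sSite q qi a b).mulVec f p = tC q qi (p a) (p b) *
      f (Function.update (Function.update p a (p b)) b (p a)) := by
  rw [sSite, ice_mulVec hab, zero_mul, zero_add]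

/-- Modification of three coordinates. -/
def upd3 (p : Fin n → Fin N) (a b c : Fin n) (i j k : Fin N) : Fin n → Fin N :=
  Function.update (Function.update (Function.update p a i) b j) c k

theorem upd3_self (p : Fin n → Fin N) {a b c : Fin n} :
    upd3 p a b c (p a) (p b) (p c) = p := by
  simp [upd3]

theorem ice_mulVec_upd3_ab {a b c : Fin n} (hab : a ≠ b) (hac : a ≠ c) (hbc : b ≠ c)
    (A C : Fin N → Fin N → S) (f : (Fin n → Fin N) → S) (p : Fin n → Fin N) (i j k : Fin N) :
    (site₂ a b (ice A C)).mulVec f (upd3 p a b c i j k) =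
      A i j * f (upd3 p a b c i j k) + C i j * f (upd3 p a b c j i k) := by
  have : Function.update (Function.update (upd3 p a b c i j k) a j) b i = upd3 p a b c j i k := by
    ext1 d
    simp only [upd3, Function.update_apply]
    split_ifs <;> simp_all
  rw [ice_mulVec hab]
  have ha : upd3 p a b c i j k a = i := by simp [upd3, hab, hac]
  have hb : upd3 p a b c i j k b = j := by simp [upd3, hbc]
  rw [ha, hb, this]

theorem ice_mulVec_upd3_ac {a b c : Fin n} (hab : a ≠ b) (hac : a ≠ c)
    (A C : Fin N → Fin N → S) (f : (Fin n → Fin N) → S) (p : Fin n → Fin N) (i j k : Fin N) :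
    (site₂ a c (ice A C)).mulVec f (upd3 p a b c i j k) =
      A i k * f (upd3 p a b c i j k) + C i k * f (upd3 p a b c k j i) := by
  have : Function.update (Function.update (upd3 p a b c i j k) a k) c i = upd3 p a b c k j i := by
    ext1 d
    simp only [upd3, Function.update_apply]
    split_ifs <;> simp_all
  rw [ice_mulVec hac]
  have ha : upd3 p a b c i j k a = i := by simp [upd3, hab, hac]
  have hc : upd3 p a b c i j k c = k := by simp [upd3]
  rw [ha, hc, this]

theorem ice_mulVec_upd3_bc {a b c : Fin n} (hbc : b ≠ c)
    (A C : Fin N → Fin N → S) (f : (Fin n → Fin N) → S) (p : Fin n → Fin N) (i j k : Fin N) :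
    (site₂ b c (ice A C)).mulVec f (upd3 p a b c i j k) =
      A j k * f (upd3 p a b c i j k) + C j k * f (upd3 p a b c i k j) := by
  have : Function.update (Function.update (upd3 p a b c i j k) b k) c j = upd3 p a b c i k j := by
    ext1 d
    simp only [upd3, Function.update_apply]
    split_ifs <;> simp_all
  rw [ice_mulVec hbc]
  have hb : upd3 p a b c i j k b = j := by simp [upd3, hbc]
  have hc : upd3 p a b c i j k c = k := by simp [upd3]
  rw [hb, hc, this]

theorem lt_cases {α : Type*} [LinearOrder α] (i j : α) :
    (i < j ∧ i ≠ j ∧ j ≠ i ∧ ¬ j < i) ∨ i = j ∨ (j < i ∧ i ≠ j ∧ j ≠ i ∧ ¬ i < j) := by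
  rcases lt_trichotomy i j with h | h | h
  · exact Or.inl ⟨h, h.ne, h.ne', h.not_gt⟩
  · exact Or.inr (Or.inl h)
  · exact Or.inr (Or.inr ⟨h, h.ne', h.ne, h.not_gt⟩)

/-- The Yang–Baxter equation applied to a vector `F` and read at one basis triple. The coefficients
depend only on the relative order of `i`, `j`, `k`, which leaves finitely many polynomial
identities. As `R` is homogeneous of degree one, the first factor may keep the arguments `x, y`
while the others carry `t`; thus `t` never has to be inverted, and `t = 0` is allowed. -/
theorem yang_baxter_scalar {q qi : S} (hq : q * qi = 1) (t x y z : S) (F : Fin N → Fin N → Fin N → S)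
    (i j k : Fin N) :
    rA q qi x y i j * (rA q qi (t * x) z i k * (rA q qi (t * y) z j k * F i j k
        + rC q qi (t * y) z j k * F i k j)
      + rC q qi (t * x) z i k * (rA q qi (t * y) z j i * F k j i + rC q qi (t * y) z j i * F k i j))
    + rC q qi x y i j * (rA q qi (t * x) z j k * (rA q qi (t * y) z i k * F j i k
        + rC q qi (t * y) z i k * F j k i)
      + rC q qi (t * x) z j k * (rA q qi (t * y) z i j * F k i j + rC q qi (t * y) z i j * F k j i))
    = rA q qi (t * y) z j k * (rA q qi (t * x) z i k * (rA q qi x y i j * F i j k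
        + rC q qi x y i j * F j i k)
      + rC q qi (t * x) z i k * (rA q qi x y k j * F k j i + rC q qi x y k j * F j k i))
    + rC q qi (t * y) z j k * (rA q qi (t * x) z i j * (rA q qi x y i k * F i k j
        + rC q qi x y i k * F k i j)
      + rC q qi (t * x) z i j * (rA q qi x y j k * F j k i + rC q qi x y j k * F k j i)) := by
  rcases lt_cases i j with ⟨hij, hij1, hij2, hij3⟩ | hij | ⟨hij, hij1, hij2, hij3⟩ <;>
    rcases lt_cases j k with ⟨hjk, hjk1, hjk2, hjk3⟩ | hjk | ⟨hjk, hjk1, hjk2, hjk3⟩ <;>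
    rcases lt_cases i k with ⟨hik, hik1, hik2, hik3⟩ | hik | ⟨hik, hik1, hik2, hik3⟩ <;>
    first
    | (exfalso; omega)
    | (try subst hij
       try subst hjk
       try subst hik
       simp only [rA, rC, if_true, if_false, *]
       grind)

theorem yang_baxter {q qi : S} (hq : q * qi = 1) {a b c : Fin n} (hab : a ≠ b) (hac : a ≠ c)
    (hbc : b ≠ c) (t x y z : S) :
    rSite (N := N) q qi a b x y * rSite q qi a c (t * x) z * rSite q qi b c (t * y) z =
      rSite q qi b c (t * y) z * rSite q qi a c (t * x) z * rSite q qi a b x y := by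
  refine ext_of_mulVec fun f => funext fun p => ?_
  rw [← upd3_self p (a := a) (b := b) (c := c)]
  simp only [← Matrix.mulVec_mulVec, rSite, ice_mulVec_upd3_ab hab hac hbc,
    ice_mulVec_upd3_ac hab hac, ice_mulVec_upd3_bc hbc]
  exact yang_baxter_scalar hq t x y z (fun i j k => f (upd3 p a b c i j k)) (p a) (p b) (p c)

/-- Unitarity. It makes every R-matrix invertible after localization, away from the points where the
scalar vanishes. -/
theorem rSite_mul_rSite {q qi : S} (hq : q * qi = 1) {a b : Fin n} (hab : a ≠ b) (x y : S) :
    rSite (N := N) q qi a b x y * rSite q qi b a y x =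
      ((qi * y - q * x) * (qi * x - q * y)) • 1 := by
  refine ext_of_mulVec fun f => funext fun p => ?_
  rw [← Matrix.mulVec_mulVec, Matrix.smul_mulVec, Matrix.one_mulVec, Pi.smul_apply, smul_eq_mul]
  have e : Function.update (Function.update (Function.update (Function.update p a (p b)) b (p a))
      b (p b)) a (p a) = p := by
    rw [Function.update_idem, Function.update_comm hab, Function.update_idem]
    simp
  simp only [rSite, ice_mulVec hab, ice_mulVec hab.symm, Function.update_of_ne hab,
    Function.update_self, e, Function.update_comm hab.symm (p a) (p b) p]
  generalize f p = F
  generalize f (Function.update (Function.update p a (p b)) b (p a)) = G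
  rcases lt_cases (p a) (p b) with ⟨hij, hij1, hij2, hij3⟩ | hij | ⟨hij, hij1, hij2, hij3⟩
  · simp only [rA, rC, if_false, if_true, *]
    grind
  · simp only [hij, rA, rC, if_true]
    ring
  · simp only [rA, rC, if_false, if_true, *]
    grind

/-- At `y = q² x` the diagonal entry `qi * y - q * x` vanishes and the R-matrix degenerates to a
multiple of `1 - P^q`. All fusion arguments rest on this point. -/
theorem rSite_eq_smul_one_sub {q qi : S} (hq : q * qi = 1) {a b : Fin n} (hab : a ≠ b) (x : S) :
    rSite (N := N) q qi a b x (q ^ 2 * x) = (x * (q ^ 2 - 1)) • (1 - sSite q qi a b) := by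
  refine ext_of_mulVec fun f => funext fun p => ?_
  rw [Matrix.smul_mulVec, Matrix.sub_mulVec, Matrix.one_mulVec, Pi.smul_apply, smul_eq_mul,
    Pi.sub_apply, sSite_mulVec _ _ hab, rSite, ice_mulVec hab]
  rcases lt_cases (p a) (p b) with ⟨hij, hij1, hij2, hij3⟩ | hij | ⟨hij, hij1, hij2, hij3⟩
  · simp only [rA, rC, tC, if_false, if_true, *]
    grind
  · have e : Function.update (Function.update p a (p b)) b (p a) = p := by
      rw [hij, ← hij]; simp only [Function.update_eq_self]; rw [hij]; simp
    rw [e]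
    simp only [rA, rC, tC, hij, if_true]
    grind
  · simp only [rA, rC, tC, if_false, if_true, *]
    grind

theorem sSite_mul_self {q qi : S} (hq : q * qi = 1) {a b : Fin n} (hab : a ≠ b) :
    sSite (N := N) q qi a b * sSite q qi a b = 1 := by
  refine ext_of_mulVec fun f => funext fun p => ?_
  have e : Function.update (Function.update (Function.update (Function.update p a (p b)) b (p a))
      a (p a)) b (p b) = p := by
    rw [Function.update_comm hab.symm, Function.update_idem, Function.update_idem]
    simp
  simp only [← Matrix.mulVec_mulVec, Matrix.one_mulVec, sSite_mulVec _ _ hab,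
    Function.update_of_ne hab, Function.update_self, e]
  rw [← mul_assoc]
  rcases lt_cases (p a) (p b) with ⟨hij, hij1, hij2, hij3⟩ | hij | ⟨hij, hij1, hij2, hij3⟩
  · simp [tC, *]
  · simp [tC, hij]
  · simp [tC, *, mul_comm qi q]

theorem sSite_braid (q qi : S) {a b c : Fin n} (hab : a ≠ b) (hac : a ≠ c)
    (hbc : b ≠ c) :
    sSite (N := N) q qi a b * sSite q qi b c * sSite q qi a b =
      sSite q qi b c * sSite q qi a b * sSite q qi b c := by
  refine ext_of_mulVec fun f => funext fun p => ?_
  rw [← upd3_self p (a := a) (b := b) (c := c)]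
  simp only [← Matrix.mulVec_mulVec, sSite, ice_mulVec_upd3_ab hab hac hbc,
    ice_mulVec_upd3_bc hbc, zero_mul, zero_add]
  ring

theorem commute_site₂ {a b c d : Fin n} (hab : a ≠ b) (hcd : c ≠ d)
    (hac : a ≠ c) (had : a ≠ d) (hbc : b ≠ c) (hbd : b ≠ d) (A C A' C' : Fin N → Fin N → S) :
    Commute (site₂ a b (ice A C)) (site₂ c d (ice A' C')) := by
  refine ext_of_mulVec fun f => funext fun p => ?_
  have e : ∀ i j k l : Fin N, Function.update (Function.update (Function.update (Function.update p a i)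
      b j) c k) d l = Function.update (Function.update (Function.update (Function.update p c k)
      d l) a i) b j := by
    intro i j k l
    ext1 x
    simp only [Function.update_apply]
    split_ifs <;> simp_all
  simp only [← Matrix.mulVec_mulVec, ice_mulVec hab, ice_mulVec hcd,
    Function.update_of_ne hac, Function.update_of_ne had, Function.update_of_ne hbc,
    Function.update_of_ne hbd, Function.update_of_ne hac.symm, Function.update_of_ne had.symm,
    Function.update_of_ne hbc.symm, Function.update_of_ne hbd.symm, e]
  ring

end RMatrix

end TrigGaudin

namespace TrigGaudin

/-! ### Two groups of sites -/

section Blocks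

variable {N : ℕ} {B : Type} [Ring B]

/-- Operators on the first `k` of `k + l` sites. -/
def leftHom (k l : ℕ) : Matrix (Fin k → Fin N) (Fin k → Fin N) B →+*
    Matrix (Fin (k + l) → Fin N) (Fin (k + l) → Fin N) B :=
  (Matrix.reindexRingEquiv B (Fin.appendEquiv k l)).toRingHom.comp
    ((Matrix.blockDiagonalRingHom (Fin k → Fin N) (Fin l → Fin N) B).comp
      (Pi.constRingHom (Fin l → Fin N) _))

/-- Operators on the last `l` of `k + l` sites. -/
def rightHom (k l : ℕ) : Matrix (Fin l → Fin N) (Fin l → Fin N) B →+*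
    Matrix (Fin (k + l) → Fin N) (Fin (k + l) → Fin N) B :=
  (Matrix.reindexRingEquiv B ((Equiv.prodComm _ _).trans (Fin.appendEquiv k l))).toRingHom.comp
    ((Matrix.blockDiagonalRingHom (Fin l → Fin N) (Fin k → Fin N) B).comp
      (Pi.constRingHom (Fin k → Fin N) _))

variable {k l : ℕ}

theorem leftHom_apply (Z : Matrix (Fin k → Fin N) (Fin k → Fin N) B) (p r : Fin (k + l) → Fin N) :
    leftHom k l Z p r = if (p ∘ Fin.natAdd k) = (r ∘ Fin.natAdd k) then
      Z (p ∘ Fin.castAdd l) (r ∘ Fin.castAdd l) else 0 := rfl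

theorem rightHom_apply (Z : Matrix (Fin l → Fin N) (Fin l → Fin N) B) (p r : Fin (k + l) → Fin N) :
    rightHom k l Z p r = if (p ∘ Fin.castAdd l) = (r ∘ Fin.castAdd l) then
      Z (p ∘ Fin.natAdd k) (r ∘ Fin.natAdd k) else 0 := rfl

theorem sum_append {M : Type*} [AddCommMonoid M] (F : (Fin k → Fin N) → (Fin l → Fin N) → M) :
    ∑ p : Fin (k + l) → Fin N, F (p ∘ Fin.castAdd l) (p ∘ Fin.natAdd k) = ∑ a, ∑ b, F a b := by
  rw [← Fintype.sum_prod_type']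
  exact Fintype.sum_equiv (Fin.appendEquiv k l).symm _ _ fun p => rfl

theorem leftHom_mul_rightHom (Z : Matrix (Fin k → Fin N) (Fin k → Fin N) B)
    (Z' : Matrix (Fin l → Fin N) (Fin l → Fin N) B) (p r : Fin (k + l) → Fin N) :
    (leftHom k l Z * rightHom k l Z') p r = Z (p ∘ Fin.castAdd l) (r ∘ Fin.castAdd l) *
      Z' (p ∘ Fin.natAdd k) (r ∘ Fin.natAdd k) := by
  simp only [Matrix.mul_apply, leftHom_apply, rightHom_apply]
  rw [sum_append fun a b => (if (p ∘ Fin.natAdd k) = b then Z (p ∘ Fin.castAdd l) a else 0) *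
    (if a = (r ∘ Fin.castAdd l) then Z' b (r ∘ Fin.natAdd k) else 0)]
  simp

theorem rightHom_mul_leftHom (Z : Matrix (Fin k → Fin N) (Fin k → Fin N) B)
    (Z' : Matrix (Fin l → Fin N) (Fin l → Fin N) B) (p r : Fin (k + l) → Fin N) :
    (rightHom k l Z' * leftHom k l Z) p r = Z' (p ∘ Fin.natAdd k) (r ∘ Fin.natAdd k) *
      Z (p ∘ Fin.castAdd l) (r ∘ Fin.castAdd l) := by
  simp only [Matrix.mul_apply, leftHom_apply, rightHom_apply]
  rw [sum_append fun a b => (if (p ∘ Fin.castAdd l) = a then Z' (p ∘ Fin.natAdd k) b else 0) *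
    (if b = (r ∘ Fin.natAdd k) then Z a (r ∘ Fin.castAdd l) else 0)]
  simp

/-- With noncommuting entries the order of the two blocks is the order of the two traces.
Commutation of traces therefore amounts to comparing the two orders of the blocks. -/
theorem trace_leftHom_mul_rightHom (Z : Matrix (Fin k → Fin N) (Fin k → Fin N) B)
    (Z' : Matrix (Fin l → Fin N) (Fin l → Fin N) B) :
    (leftHom k l Z * rightHom k l Z').trace = Z.trace * Z'.trace := by
  simp only [Matrix.trace, Matrix.diag, leftHom_mul_rightHom]
  rw [sum_append fun a b => Z a a * Z' b b, Finset.sum_mul_sum]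

theorem trace_rightHom_mul_leftHom (Z : Matrix (Fin k → Fin N) (Fin k → Fin N) B)
    (Z' : Matrix (Fin l → Fin N) (Fin l → Fin N) B) :
    (rightHom k l Z' * leftHom k l Z).trace = Z'.trace * Z.trace := by
  simp only [Matrix.trace, Matrix.diag, rightHom_mul_leftHom]
  rw [sum_append fun a b => Z' b b * Z a a, Finset.sum_mul_sum, Finset.sum_comm]

theorem commute_leftHom_rightHom {Z : Matrix (Fin k → Fin N) (Fin k → Fin N) B}
    {Z' : Matrix (Fin l → Fin N) (Fin l → Fin N) B} (h : ∀ a b c d, Commute (Z a b) (Z' c d)) :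
    Commute (leftHom k l Z) (rightHom k l Z') := by
  ext p r
  rw [leftHom_mul_rightHom, rightHom_mul_leftHom, (h _ _ _ _).eq]

theorem leftHom_site (a : Fin k) (X : Matrix (Fin N) (Fin N) B) :
    leftHom k l (site a X) = site (Fin.castAdd l a) X := by
  ext p r
  rw [leftHom_apply]
  simp only [site, Matrix.of_apply, Fin.forall_fin_add, funext_iff, Function.comp_apply]
  rw [← ite_and]
  congr 1
  simp only [eq_iff_iff, ne_eq, Fin.castAdd_inj]
  have : ∀ c : Fin l, Fin.natAdd k c ≠ Fin.castAdd l a := fun c h => by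
    have := congrArg Fin.val h; simp at this; omega
  simp only [this, not_false_eq_true, forall_const]
  tauto

theorem rightHom_site (a : Fin l) (X : Matrix (Fin N) (Fin N) B) :
    rightHom k l (site a X) = site (Fin.natAdd k a) X := by
  ext p r
  rw [rightHom_apply]
  simp only [site, Matrix.of_apply, Fin.forall_fin_add, funext_iff, Function.comp_apply]
  rw [← ite_and]
  congr 1
  simp only [eq_iff_iff, ne_eq, Fin.natAdd_inj]
  have : ∀ c : Fin k, Fin.castAdd l c ≠ Fin.natAdd k a := fun c h => by
    have := congrArg Fin.val h; simp at this; omega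
  simp only [this, not_false_eq_true, forall_const]

theorem leftHom_site₂ (a b : Fin k) (X : Matrix (Fin N × Fin N) (Fin N × Fin N) B) :
    leftHom k l (site₂ a b X) = site₂ (Fin.castAdd l a) (Fin.castAdd l b) X := by
  ext p r
  rw [leftHom_apply]
  simp only [site₂, Matrix.of_apply, Fin.forall_fin_add, funext_iff, Function.comp_apply]
  rw [← ite_and]
  congr 1
  simp only [eq_iff_iff, ne_eq, Fin.castAdd_inj]
  have : ∀ (c : Fin l) a, Fin.natAdd k c ≠ Fin.castAdd l a := fun c a h => by
    have := congrArg Fin.val h; simp at this; omega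
  simp only [this, not_false_eq_true, forall_const]
  tauto

theorem rightHom_site₂ (a b : Fin l) (X : Matrix (Fin N × Fin N) (Fin N × Fin N) B) :
    rightHom k l (site₂ a b X) = site₂ (Fin.natAdd k a) (Fin.natAdd k b) X := by
  ext p r
  rw [rightHom_apply]
  simp only [site₂, Matrix.of_apply, Fin.forall_fin_add, funext_iff, Function.comp_apply]
  rw [← ite_and]
  congr 1
  simp only [eq_iff_iff, ne_eq, Fin.natAdd_inj]
  have : ∀ (c : Fin k) a, Fin.castAdd l c ≠ Fin.natAdd k a := fun c a h => by
    have := congrArg Fin.val h; simp at this; omega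
  simp only [this, not_false_eq_true, forall_const]

end Blocks

/-! ### Sites labelled by natural numbers -/

section NatSites

variable {N n : ℕ} {B : Type} [Ring B]

/-- The family `X a` placed at the site `a`. -/
def siteN (n : ℕ) (X : ℕ → Matrix (Fin N) (Fin N) B) (a : ℕ) :
    Matrix (Fin n → Fin N) (Fin n → Fin N) B :=
  if h : a < n then site ⟨a, h⟩ (X a) else 1

theorem siteN_of_lt {a : ℕ} (h : a < n) (X : ℕ → Matrix (Fin N) (Fin N) B) :
    siteN n X a = site ⟨a, h⟩ (X a) := dif_pos h

/-- The twisted permutation operator of the neighbouring sites `j` and `j + 1`. -/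
def permN (n : ℕ) (t : Fin N → Fin N → B) (j : ℕ) : Matrix (Fin n → Fin N) (Fin n → Fin N) B :=
  if h : j + 1 < n then site₂ ⟨j, by omega⟩ ⟨j + 1, h⟩ (ice (fun _ _ => 0) t) else 1

theorem permN_of_lt {j : ℕ} (h : j + 1 < n) (t : Fin N → Fin N → B) :
    permN n t j = site₂ ⟨j, by omega⟩ ⟨j + 1, h⟩ (ice (fun _ _ => 0) t) := dif_pos h

theorem leftHom_siteN {k l a : ℕ} (ha : a < k) (X : ℕ → Matrix (Fin N) (Fin N) B) :
    leftHom k l (siteN k X a) = siteN (k + l) X a := by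
  rw [siteN_of_lt ha, siteN_of_lt (by omega), leftHom_site]; rfl

theorem rightHom_siteN {k l a : ℕ} (ha : a < l) (X : ℕ → Matrix (Fin N) (Fin N) B) :
    rightHom k l (siteN l (fun a => X (k + a)) a) = siteN (k + l) X (k + a) := by
  rw [siteN_of_lt ha, siteN_of_lt (by omega), rightHom_site]; rfl

theorem leftHom_permN {k l j : ℕ} (hj : j + 1 < k) (t : Fin N → Fin N → B) :
    leftHom k l (permN k t j) = permN (k + l) t j := by
  rw [permN_of_lt hj, permN_of_lt (by omega), leftHom_site₂]; rfl

theorem rightHom_permN {k l j : ℕ} (hj : j + 1 < l) (t : Fin N → Fin N → B) :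
    rightHom k l (permN l t j) = permN (k + l) t (k + j) := by
  rw [permN_of_lt hj, permN_of_lt (by omega), rightHom_site₂]; rfl

end NatSites

/-! ### The trace of a cycle of permutations times site operators -/

section TraceFormula

variable {N n : ℕ} {B : Type} [Ring B]

/-- The matrix product `X 0 * d * X 1 * d * ⋯ * d * X r`. -/
def chain (d : Matrix (Fin N) (Fin N) B) (X : ℕ → Matrix (Fin N) (Fin N) B) :
    ℕ → Matrix (Fin N) (Fin N) B
  | 0 => X 0
  | r + 1 => chain d X r * d * X (r + 1)

theorem ice_zero_mul_apply {a b : Fin n} (hab : a ≠ b) (t : Fin N → Fin N → B)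
    (Z : Matrix (Fin n → Fin N) (Fin n → Fin N) B) (p r : Fin n → Fin N) :
    (site₂ a b (ice (fun _ _ => 0) t) * Z) p r =
      t (p a) (p b) * Z (Function.update (Function.update p a (p b)) b (p a)) r := by
  have := ice_mulVec hab (fun _ _ => 0) t (fun p => Z p r) p
  rw [zero_mul, zero_add] at this
  exact this

theorem mul_site_apply (a : Fin n) (X : Matrix (Fin N) (Fin N) B)
    (Z : Matrix (Fin n → Fin N) (Fin n → Fin N) B) (p r : Fin n → Fin N) :
    (Z * site a X) p r = ∑ k, Z p (Function.update r a k) * X k (r a) := by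
  rw [Matrix.mul_apply]
  symm
  refine Finset.sum_of_injOn (fun k => Function.update r a k)
    (fun k _ l _ h => Function.update_injective r a h)
    (fun _ _ => Finset.mem_coe.2 (Finset.mem_univ _)) ?_ ?_
  · intro p' _ hr
    rw [site, Matrix.of_apply, if_neg, mul_zero]
    intro h
    refine hr ⟨p' a, by simp, ?_⟩
    ext1 c
    by_cases hc : c = a
    · subst hc; simp
    · simp [hc, h c hc]
  · intro k _
    rw [site, Matrix.of_apply, if_pos]
    · simp
    · intro c hc
      simp [hc]

/-- A partial trace over all sites but the last. The last permutation moves the free index `i` from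
the last site to the one before it and leaves behind the summation index `k`, with weight `t k i`;
so the same `i` enters every twist, and the operators link up into one matrix product. -/
theorem sum_prodDown_permN_mul_prodUp_siteN (t : Fin N → Fin N → B)
    (ht : ∀ i j z, Commute (t i j) z) (X : ℕ → Matrix (Fin N) (Fin N) B) (r : ℕ) (i j : Fin N) :
    ∑ p : Fin r → Fin N, (prodDown (permN (r + 1) t) r * prodUp (siteN (r + 1) X) (r + 1))
      (Fin.snoc p i : Fin (r + 1) → Fin N) (Fin.snoc p j : Fin (r + 1) → Fin N) =
      chain (Matrix.diagonal fun k => t k i) X r i j := by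
  induction r generalizing j with
  | zero =>
    simp [prodDown, prodUp, chain, siteN, site, Fin.snoc, Subsingleton.elim _ (0 : Fin 1)]
  | succ r ih =>
    have hleft : prodDown (permN (r + 1 + 1) t) (r + 1) * prodUp (siteN (r + 1 + 1) X) (r + 1 + 1) =
        site₂ (Fin.castSucc (Fin.last r)) (Fin.last (r + 1)) (ice (fun _ _ => 0) t) *
          (leftHom (r + 1) 1 (prodDown (permN (r + 1) t) r * prodUp (siteN (r + 1) X) (r + 1)) *
          site (Fin.last (r + 1)) (X (r + 1))) := by
      rw [map_mul, map_prodDown, map_prodUp, prodDown, prodUp, permN_of_lt (by omega),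
        siteN_of_lt (by omega),
        prodDown_congr fun a ha => (leftHom_permN (l := 1) (show a + 1 < r + 1 by omega) t),
        prodUp_congr fun a ha => (leftHom_siteN (l := 1) ha X)]
      simp only [mul_assoc]
      rfl
    have hentry : ∀ (p : Fin r → Fin N) (k : Fin N),
        (prodDown (permN (r + 1 + 1) t) (r + 1) * prodUp (siteN (r + 1 + 1) X) (r + 1 + 1))
          (Fin.snoc (Fin.snoc p k : Fin (r + 1) → Fin N) i : Fin (r + 1 + 1) → Fin N)
          (Fin.snoc (Fin.snoc p k : Fin (r + 1) → Fin N) j : Fin (r + 1 + 1) → Fin N) =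
        t k i * ((prodDown (permN (r + 1) t) r * prodUp (siteN (r + 1) X) (r + 1))
          (Fin.snoc p i : Fin (r + 1) → Fin N) (Fin.snoc p k : Fin (r + 1) → Fin N) *
            X (r + 1) k j) := by
      intro p k
      rw [hleft, ice_zero_mul_apply (Fin.castSucc_lt_last _).ne, mul_site_apply]
      have e1 : Function.update (Function.update (Fin.snoc (Fin.snoc p k : Fin (r + 1) → Fin N) i :
          Fin (r + 1 + 1) → Fin N) (Fin.castSucc (Fin.last r)) i) (Fin.last (r + 1)) k =
          (Fin.snoc (Fin.snoc p i : Fin (r + 1) → Fin N) k : Fin (r + 1 + 1) → Fin N) := by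
        rw [← Fin.snoc_update, Fin.update_snoc_last, Fin.update_snoc_last]
      have e2 : ∀ b, Function.update (Fin.snoc (Fin.snoc p k : Fin (r + 1) → Fin N) j :
          Fin (r + 1 + 1) → Fin N) (Fin.last (r + 1)) b =
          (Fin.snoc (Fin.snoc p k : Fin (r + 1) → Fin N) b : Fin (r + 1 + 1) → Fin N) := fun b => by
        rw [Fin.update_snoc_last]
      have e3 : ∀ (f g : Fin (r + 1) → Fin N) (a b : Fin N)
          (Z : Matrix (Fin (r + 1) → Fin N) (Fin (r + 1) → Fin N) B),
          leftHom (r + 1) 1 Z (Fin.snoc f a : Fin (r + 1 + 1) → Fin N)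
            (Fin.snoc g b : Fin (r + 1 + 1) → Fin N) = if a = b then Z f g else 0 := by
        intro f g a b Z
        rw [leftHom_apply]
        have h1 : ∀ (f : Fin (r + 1) → Fin N) (a : Fin N),
            (Fin.snoc f a : Fin (r + 1 + 1) → Fin N) ∘ Fin.castAdd 1 = f := fun f a => by
          ext1 c; exact Fin.snoc_castSucc (α := fun _ => Fin N) a f c
        have h2 : ∀ (f : Fin (r + 1) → Fin N) (a : Fin N),
            (Fin.snoc f a : Fin (r + 1 + 1) → Fin N) ∘ Fin.natAdd (r + 1) = fun _ : Fin 1 => a :=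
          fun f a => by
            ext1 c
            rw [Subsingleton.elim c 0]
            exact Fin.snoc_last (α := fun _ => Fin N) a f
        rw [h1, h1, h2, h2]
        congr 1
        simp [funext_iff]
      simp only [Fin.snoc_last, Fin.snoc_castSucc, e1, e2, e3]
      simp
    rw [← Equiv.sum_comp (Fin.snocEquiv fun _ => Fin N), Fintype.sum_prod_type]
    simp only [Fin.snocEquiv, Equiv.coe_fn_mk]
    rw [chain, Matrix.mul_apply]
    refine Finset.sum_congr rfl fun k _ => ?_
    rw [Matrix.mul_diagonal, ← ih k, ← (ht k i _).eq, Finset.mul_sum, Finset.sum_mul]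
    refine Finset.sum_congr rfl fun p _ => ?_
    rw [mul_assoc]
    exact hentry p k

theorem trace_prodDown_permN_mul_prodUp_siteN (t : Fin N → Fin N → B)
    (ht : ∀ i j z, Commute (t i j) z) (X : ℕ → Matrix (Fin N) (Fin N) B) (r : ℕ) :
    (prodDown (permN (r + 1) t) r * prodUp (siteN (r + 1) X) (r + 1)).trace =
      ∑ i, chain (Matrix.diagonal fun k => t k i) X r i i := by
  simp only [← sum_prodDown_permN_mul_prodUp_siteN t ht]
  rw [Matrix.trace, ← Equiv.sum_comp (Fin.snocEquiv fun _ => Fin N), Fintype.sum_prod_type]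
  rfl

end TraceFormula

end TrigGaudin

namespace TrigGaudin

/-! ### Scalar matrices, cyclicity of the trace, and intertwiners -/

section ScalarMatrices

variable {S B : Type} [CommRing S] [Ring B] [Algebra S B] {ι : Type} [Fintype ι] [DecidableEq ι]

/-- Matrices over the ground ring, regarded as matrices over an algebra. -/
abbrev scalarHom (S B ι : Type) [CommRing S] [Ring B] [Algebra S B] [Fintype ι] [DecidableEq ι] :
    Matrix ι ι S →+* Matrix ι ι B :=
  (algebraMap S B).mapMatrix

/-- Cyclicity of the trace fails over a noncommutative ring, but survives when one of the factors
has central entries. -/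
theorem trace_scalarHom_mul (c : Matrix ι ι S) (Z : Matrix ι ι B) :
    (scalarHom S B ι c * Z).trace = (Z * scalarHom S B ι c).trace := by
  simp only [Matrix.trace, Matrix.diag, Matrix.mul_apply, RingHom.mapMatrix_apply, Matrix.map_apply]
  rw [Finset.sum_comm]
  simp only [Algebra.commutes]

theorem scalarHom_smul (g : S) (c : Matrix ι ι S) :
    scalarHom S B ι (g • c) = g • scalarHom S B ι c := by
  ext i j
  simp only [RingHom.mapMatrix_apply, Matrix.map_apply, Matrix.smul_apply, smul_eq_mul, map_mul]
  rw [Algebra.smul_def]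

/-- Over a domain the determinant of `M` is nonzero, so multiplication by the adjugate cancels `M`
and a right inverse up to a scalar is also a left inverse up to it. -/
theorem mul_eq_smul_one_comm [IsDomain S] {M M' : Matrix ι ι S} {g : S} (hg : g ≠ 0)
    (h : M * M' = g • 1) : M' * M = g • 1 := by
  have hdet : M.det ≠ 0 := by
    intro h0
    have := congrArg Matrix.det h
    rw [Matrix.det_mul, h0, zero_mul, Matrix.det_smul, Matrix.det_one, mul_one] at this
    exact pow_ne_zero _ hg this.symm
  have h1 : M * (M' * M - g • 1) = 0 := by
    rw [mul_sub, ← mul_assoc, h, smul_mul_assoc, one_mul, mul_smul_comm, mul_one, sub_self]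
  have h2 : M.det • (M' * M - g • 1) = 0 := by
    have := congrArg (fun Z => M.adjugate * Z) h1
    simpa [← mul_assoc, Matrix.adjugate_mul] using this
  rcases smul_eq_zero.1 h2 with h3 | h3
  · exact absurd h3 hdet
  · exact sub_eq_zero.1 h3

/-- Traces over the image of an idempotent agree for operators which are intertwined by an
operator that is invertible after localization. -/
theorem trace_eq_of_intertwine [IsDomain S] (htf : ∀ (c : S) (b : B), c ≠ 0 → c • b = 0 → b = 0)
    {E R R' : Matrix ι ι S} {g : S} (hg : g ≠ 0) (hE : E * E = E) (hR : E * R = E * R * E)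
    (hRR : R * R' = g • 1) {P Q : Matrix ι ι B}
    (hQ : scalarHom S B ι E * Q = scalarHom S B ι E * Q * scalarHom S B ι E)
    (h : scalarHom S B ι R * P = Q * scalarHom S B ι R) :
    (scalarHom S B ι E * P).trace = (scalarHom S B ι E * Q).trace := by
  -- On the image of `E` the compressions of `R` and `R'` are inverse to each other up to `g`.
  have hab : (E * R * E) * (E * R' * E) = g • E := by
    calc (E * R * E) * (E * R' * E) = (E * R * (E * E)) * R' * E := by noncomm_ring
      _ = E * (R * R') * E := by rw [hE, ← hR]; noncomm_ring
      _ = g • E := by rw [hRR, mul_smul_comm, mul_one, smul_mul_assoc, hE]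
  have hba : (E * R' * E) * (E * R * E) = g • E := by
    have hEc : E * (1 - E) = 0 := by rw [mul_sub, hE, mul_one, sub_self]
    have hEc' : (1 - E) * E = 0 := by rw [sub_mul, hE, one_mul, sub_self]
    have hcc : (1 - E) * (1 - E) = 1 - E := by rw [mul_sub, hEc', mul_one, sub_zero]
    -- To reverse the order, the compressions are completed by scalars on the complementary summand;
    -- this gives full matrices to which `mul_eq_smul_one_comm` applies.
    have h1 : (E * R * E + (1 - E)) * (E * R' * E + g • (1 - E)) = g • 1 := by
      rw [add_mul, mul_add, mul_add, hab, mul_smul_comm, mul_assoc _ E (1 - E), hEc, mul_zero,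
        smul_zero, add_zero, ← mul_assoc (1 - E), ← mul_assoc (1 - E), hEc', zero_mul, zero_mul,
        zero_add, mul_smul_comm, hcc, ← smul_add, add_sub_cancel]
    have h2 := congrArg (fun Z => E * Z * E) (mul_eq_smul_one_comm hg h1)
    simp only [mul_smul_comm, mul_one, smul_mul_assoc, hE] at h2
    rw [← h2]
    simp only [add_mul, mul_add, smul_mul_assoc, mul_smul_comm, hE, hEc, hEc', mul_assoc, zero_mul,
      mul_zero, smul_zero, add_zero]
    simp only [← mul_assoc, hE, hEc, zero_mul, smul_zero, add_zero]
  set σ := scalarHom S B ι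
  -- Here `E P` is, up to `g`, the conjugate of `E Q` by the compressed `R`. Moving a scalar matrix
  -- around the trace then removes the conjugation.
  have e1 : g • (σ E * P) = σ (E * R' * E) * (σ E * Q * (σ E * σ R)) := by
    calc g • (σ E * P) = σ (g • E) * P := by rw [scalarHom_smul, smul_mul_assoc]
      _ = σ (E * R' * E) * (σ E * (σ R * P)) := by
        rw [← hba, ← hR]; simp only [map_mul, mul_assoc]
      _ = σ (E * R' * E) * (σ E * Q * (σ E * σ R)) := by
        rw [h, ← mul_assoc (σ E) Q, hQ]; simp only [mul_assoc]
        rw [← mul_assoc (σ E) (σ E), ← map_mul σ E E, hE]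
  have e2 : g • (σ E * P).trace = g • (σ E * Q).trace := by
    rw [← Matrix.trace_smul, e1, trace_scalarHom_mul, mul_assoc, ← map_mul, ← map_mul, hR, hab,
      scalarHom_smul, mul_smul_comm, Matrix.trace_smul, ← hQ]
  exact sub_eq_zero.1 (htf g _ hg (by rw [smul_sub, e2, sub_self]))

/-- Elements with a right inverse after localization. -/
def QuasiUnit (z : Matrix ι ι S) : Prop := ∃ (z' : Matrix ι ι S) (g : S), g ≠ 0 ∧ z * z' = g • 1

theorem QuasiUnit.mul [IsDomain S] {z w : Matrix ι ι S} (hz : QuasiUnit z) (hw : QuasiUnit w) :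
    QuasiUnit (z * w) := by
  obtain ⟨z', g, hg, h⟩ := hz
  obtain ⟨w', g', hg', h'⟩ := hw
  refine ⟨w' * z', g' * g, mul_ne_zero hg' hg, ?_⟩
  rw [mul_assoc, ← mul_assoc w, h', smul_mul_assoc, one_mul, mul_smul_comm, h, smul_smul]

theorem QuasiUnit.one [Nontrivial S] : QuasiUnit (1 : Matrix ι ι S) :=
  ⟨1, 1, one_ne_zero, by simp⟩

theorem QuasiUnit.prodUp [IsDomain S] {z : ℕ → Matrix ι ι S} {m : ℕ}
    (h : ∀ a < m, QuasiUnit (z a)) : QuasiUnit (prodUp z m) := by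
  induction m with
  | zero => exact QuasiUnit.one
  | succ m ih => exact (ih fun a ha => h a (by omega)).mul (h m (by omega))

theorem QuasiUnit.prodDown [IsDomain S] {z : ℕ → Matrix ι ι S} {m : ℕ}
    (h : ∀ a < m, QuasiUnit (z a)) : QuasiUnit (prodDown z m) := by
  induction m with
  | zero => exact QuasiUnit.one
  | succ m ih => exact (h m (by omega)).mul (ih fun a ha => h a (by omega))

theorem eq_zero_of_smul_matrix_eq_zero {S B ι : Type} [CommRing S] [Ring B] [Algebra S B]
    (htf : ∀ (c : S) (b : B), c ≠ 0 → c • b = 0 → b = 0)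
    {c : S} (hc : c ≠ 0) {Z : Matrix ι ι B} (h : c • Z = 0) : Z = 0 := by
  ext i j
  exact htf c _ hc (congrFun (congrFun h i) j)

theorem one_sub_mul_one_add {W : Type*} [Ring W] {s : W} (h : s * s = 1) :
    (1 - s) * (1 + s) = 0 := by
  rw [sub_mul, mul_add, mul_add, h, one_mul, one_mul, mul_one]
  abel

theorem mul_prodDown_absorb {W : Type*} [Ring W] {e : W} {r : ℕ → W} {l : ℕ} (he : e * e = e)
    (h : ∀ b < l, e * r b = e * r b * e) : e * prodDown r l = e * prodDown r l * e := by
  induction l with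
  | zero => simp [prodDown, he]
  | succ l ih =>
    have ih' := ih fun b hb => h b (by omega)
    calc e * (r l * prodDown r l) = e * r l * (e * prodDown r l) := by
          rw [← mul_assoc, ← mul_assoc, ← h l (by omega)]
      _ = e * r l * e * prodDown r l * e := by rw [ih']; noncomm_ring
      _ = e * (r l * prodDown r l) * e := by rw [← h l (by omega)]; noncomm_ring

end ScalarMatrices

/-! ### The q-permutations satisfy the Coxeter relations -/

section Coxeter

variable {N n : ℕ} {S : Type} [CommRing S]

theorem permN_tC_of_lt {q qi : S} {j : ℕ} (h : j + 1 < n) :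
    permN (N := N) n (tC q qi) j = sSite q qi ⟨j, by omega⟩ ⟨j + 1, h⟩ := dif_pos h

theorem isCoxeter_permN {q qi : S} (hq : q * qi = 1) :
    IsCoxeter (permN (N := N) n (tC q qi)) n where
  sq j hj := by
    rw [permN_tC_of_lt hj]
    exact sSite_mul_self hq (by simp)
  braid j hj := by
    rw [permN_tC_of_lt (show j + 1 < n by omega), permN_tC_of_lt (show j + 1 + 1 < n by omega)]
    refine sSite_braid q qi ?_ ?_ ?_ <;> simp only [ne_eq, Fin.mk.injEq] <;> omega
  comm i j hij hj := by
    rw [permN_tC_of_lt hj, permN_tC_of_lt (show i + 1 < n by omega)]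
    refine commute_site₂ ?_ ?_ ?_ ?_ ?_ ?_ _ _ _ _ <;> simp only [ne_eq, Fin.mk.injEq] <;> omega

theorem IsCoxeter.map {W W' : Type*} [Ring W] [Ring W'] (f : W →+* W') {s : ℕ → W} {n : ℕ}
    (hs : IsCoxeter s n) : IsCoxeter (fun j => f (s j)) n where
  sq j hj := by rw [← map_mul, hs.sq j hj, map_one]
  braid j hj := by simp only [← map_mul, hs.braid j hj]
  comm i j hij hj := (hs.comm i j hij hj).map f

end Coxeter

/-! ### Exchange relations and their degenerations -/

section Fusion

variable {N n : ℕ} {S B : Type} [CommRing S] [Ring B] [Algebra S B]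

theorem scalarHom_site₂ (a b : Fin n) (A C : Fin N → Fin N → S) :
    scalarHom S B _ (site₂ a b (ice A C)) =
      site₂ a b (ice (fun i j => algebraMap S B (A i j)) fun i j => algebraMap S B (C i j)) := by
  ext p r
  simp only [RingHom.mapMatrix_apply, Matrix.map_apply, site₂, ice, Matrix.of_apply]
  split_ifs <;> simp

theorem scalarHom_leftHom {k l : ℕ} (Z : Matrix (Fin k → Fin N) (Fin k → Fin N) S) :
    scalarHom S B _ (leftHom k l Z) = leftHom k l (scalarHom S B _ Z) := by
  ext p r
  simp only [RingHom.mapMatrix_apply, Matrix.map_apply, leftHom_apply]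
  split_ifs <;> simp

theorem scalarHom_rightHom {k l : ℕ} (Z : Matrix (Fin l → Fin N) (Fin l → Fin N) S) :
    scalarHom S B _ (rightHom k l Z) = rightHom k l (scalarHom S B _ Z) := by
  ext p r
  simp only [RingHom.mapMatrix_apply, Matrix.map_apply, rightHom_apply]
  split_ifs <;> simp

/-- The exchange relation with the trigonometric `R`-matrix `R(x, y)`. -/
def RExchange (q qi x y : S) (X Y : Matrix (Fin N) (Fin N) B) : Prop :=
  Exchange (fun i j => algebraMap S B (rA q qi x y i j)) (fun i j => algebraMap S B (rC q qi x y i j))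
    X Y

theorem RExchange.site {q qi x y : S} {X Y : Matrix (Fin N) (Fin N) B} (h : RExchange q qi x y X Y)
    {a b : Fin n} (hab : a ≠ b) :
    scalarHom S B _ (rSite q qi a b x y) * site a X * site b Y =
      site b Y * site a X * scalarHom S B _ (rSite q qi a b x y) := by
  rw [rSite, scalarHom_site₂]
  exact Exchange.site hab (fun _ _ _ => Algebra.commutes _ _) (fun _ _ _ => Algebra.commutes _ _) h

theorem commute_scalarHom_site {a b c : Fin n} (hab : a ≠ b) (hca : c ≠ a) (hcb : c ≠ b)
    (A C : Fin N → Fin N → S) (X : Matrix (Fin N) (Fin N) B) :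
    Commute (scalarHom S B _ (site₂ a b (ice A C))) (site c X) := by
  rw [scalarHom_site₂]
  exact commute_ice_site hab hca hcb (fun _ _ _ => Algebra.commutes _ _)
    (fun _ _ _ => Algebra.commutes _ _) X

/-- The exchange relation at the point where the `R`-matrix degenerates. -/
theorem RExchange.one_sub_mul_mul_one_add {q qi x : S} (hq : q * qi = 1)
    (htf : ∀ (c : S) (b : B), c ≠ 0 → c • b = 0 → b = 0) (hx : x * (q ^ 2 - 1) ≠ 0)
    {X Y : Matrix (Fin N) (Fin N) B} (h : RExchange q qi x (q ^ 2 * x) X Y)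
    {a b : Fin n} (hab : a ≠ b) :
    (1 - scalarHom S B _ (sSite q qi a b)) * (TrigGaudin.site a X * TrigGaudin.site b Y) *
      (1 + scalarHom S B _ (sSite q qi a b)) = 0 := by
  have h1 := h.site hab
  rw [rSite_eq_smul_one_sub hq hab, scalarHom_smul, map_sub, map_one] at h1
  set s := scalarHom S B _ (sSite (N := N) q qi a b) with hs
  have hss : s * s = 1 := by rw [hs, ← map_mul, sSite_mul_self hq hab, map_one]
  refine eq_zero_of_smul_matrix_eq_zero htf hx ?_
  rw [← smul_mul_assoc, ← smul_mul_assoc, ← mul_assoc, h1, mul_assoc, smul_mul_assoc]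
  rw [one_sub_mul_one_add hss, smul_zero, mul_zero]

/-- The Yang–Baxter equation at the degenerate point of the R-matrix on sites `a`, `b`, after
cancelling its nonzero scalar. -/
theorem rSite_fusion_left [IsDomain S] {q qi : S} (hq : q * qi = 1) {a b c : Fin n} (hab : a ≠ b) (hac : a ≠ c)
    (hbc : b ≠ c) {x : S} (z : S) (hx : x * (q ^ 2 - 1) ≠ 0) :
    (1 - sSite (N := N) q qi a b) * (rSite q qi a c x z * rSite q qi b c (q ^ 2 * x) z) =
      rSite q qi b c (q ^ 2 * x) z * rSite q qi a c x z * (1 - sSite q qi a b) := by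
  have h1 := yang_baxter (N := N) hq hab hac hbc 1 x (q ^ 2 * x) z
  rw [one_mul, one_mul, rSite_eq_smul_one_sub hq hab, smul_mul_assoc, smul_mul_assoc,
    mul_smul_comm, mul_assoc] at h1
  exact smul_right_injective _ hx h1

theorem rSite_fusion_right [IsDomain S] {q qi : S} (hq : q * qi = 1) {a b c : Fin n} (hab : a ≠ b) (hac : a ≠ c)
    (hbc : b ≠ c) (x : S) {z : S} (hz : z * (q ^ 2 - 1) ≠ 0) :
    (1 - sSite (N := N) q qi b c) * (rSite q qi a c x (q ^ 2 * z) * rSite q qi a b x z) =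
      rSite q qi a b x z * rSite q qi a c x (q ^ 2 * z) * (1 - sSite q qi b c) := by
  have h1 := yang_baxter (N := N) hq hab hac hbc 1 x z (q ^ 2 * z)
  rw [one_mul, one_mul, rSite_eq_smul_one_sub hq hbc, mul_smul_comm, smul_mul_assoc, smul_mul_assoc,
    mul_assoc (1 - _)] at h1
  exact (smul_right_injective _ hz h1).symm

end Fusion

/-! ### Commutativity of the quantum elementary symmetric functions -/

section ElementarySymmetric

variable {N : ℕ} {S B : Type} [CommRing S] [Ring B] [Algebra S B]

/-- A sequence of matrices with the exchange relations along a `q²`-string of parameters. -/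
structure IsString (q qi : S) (x : ℕ → S) (X : ℕ → Matrix (Fin N) (Fin N) B) : Prop where
  shift : ∀ a, x (a + 1) = q ^ 2 * x a
  ne_zero : ∀ a, x a * (q ^ 2 - 1) ≠ 0
  exchange : ∀ a, RExchange q qi (x a) (x (a + 1)) (X a) (X (a + 1))

theorem IsString.shift_by {q qi : S} {x : ℕ → S} {X : ℕ → Matrix (Fin N) (Fin N) B}
    (h : IsString q qi x X) (k : ℕ) : IsString q qi (fun a => x (k + a)) fun a => X (k + a) :=
  ⟨fun a => h.shift (k + a), fun a => h.ne_zero (k + a), fun a => h.exchange (k + a)⟩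

/-- The `R`-matrix between the site `a` of the first group and the site `b` of the second group. -/
def crossR (N : ℕ) (q qi : S) (x y : ℕ → S) (m l b a : ℕ) :
    Matrix (Fin (m + l) → Fin N) (Fin (m + l) → Fin N) S :=
  if h : a < m ∧ b < l then
    rSite q qi (Fin.castAdd l ⟨a, h.1⟩) (Fin.natAdd m ⟨b, h.2⟩) (x a) (y b) else 1

theorem crossR_of_lt {q qi : S} {x y : ℕ → S} {m l a b : ℕ} (ha : a < m) (hb : b < l) :
    crossR N q qi x y m l b a =
      rSite q qi (Fin.castAdd l ⟨a, ha⟩) (Fin.natAdd m ⟨b, hb⟩) (x a) (y b) := dif_pos ⟨ha, hb⟩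

theorem castAdd_ne_natAdd {m l : ℕ} (a : Fin m) (b : Fin l) : Fin.castAdd l a ≠ Fin.natAdd m b := by
  intro h
  have := congrArg Fin.val h
  simp at this
  omega

/-- The product of all `R`-matrices between two groups of sites. -/
def bigR (N : ℕ) (q qi : S) (x y : ℕ → S) (m l : ℕ) :
    Matrix (Fin (m + l) → Fin N) (Fin (m + l) → Fin N) S :=
  prodDown (fun b => prodUp (crossR N q qi x y m l b) m) l

theorem commute_crossR {q qi : S} {x y : ℕ → S} {m l a b c d : ℕ} (ha : a < m) (hb : b < l)
    (hc : c < m) (hd : d < l) (hac : a ≠ c) (hbd : b ≠ d) :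
    Commute (crossR N q qi x y m l b a) (crossR N q qi x y m l d c) := by
  rw [crossR_of_lt ha hb, crossR_of_lt hc hd]
  exact commute_site₂ (castAdd_ne_natAdd _ _) (castAdd_ne_natAdd _ _)
    (fun h => hac (by simpa using h)) (castAdd_ne_natAdd _ _) (castAdd_ne_natAdd _ _).symm
    (fun h => hbd (by simpa using h)) _ _ _ _

/-- Every matrix of the first group crosses every matrix of the second. Each crossing costs one
R-matrix, which commutes with the matrices at all other sites. -/
theorem bigR_intertwine {q qi : S} {x y : ℕ → S} {m l : ℕ} {X Y : ℕ → Matrix (Fin N) (Fin N) B}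
    (h : ∀ a b, RExchange q qi (x a) (y b) (X a) (Y b)) :
    scalarHom S B _ (bigR N q qi x y m l) *
        (leftHom m l (prodUp (siteN m X) m) * rightHom m l (prodUp (siteN l Y) l)) =
      rightHom m l (prodUp (siteN l Y) l) * leftHom m l (prodUp (siteN m X) m) *
        scalarHom S B _ (bigR N q qi x y m l) := by
  rw [bigR, map_prodDown, map_prodUp (rightHom (N := N) (B := B) m l), ← mul_assoc]
  refine prodDown_intertwine (fun b hb => ?_) fun b hb d hd hbd => ?_
  · rw [map_prodUp (leftHom (N := N) (B := B) m l), map_prodUp]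
    refine prodUp_intertwine (fun a ha => ?_) fun a ha c hc hac => ?_
    · rw [crossR_of_lt ha hb, siteN_of_lt ha, siteN_of_lt hb, leftHom_site, rightHom_site]
      exact (h a b).site (castAdd_ne_natAdd _ _)
    · rw [crossR_of_lt ha hb, siteN_of_lt hc, leftHom_site]
      exact commute_scalarHom_site (castAdd_ne_natAdd _ _) (fun h => hac (by simpa using h))
        (castAdd_ne_natAdd _ _) _ _ _
  · rw [map_prodUp]
    refine (commute_prodUp fun a ha => ?_).symm
    rw [crossR_of_lt ha hb, siteN_of_lt hd, rightHom_site]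
    exact (commute_scalarHom_site (castAdd_ne_natAdd _ _) (castAdd_ne_natAdd _ _).symm
      (fun h => hbd (by simpa using h)) _ _ _).symm

theorem quasiUnit_bigR [IsDomain S] {q qi : S} (hq : q * qi = 1) {x y : ℕ → S} {m l : ℕ}
    (hg : ∀ a b, (qi * y b - q * x a) * (qi * x a - q * y b) ≠ 0) :
    QuasiUnit (bigR N q qi x y m l) := by
  refine QuasiUnit.prodDown fun b hb => QuasiUnit.prodUp fun a ha => ?_
  rw [crossR_of_lt ha hb]
  exact ⟨_, _, hg a b, rSite_mul_rSite hq (castAdd_ne_natAdd _ _) _ _⟩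

variable [Algebra ℚ S] [Algebra ℚ B]

/-- The quantum elementary symmetric function of a string of matrices. -/
def elemE (q qi : S) (m : ℕ) (X : ℕ → Matrix (Fin N) (Fin N) B) : B :=
  (scalarHom S B _ (asym (permN m (tC q qi)) m) * prodUp (siteN m X) m).trace

/-- Consecutive parameters of a string differ by `q²`, so each neighbouring pair sits at the
degenerate point of its exchange relation and the fusion property applies. -/
theorem IsString.asym_mul_prodUp {q qi : S} (hq : q * qi = 1)
    (htf : ∀ (c : S) (b : B), c ≠ 0 → c • b = 0 → b = 0)
    {x : ℕ → S} {X : ℕ → Matrix (Fin N) (Fin N) B} (h : IsString q qi x X) {n m k : ℕ} (hk : k ≤ m)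
    (hm : m ≤ n) :
    scalarHom S B _ (asym (permN n (tC q qi)) k) * prodUp (siteN n X) m =
      scalarHom S B _ (asym (permN n (tC q qi)) k) * prodUp (siteN n X) m *
        scalarHom S B _ (asym (permN n (tC q qi)) k) := by
  rw [map_asym]
  refine ((isCoxeter_permN hq).map _).asym_mul_eq (hk.trans hm) fun j hj => ?_
  refine sub_prodUp_add (show j + 1 < m by omega) (fun a ha h1 h2 => ?_) ?_
  · rw [permN_of_lt (by omega), siteN_of_lt (by omega)]
    refine commute_scalarHom_site ?_ ?_ ?_ _ _ _ <;> simp only [ne_eq, Fin.mk.injEq] <;> omega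
  · rw [permN_tC_of_lt (by omega), siteN_of_lt (by omega), siteN_of_lt (by omega)]
    have h1 := h.exchange j
    rw [h.shift j] at h1
    exact h1.one_sub_mul_mul_one_add hq htf (h.ne_zero j) (by simp)

variable [IsDomain S]

/-- Each row of R-matrices against one fixed site `b` is fused by `rSite_fusion_left`; the absorbed
antisymmetrizer is passed on from row to row. -/
theorem asym_left_mul_bigR {q qi : S} (hq : q * qi = 1) {x y : ℕ → S} {m l : ℕ}
    (hx : ∀ a, x (a + 1) = q ^ 2 * x a) (hx0 : ∀ a, x a * (q ^ 2 - 1) ≠ 0) :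
    leftHom m l (asym (permN (N := N) m (tC q qi)) m) * bigR N q qi x y m l =
      leftHom m l (asym (permN m (tC q qi)) m) * bigR N q qi x y m l *
        leftHom m l (asym (permN m (tC q qi)) m) := by
  have hcox := (isCoxeter_permN (N := N) (n := m) hq).map (leftHom m l)
  rw [map_asym]
  refine mul_prodDown_absorb (hcox.asym_mul_asym le_rfl) fun b hb => ?_
  refine hcox.asym_mul_eq le_rfl fun j hj => ?_
  have hss := hcox.sq j hj
  refine sub_prodUp_add hj (fun a ha h1 h2 => ?_) ?_
  · rw [permN_of_lt hj, leftHom_site₂, crossR_of_lt ha hb]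
    refine commute_site₂ ?_ (castAdd_ne_natAdd _ _) ?_ (castAdd_ne_natAdd _ _) ?_
      (castAdd_ne_natAdd _ _) _ _ _ _ <;>
      simp only [ne_eq, Fin.castAdd_inj, Fin.mk.injEq] <;> omega
  · rw [crossR_of_lt (by omega) hb, crossR_of_lt hj hb, hx j]
    rw [permN_of_lt hj, leftHom_site₂] at hss ⊢
    have := rSite_fusion_left (N := N) hq (a := Fin.castAdd l ⟨j, by omega⟩)
      (b := Fin.castAdd l ⟨j + 1, hj⟩) (c := Fin.natAdd m ⟨b, hb⟩)
      (by simp [Fin.ext_iff]) (castAdd_ne_natAdd _ _) (castAdd_ne_natAdd _ _) (y b) (hx0 j)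
    rw [sSite] at this
    rw [this, mul_assoc, one_sub_mul_one_add hss, mul_zero]

/-- Now the two neighbouring sites lie in different rows. The two rows are merged into one product
of pairs, and `1 - s` is carried through it pair by pair. -/
theorem asym_right_mul_bigR {q qi : S} (hq : q * qi = 1) {x y : ℕ → S} {m l : ℕ}
    (hy : ∀ b, y (b + 1) = q ^ 2 * y b) (hy0 : ∀ b, y b * (q ^ 2 - 1) ≠ 0) :
    rightHom m l (asym (permN (N := N) l (tC q qi)) l) * bigR N q qi x y m l =
      rightHom m l (asym (permN l (tC q qi)) l) * bigR N q qi x y m l *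
        rightHom m l (asym (permN l (tC q qi)) l) := by
  have hcox := (isCoxeter_permN (N := N) (n := l) hq).map (rightHom m l)
  rw [map_asym]
  refine hcox.asym_mul_eq le_rfl fun j hj => ?_
  have hss := hcox.sq j hj
  refine sub_prodDown_add hj (fun b hb h1 h2 => commute_prodUp fun a ha => ?_) ?_
  · rw [permN_of_lt hj, rightHom_site₂, crossR_of_lt ha hb]
    refine commute_site₂ ?_ (castAdd_ne_natAdd _ _) (castAdd_ne_natAdd _ _).symm ?_
      (castAdd_ne_natAdd _ _).symm ?_ _ _ _ _ <;>
      simp only [ne_eq, Fin.natAdd_inj, Fin.mk.injEq] <;> omega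
  · rw [prodUp_mul_prodUp fun a ha c hc hac =>
      commute_crossR ha hj hc (by omega) hac.symm (by omega)]
    rw [permN_of_lt hj, rightHom_site₂] at hss ⊢
    rw [prodUp_semiconj (y := fun a => crossR N q qi x y m l j a * crossR N q qi x y m l (j + 1) a)]
    · rw [mul_assoc, one_sub_mul_one_add hss, mul_zero]
    · intro a ha
      rw [crossR_of_lt ha hj, crossR_of_lt ha (by omega), hy j]
      exact rSite_fusion_right (N := N) hq (castAdd_ne_natAdd _ _) (castAdd_ne_natAdd _ _)
        (by simp [Fin.ext_iff]) (x a) (hy0 j)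

/-- The two products are the traces of `E P Q` and `E Q P`, where `E` is the product of the two
antisymmetrizers. The big R-matrix intertwines `P Q` with `Q P` and is compatible with `E`, so
`trace_eq_of_intertwine` applies. -/
theorem commute_elemE {q qi : S} (hq : q * qi = 1)
    (htf : ∀ (c : S) (b : B), c ≠ 0 → c • b = 0 → b = 0)
    {x y : ℕ → S} {X Y : ℕ → Matrix (Fin N) (Fin N) B} (hX : IsString q qi x X)
    (hY : IsString q qi y Y) (hXY : ∀ a b, RExchange q qi (x a) (y b) (X a) (Y b))
    (hg : ∀ a b, (qi * y b - q * x a) * (qi * x a - q * y b) ≠ 0) (m l : ℕ) :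
    Commute (elemE q qi m X) (elemE q qi l Y) := by
  set σ := scalarHom S B (Fin (m + l) → Fin N) with hσ
  set A := leftHom m l (asym (permN (N := N) m (tC q qi)) m) with hA
  set A' := rightHom m l (asym (permN (N := N) l (tC q qi)) l) with hA'
  set P := leftHom m l (prodUp (siteN m X) m) with hP
  set Q := rightHom m l (prodUp (siteN l Y) l) with hQ
  have hAA : A * A = A := by
    rw [hA, ← map_mul, (isCoxeter_permN hq).asym_mul_asym le_rfl]
  have hAA' : A' * A' = A' := by
    rw [hA', ← map_mul, (isCoxeter_permN hq).asym_mul_asym le_rfl]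
  have hc1 : Commute A A' := commute_leftHom_rightHom fun _ _ _ _ => Commute.all _ _
  have hc2 : Commute (σ A') P := by
    rw [hA', hσ, scalarHom_rightHom]
    exact (commute_leftHom_rightHom fun _ _ _ _ => (Algebra.commutes _ _).symm).symm
  have hc3 : Commute (σ A) Q := by
    rw [hA, hσ, scalarHom_leftHom]
    exact commute_leftHom_rightHom fun _ _ _ _ => Algebra.commutes _ _
  have hAP : σ A * P = σ A * P * σ A := by
    rw [hA, hσ, scalarHom_leftHom, hP, ← map_mul, ← map_mul,
      ← hX.asym_mul_prodUp hq htf le_rfl le_rfl]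
  have hAQ : σ A' * Q = σ A' * Q * σ A' := by
    rw [hA', hσ, scalarHom_rightHom, hQ, ← map_mul, ← map_mul,
      ← hY.asym_mul_prodUp hq htf le_rfl le_rfl]
  have hc1' : Commute (σ A) (σ A') := hc1.map σ
  obtain ⟨R', g, hg0, hRR⟩ := quasiUnit_bigR (N := N) (m := m) (l := l) hq hg
  have hR1 := asym_left_mul_bigR (N := N) (m := m) (l := l) (y := y) hq hX.shift hX.ne_zero
  have hR2 := asym_right_mul_bigR (N := N) (m := m) (l := l) (x := x) hq hY.shift hY.ne_zero
  set R := bigR N q qi x y m l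
  have hE : A * A' * (A * A') = A * A' := by
    calc A * A' * (A * A') = A * (A' * A) * A' := by noncomm_ring
      _ = (A * A) * (A' * A') := by rw [← hc1.eq]; noncomm_ring
      _ = A * A' := by rw [hAA, hAA']
  have hER : A * A' * R = A * A' * R * (A * A') := by
    calc A * A' * R = A' * (A * R) := by rw [hc1.eq, mul_assoc]
      _ = A' * A * R * A := by rw [hR1]; noncomm_ring
      _ = A * (A' * R) * A := by rw [← hc1.eq]; noncomm_ring
      _ = A * A' * R * (A' * A) := by rw [hR2]; noncomm_ring
      _ = A * A' * R * (A * A') := by rw [hc1.eq]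
  have hEQ : σ (A * A') * (Q * P) = σ (A * A') * (Q * P) * σ (A * A') := by
    rw [map_mul]
    calc σ A * σ A' * (Q * P) = σ A * (σ A' * Q) * P := by noncomm_ring
      _ = (σ A * σ A') * Q * (σ A' * P) := by rw [hAQ]; noncomm_ring
      _ = σ A' * (σ A * Q) * P * σ A' := by rw [hc1'.eq, hc2.eq]; noncomm_ring
      _ = σ A' * Q * (σ A * P) * σ A' := by rw [hc3.eq]; noncomm_ring
      _ = σ A' * (Q * σ A) * P * σ A * σ A' := by rw [hAP]; noncomm_ring
      _ = (σ A' * σ A) * (Q * P) * (σ A * σ A') := by rw [← hc3.eq]; noncomm_ring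
      _ = _ := by rw [← hc1'.eq]
  have key := trace_eq_of_intertwine (B := B) htf hg0 hE hER hRR hEQ (bigR_intertwine hXY)
  have e1 : σ (A * A') * (P * Q) = leftHom m l (scalarHom S B _ (asym (permN m (tC q qi)) m) *
      prodUp (siteN m X) m) * rightHom m l (scalarHom S B _ (asym (permN l (tC q qi)) l) *
      prodUp (siteN l Y) l) := by
    rw [map_mul, map_mul, map_mul, ← scalarHom_leftHom, ← scalarHom_rightHom]
    calc σ A * σ A' * (P * Q) = σ A * (σ A' * P) * Q := by noncomm_ring
      _ = σ A * P * (σ A' * Q) := by rw [hc2.eq]; noncomm_ring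
  have e2 : σ (A * A') * (Q * P) = rightHom m l (scalarHom S B _ (asym (permN l (tC q qi)) l) *
      prodUp (siteN l Y) l) * leftHom m l (scalarHom S B _ (asym (permN m (tC q qi)) m) *
      prodUp (siteN m X) m) := by
    rw [map_mul, map_mul, map_mul, ← scalarHom_leftHom, ← scalarHom_rightHom]
    calc σ A * σ A' * (Q * P) = σ A' * (σ A * Q) * P := by rw [hc1'.eq]; noncomm_ring
      _ = σ A' * Q * (σ A * P) := by rw [hc3.eq]; noncomm_ring
  have key' : (σ (A * A') * (P * Q)).trace = (σ (A * A') * (Q * P)).trace := key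
  rw [e1, e2, trace_leftHom_mul_rightHom, trace_rightHom_mul_leftHom] at key'
  exact key'

end ElementarySymmetric

end TrigGaudin

namespace TrigGaudin

/-! ### Newton's identities and the quantum power sums -/

section Newton

variable {N : ℕ} {S B : Type} [CommRing S] [Ring B] [Algebra S B]

/-- The quantum power sum of degree `r + 1` of a string of matrices. -/
def powSum (q qi : S) (r : ℕ) (X : ℕ → Matrix (Fin N) (Fin N) B) : B :=
  ∑ i, chain (Matrix.diagonal fun k => algebraMap S B (tC q qi k i)) X r i i

theorem scalarHom_permN (n : ℕ) (t : Fin N → Fin N → S) (j : ℕ) :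
    scalarHom S B _ (permN n t j) = permN n (fun i k => algebraMap S B (t i k)) j := by
  rw [permN, permN]
  split_ifs
  · rw [scalarHom_site₂]
    simp
  · rw [map_one]

theorem powSum_eq_trace (q qi : S) (r : ℕ) (X : ℕ → Matrix (Fin N) (Fin N) B) :
    powSum q qi r X = (scalarHom S B _ (prodDown (permN (r + 1) (tC q qi)) r) *
      prodUp (siteN (r + 1) X) (r + 1)).trace := by
  rw [map_prodDown]
  simp only [scalarHom_permN]
  rw [trace_prodDown_permN_mul_prodUp_siteN _ fun _ _ _ => Algebra.commutes _ _]
  rfl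

theorem prodDown_succ' {W : Type*} [Ring W] (x : ℕ → W) (m : ℕ) :
    prodDown x (m + 1) = prodDown (fun a => x (a + 1)) m * x 0 := by
  induction m with
  | zero => simp [prodDown]
  | succ m ih => rw [prodDown, ih, prodDown, mul_assoc]

variable [Algebra ℚ S]

/-- The hook functions, which interpolate between power sums and elementary symmetric functions. -/
def hookF (q qi : S) (n k : ℕ) (X : ℕ → Matrix (Fin N) (Fin N) B) : B :=
  (scalarHom S B _ (prodDown (fun j => permN n (tC q qi) (k - 1 + j)) (n - k) *
    asym (permN n (tC q qi)) k) * prodUp (siteN n X) n).trace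

theorem hookF_self (q qi : S) (n : ℕ) (X : ℕ → Matrix (Fin N) (Fin N) B) :
    hookF q qi n n X = elemE q qi n X := by
  simp [hookF, elemE, prodDown]

theorem hookF_one (q qi : S) (r : ℕ) (X : ℕ → Matrix (Fin N) (Fin N) B) :
    hookF q qi (r + 1) 1 X = powSum q qi r X := by
  rw [powSum_eq_trace, hookF, asym_one, mul_one]
  simp

/-- The antisymmetrizer lives on the first `k` sites and the cycle on the remaining ones, so the
trace splits. The power sum sees the string shifted by `k`. -/
theorem elemE_mul_powSum (q qi : S) (k l : ℕ) (X : ℕ → Matrix (Fin N) (Fin N) B) :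
    elemE q qi k X * powSum q qi l (fun a => X (k + a)) =
      (scalarHom S B _ (prodDown (fun j => permN (k + (l + 1)) (tC q qi) (k + j)) l *
        asym (permN (k + (l + 1)) (tC q qi)) k) * prodUp (siteN (k + (l + 1)) X) (k + (l + 1))).trace := by
  have h1 : asym (permN (N := N) (k + (l + 1)) (tC q qi)) k =
      leftHom k (l + 1) (asym (permN k (tC q qi)) k) := by
    rw [map_asym]
    exact asym_congr fun j hj => (leftHom_permN hj _).symm
  have h2 : prodDown (fun j => permN (N := N) (k + (l + 1)) (tC q qi) (k + j)) l =
      rightHom k (l + 1) (prodDown (permN (l + 1) (tC q qi)) l) := by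
    rw [map_prodDown]
    exact prodDown_congr fun j hj => (rightHom_permN (by omega) _).symm
  have h3 : prodUp (siteN (k + (l + 1)) X) (k + (l + 1)) =
      leftHom k (l + 1) (prodUp (siteN k X) k) *
        rightHom k (l + 1) (prodUp (siteN (l + 1) fun a => X (k + a)) (l + 1)) := by
    rw [prodUp_add, map_prodUp (leftHom (N := N) (B := B) k (l + 1)),
      map_prodUp (rightHom (N := N) (B := B) k (l + 1)),
      prodUp_congr fun a ha => (leftHom_siteN (l := l + 1) ha X),
      prodUp_congr fun a ha => (rightHom_siteN (k := k) ha X)]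
  rw [h1, h2, h3, powSum_eq_trace, elemE, ← trace_leftHom_mul_rightHom]
  congr 1
  simp only [map_mul, scalarHom_leftHom, scalarHom_rightHom]
  have hc1 : Commute (rightHom k (l + 1) (scalarHom S B (Fin (l + 1) → Fin N)
      (prodDown (permN (l + 1) (tC q qi)) l)))
      (leftHom k (l + 1) (scalarHom S B _ (asym (permN k (tC q qi)) k)) *
        leftHom k (l + 1) (prodUp (siteN k X) k)) := by
    rw [← map_mul]
    exact (commute_leftHom_rightHom fun _ _ _ _ => (Algebra.commutes _ _).symm).symm
  simp only [← mul_assoc] at hc1 ⊢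
  rw [mul_assoc (rightHom _ _ _), hc1.eq]

variable [Algebra ℚ B]

/-- This is the recursion of the antisymmetrizer under the trace, multiplied by the cycle on the
remaining sites. The term with `A` alone splits into a product of traces, and the term with `A s A`
is a hook function, one of its two antisymmetrizers being absorbed. -/
theorem newton {q qi : S} (hq : q * qi = 1) (htf : ∀ (c : S) (b : B), c ≠ 0 → c • b = 0 → b = 0)
    {x : ℕ → S} {X : ℕ → Matrix (Fin N) (Fin N) B} (hX : IsString q qi x X) {k l : ℕ} (hk : 1 ≤ k) :
    ((k : ℚ) + 1) • hookF q qi (k + (l + 1)) (k + 1) X =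
      elemE q qi k X * powSum q qi l (fun a => X (k + a)) -
        (k : ℚ) • hookF q qi (k + (l + 1)) k X := by
  set n := k + (l + 1) with hn
  set s := permN (N := N) n (tC q qi) with hs
  set σ := scalarHom S B (Fin n → Fin N)
  set P := prodUp (siteN n X) n
  set C := prodDown (fun j => s (k + j)) l with hC
  set A := asym s k
  have hcox : IsCoxeter s n := isCoxeter_permN hq
  have hCA : Commute C A := by
    refine (commute_prodDown fun j hj => (commute_asym fun i hi => ?_).symm).symm
    exact (hcox.comm i (k + j) (by omega) (by omega)).symm
  have hAP : σ A * P = σ A * P * σ A := hX.asym_mul_prodUp hq htf (by omega) le_rfl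
  -- The second antisymmetrizer is created by absorption on the right of `σ A * P` and brought to
  -- the front by cyclicity.
  have hF : hookF q qi n k X = (σ (C * A * s (k - 1) * A) * P).trace := by
    have e : prodDown (fun j => permN (N := N) n (tC q qi) (k - 1 + j)) (n - k) = C * s (k - 1) := by
      rw [show n - k = l + 1 by omega, prodDown_succ', hC]
      congr 1
      exact prodDown_congr fun j _ => by rw [hs, show k - 1 + (j + 1) = k + j by omega]
    rw [hookF, e]
    calc (σ (C * s (k - 1) * A) * P).trace
        = (σ (C * s (k - 1)) * (σ A * P)).trace := by rw [map_mul σ (C * s (k - 1)), mul_assoc]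
      _ = (σ (C * s (k - 1) * A) * P * σ A).trace := by
        rw [hAP, map_mul σ (C * s (k - 1))]; simp only [mul_assoc]
      _ = (σ A * (σ (C * s (k - 1) * A) * P)).trace := by rw [trace_scalarHom_mul]
      _ = (σ (C * A * s (k - 1) * A) * P).trace := by
        rw [← mul_assoc, ← map_mul, ← mul_assoc, ← mul_assoc, hCA.eq]
  have hF' : hookF q qi n (k + 1) X = (σ (C * asym s (k + 1)) * P).trace := by
    rw [hookF, show n - (k + 1) = l by omega]
    simp only [Nat.add_sub_cancel]
    rfl
  rw [hF, hF', elemE_mul_powSum, ← Matrix.trace_smul, ← smul_mul_assoc, ← map_rat_smul,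
    ← mul_smul_comm, succ_smul_asym, mul_sub, map_sub, sub_mul, Matrix.trace_sub, mul_smul_comm,
    map_rat_smul, smul_mul_assoc, Matrix.trace_smul, ← mul_assoc, ← mul_assoc]

/-- Newton's identities are solved for the hook function with the smaller `k`, descending from the
elementary symmetric function at `k = r + 1` to the power sum at `k = 1`. They involve power sums of
shifted strings, so all shifts `t` are treated at once. -/
theorem commute_powSum {q qi : S} (hq : q * qi = 1)
    (htf : ∀ (c : S) (b : B), c ≠ 0 → c • b = 0 → b = 0)
    {x : ℕ → S} {X : ℕ → Matrix (Fin N) (Fin N) B} (hX : IsString q qi x X) {z : B}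
    (hz : ∀ k t, Commute z (elemE q qi k fun a => X (t + a))) (r t : ℕ) :
    Commute z (powSum q qi r fun a => X (t + a)) := by
  induction r using Nat.strong_induction_on generalizing t with
  | _ r ih =>
    suffices h : ∀ l k, k + l = r + 1 → 1 ≤ k →
        Commute z (hookF q qi (r + 1) k fun a => X (t + a)) by
      rw [← hookF_one]
      exact h r 1 (by omega) le_rfl
    intro l
    induction l with
    | zero =>
      intro k hk _
      obtain rfl : k = r + 1 := by omega
      rw [hookF_self]
      exact hz _ _
    | succ l ihl =>
      intro k hk hk1
      have h1 := ihl (k + 1) (by omega) (by omega)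
      have h2 := newton hq htf (hX.shift_by t) (l := l) hk1
      have h3 : Commute z (powSum q qi l fun a => X (t + (k + a))) := by
        simpa [add_assoc] using ih l (by omega) (t + k)
      rw [hk] at h2
      have h4 : (hookF q qi (r + 1) k fun a => X (t + a)) =
          (k : ℚ)⁻¹ • ((elemE q qi k fun a => X (t + a)) * (powSum q qi l fun a => X (t + (k + a))) -
            ((k : ℚ) + 1) • hookF q qi (r + 1) (k + 1) fun a => X (t + a)) := by
        rw [h2, sub_sub_cancel, smul_smul, inv_mul_cancel₀ (by positivity), one_smul]
      rw [h4]
      exact (((hz k t).mul_right h3).sub_right (h1.smul_right _)).smul_right _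

theorem commute_powSum_powSum [IsDomain S] {q qi : S} (hq : q * qi = 1)
    (htf : ∀ (c : S) (b : B), c ≠ 0 → c • b = 0 → b = 0)
    {x y : ℕ → S} {X Y : ℕ → Matrix (Fin N) (Fin N) B} (hX : IsString q qi x X)
    (hY : IsString q qi y Y) (hXY : ∀ a b, RExchange q qi (x a) (y b) (X a) (Y b))
    (hg : ∀ a b, (qi * y b - q * x a) * (qi * x a - q * y b) ≠ 0) (r r' : ℕ) :
    Commute (powSum q qi r X) (powSum q qi r' Y) := by
  have h1 : ∀ k t k' t', Commute (elemE q qi k fun a => X (t + a))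
      (elemE q qi k' fun b => Y (t' + b)) := fun k t k' t' =>
    commute_elemE hq htf (hX.shift_by t) (hY.shift_by t') (fun a b => hXY _ _) (fun a b => hg _ _) k k'
  have h2 : ∀ k t, Commute (powSum q qi r' Y) (elemE q qi k fun a => X (t + a)) := fun k t => by
    simpa using (commute_powSum hq htf hY (fun k' t' => h1 k t k' t') r' 0).symm
  simpa using (commute_powSum hq htf hX h2 r 0).symm

end Newton

end TrigGaudin

namespace TrigGaudin

/-! ### The operators ϑ_m as coefficients of twisted powers -/

section Theta

variable {N : ℕ} {R : Type*} [Ring R]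

/-- The coefficient of `y^m` in `∑_s y^s ∑_i [(L τ_i(y))^{s-1} L]_{ii}`, where `τ_i` is the diagonal
matrix with entries `τ k i`. -/
noncomputable def thetaGen (L : Matrix (Fin N) (Fin N) R) (τ : Fin N → Fin N → PowerSeries R)
    (m : ℕ) : R :=
  ∑ s ∈ Finset.Icc 1 m, PowerSeries.coeff (m - s) (∑ i,
    ((L.map (PowerSeries.C (R := R)) * Matrix.diagonal fun k => τ k i) ^ (s - 1) *
      L.map (PowerSeries.C (R := R))) i i)

theorem map_thetaGen {R' : Type*} [Ring R'] (f : R →+* R') (L : Matrix (Fin N) (Fin N) R)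
    (τ : Fin N → Fin N → PowerSeries R) (m : ℕ) :
    f (thetaGen L τ m) = thetaGen (L.map f) (fun k i => PowerSeries.map f (τ k i)) m := by
  rw [thetaGen, thetaGen, map_sum]
  refine Finset.sum_congr rfl fun s _ => ?_
  rw [← PowerSeries.coeff_map, map_sum]
  congr 1
  refine Finset.sum_congr rfl fun i _ => ?_
  have h1 : (PowerSeries.map f).mapMatrix (L.map (PowerSeries.C (R := R))) =
      (L.map f).map (PowerSeries.C (R := R')) := by
    ext1 a b; simp
  have h2 : (PowerSeries.map f).mapMatrix (Matrix.diagonal fun k => τ k i) =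
      Matrix.diagonal fun k => PowerSeries.map f (τ k i) := by
    rw [RingHom.mapMatrix_apply, Matrix.diagonal_map (map_zero _)]
  rw [← h1, ← h2, ← map_mul, ← map_pow, ← map_mul]
  rfl

end Theta

/-! ### The resolvents of L and of 1 + hL -/

section GeneratingFunction

variable {N : ℕ} {K O : Type} [CommRing K] [Ring O] [Algebra K O]

theorem chain_const {B : Type} [Ring B] (d X : Matrix (Fin N) (Fin N) B) (r : ℕ) :
    chain d (fun _ => X) r = (X * d) ^ r * X := by
  induction r with
  | zero => simp [chain]
  | succ r ih => rw [chain, ih, pow_succ]; simp only [mul_assoc]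

/-- The substitution `y ↦ h y` for a central element `h`. -/
noncomputable def rescaleHom (O : Type) [Ring O] [Algebra K O] (h : K) :
    PowerSeries O →+* PowerSeries O where
  toFun f := PowerSeries.mk fun n => h ^ n • PowerSeries.coeff n f
  map_zero' := by ext; simp
  map_one' := by
    ext n
    rw [PowerSeries.coeff_mk, PowerSeries.coeff_one]
    split_ifs with hn
    · simp [hn]
    · simp
  map_add' f g := by ext; simp
  map_mul' f g := by
    ext n
    simp only [PowerSeries.coeff_mk, PowerSeries.coeff_mul, Finset.smul_sum]
    refine Finset.sum_congr rfl fun p hp => ?_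
    rw [smul_mul_smul_comm, ← pow_add, Finset.HasAntidiagonal.mem_antidiagonal.1 hp]

theorem coeff_rescaleHom (h : K) (f : PowerSeries O) (n : ℕ) :
    PowerSeries.coeff n (rescaleHom O h f) = h ^ n • PowerSeries.coeff n f :=
  PowerSeries.coeff_mk n fun n => h ^ n • PowerSeries.coeff n f

theorem commute_map_algebraMap (f : PowerSeries K) (g : PowerSeries O) :
    Commute (PowerSeries.map (algebraMap K O) f) g := by
  ext n
  rw [PowerSeries.coeff_mul, PowerSeries.coeff_mul, ← Finset.Nat.sum_antidiagonal_swap]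
  refine Finset.sum_congr rfl fun p _ => ?_
  simp [Algebra.commutes]

theorem one_sub_mul_geom (b : K) :
    (1 - PowerSeries.C b * PowerSeries.X) * PowerSeries.mk (fun n => b ^ n) = 1 := by
  ext n
  rw [sub_mul, one_mul, map_sub, mul_assoc, PowerSeries.coeff_C_mul, PowerSeries.coeff_mk,
    PowerSeries.coeff_one]
  rcases n with _ | n
  · simp
  · rw [PowerSeries.coeff_succ_X_mul, PowerSeries.coeff_mk, pow_succ']
    simp

/-- The deformation of the coefficients of `T(y)`. -/
noncomputable def hTau (q qi : K) (k i : Fin N) : PowerSeries K :=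
  if k = i then 1 else if k < i then PowerSeries.mk fun _ => q
    else PowerSeries.mk fun n => (-1) ^ n * qi ^ (n + 1)

/-- The series is `Z = y/(1 + y)`, and the relation says `y τ(hy) = Z t/(1 - Z t)` for each twist
`t` in `1, q, qi`. It determines `hTau`: the series are `1`, `q/(1 - y)` and `qi/(1 + qi y)`, and
they become the coefficients of `T(y)` at `q = 1`. -/
theorem exists_rescaled_geom {h q qi : K} (hq : q * qi = 1) (hh : q = 1 + h) :
    ∃ Z Z' : PowerSeries K, Z = PowerSeries.X * Z' ∧ ∀ k i : Fin N,
      PowerSeries.X * rescaleHom K h (hTau q qi k i) * (1 - Z * PowerSeries.C (tC q qi k i)) =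
        Z * PowerSeries.C (tC q qi k i) := by
  refine ⟨_, PowerSeries.mk fun n => (-1 : K) ^ n, rfl, fun k i => ?_⟩
  have he := one_sub_mul_geom (-1 : K)
  set e := PowerSeries.mk fun n => (-1 : K) ^ n
  set x : PowerSeries K := PowerSeries.X
  simp only [map_neg, map_one] at he
  rcases lt_cases k i with ⟨h1, h2, h3, h4⟩ | h1 | ⟨h1, h2, h3, h4⟩
  · have hg := one_sub_mul_geom h
    set g := PowerSeries.mk fun n => h ^ n
    have hr : rescaleHom K h (hTau q qi k i) = PowerSeries.C q * g := by
      ext n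
      rw [coeff_rescaleHom]
      simp [hTau, h1, h2, g, mul_comm]
    have hqC : PowerSeries.C q = 1 + PowerSeries.C h := by rw [hh]; simp
    rw [hr]
    simp only [tC, h1, h2, if_true, if_false]
    rw [hqC]
    linear_combination (x * (1 + PowerSeries.C h)) * (e * hg - g * he)
  · have hr : rescaleHom K h (hTau q qi k i) = 1 := by
      rw [hTau, if_pos h1, map_one]
    rw [hr]
    simp only [tC, h1, if_true, map_one]
    linear_combination -x * he
  · have hg := one_sub_mul_geom (-(qi * h))
    set g := PowerSeries.mk fun n => (-(qi * h)) ^ n with hgdef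
    have hr : rescaleHom K h (hTau q qi k i) = PowerSeries.C qi * g := by
      ext n
      rw [coeff_rescaleHom, hTau, if_neg h2, if_neg h4, PowerSeries.coeff_mk,
        PowerSeries.coeff_C_mul, hgdef, PowerSeries.coeff_mk, smul_eq_mul,
        neg_eq_neg_one_mul (qi * h), mul_pow, mul_pow]
      ring
    have hqq : PowerSeries.C q * PowerSeries.C qi = 1 := by rw [← map_mul, hq, map_one]
    have hqC : PowerSeries.C q = 1 + PowerSeries.C h := by rw [hh]; simp
    rw [hqC] at hqq
    rw [map_neg, map_mul] at hg
    rw [hr]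
    simp only [tC, h2, h4, if_false]
    linear_combination (x * PowerSeries.C qi) * (e * hg - g * he) -
      (x ^ 2 * PowerSeries.C qi * e * g) * hqq

theorem commute_diagonal_const {R : Type*} [Ring R] {z : R} (hz : ∀ a, Commute z a)
    (Y : Matrix (Fin N) (Fin N) R) : Commute (Matrix.diagonal fun _ => z) Y := by
  ext i j
  rw [Matrix.diagonal_mul, Matrix.mul_diagonal, (hz _).eq]

/-- A truncated form of `(1 - d)(1 - m)⁻¹ = (1 - a)⁻¹`. The error terms contain `a ^ n` or `m ^ n`,
so low coefficients do not see them when `a` and `m` are divisible by the formal variable. -/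
theorem one_sub_mul_geom_sum_eq {R : Type*} [Ring R] {a d m : R} (h : 1 - m = (1 - a) * (1 - d))
    (n : ℕ) : (1 - d) * ∑ k ∈ Finset.range n, m ^ k = ∑ s ∈ Finset.range n, a ^ s +
      (a ^ n * ((1 - d) * ∑ k ∈ Finset.range n, m ^ k) - (∑ s ∈ Finset.range n, a ^ s) * m ^ n) := by
  have e : (1 - a ^ n) * ((1 - d) * ∑ k ∈ Finset.range n, m ^ k) =
      (∑ s ∈ Finset.range n, a ^ s) * (1 - m ^ n) := by
    rw [← geom_sum_mul_neg a n, ← mul_neg_geom_sum m n, h]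
    simp only [mul_assoc]
  rw [sub_mul, one_mul, mul_sub, mul_one, sub_eq_iff_eq_add] at e
  exact e.trans (by abel)

/-- The expansion of the resolvents of `1 + h L` and of `L`, coefficient by coefficient. -/
theorem sum_coeff_pow_eq {h q qi : K} {Z Z' : PowerSeries K} (hZ : Z = PowerSeries.X * Z')
    (hW : ∀ k i : Fin N,
      PowerSeries.X * rescaleHom K h (hTau q qi k i) * (1 - Z * PowerSeries.C (tC q qi k i)) =
        Z * PowerSeries.C (tC q qi k i))
    (L : Matrix (Fin N) (Fin N) O) (i : Fin N) (j : ℕ) :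
    ∑ s ∈ Finset.range (j + 1), PowerSeries.coeff j (h ^ s • (PowerSeries.X ^ s *
      ((L.map (PowerSeries.C (R := O)) * Matrix.diagonal fun k => PowerSeries.map (algebraMap K O)
        (rescaleHom K h (hTau q qi k i)) : Matrix (Fin N) (Fin N) (PowerSeries O)) ^ s) i i)) =
    ∑ m ∈ Finset.range (j + 1), PowerSeries.coeff j ((1 - Z) * Z ^ m) •
      (((1 + h • L) * Matrix.diagonal fun k => algebraMap K O (tC q qi k i)) ^ m) i i := by
  set μ := PowerSeries.map (algebraMap K O) with hμ
  have hXc : ∀ Y : Matrix (Fin N) (Fin N) (PowerSeries O),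
      Commute (Matrix.diagonal fun _ => PowerSeries.X) Y :=
    commute_diagonal_const fun a => (PowerSeries.commute_X a).symm
  set x : Matrix (Fin N) (Fin N) (PowerSeries O) := Matrix.diagonal fun _ => PowerSeries.X with hx
  have hxapp : ∀ (n : ℕ) (Y : Matrix (Fin N) (Fin N) (PowerSeries O)) (a b : Fin N),
      (x ^ n * Y) a b = PowerSeries.X ^ n * Y a b := fun n Y a b => by
    rw [hx, Matrix.diagonal_pow, Matrix.diagonal_mul]; rfl
  set Lw := L.map (PowerSeries.C (R := O)) with hLw
  set W' : Matrix (Fin N) (Fin N) (PowerSeries O) :=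
    Matrix.diagonal fun k => μ (rescaleHom K h (hTau q qi k i)) with hW'
  set D' : Matrix (Fin N) (Fin N) (PowerSeries O) :=
    Matrix.diagonal fun k => μ (Z' * PowerSeries.C (tC q qi k i)) with hD'
  set D : Matrix (Fin N) (Fin N) (PowerSeries O) :=
    Matrix.diagonal fun k => μ (Z * PowerSeries.C (tC q qi k i)) with hD
  have hDx : D = x * D' := by
    rw [hD, hx, hD', Matrix.diagonal_mul_diagonal]
    congr 1
    ext1 k
    rw [hZ, mul_assoc, map_mul]
    simp [hμ]
  have hWD : (x * W') * (1 - D) = D := by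
    rw [hx, hW', hD, Matrix.diagonal_mul_diagonal, ← Matrix.diagonal_one, Matrix.diagonal_sub,
      Matrix.diagonal_mul_diagonal]
    congr 1
    ext1 k
    conv_rhs => rw [← hW k i, map_mul, map_mul, map_sub, map_one, hμ, PowerSeries.map_X]
  set M := 1 + h • L with hM
  set Mw := M.map (PowerSeries.C (R := O)) with hMw
  have hMw' : Mw = 1 + h • Lw := by
    ext1 a b
    simp only [hMw, hM, hLw, Matrix.map_apply, Matrix.add_apply, Matrix.smul_apply, map_add,
      Matrix.one_apply]
    split_ifs <;> simp [PowerSeries.ext_iff, PowerSeries.coeff_C, apply_ite (h • ·)]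
  set n := j + 1 with hn
  set a := h • (Lw * (x * W')) with ha
  set A := ∑ m ∈ Finset.range n, (Mw * D) ^ m with hA
  set B := ∑ s ∈ Finset.range n, a ^ s with hB
  -- With `a = h L W` and `W (1 - D) = D`, expanding `(1 - a)(1 - D)` gives `1 - D - h L D`.
  have e1 : 1 - Mw * D = (1 - a) * (1 - D) := by
    rw [hMw', ha, sub_mul, one_mul, smul_mul_assoc, mul_assoc Lw, hWD, add_mul, one_mul,
      smul_mul_assoc]
    abel
  have e3 := one_sub_mul_geom_sum_eq e1 n
  have ha' : a = x * (h • (Lw * W')) := by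
    rw [ha, mul_smul_comm, ← mul_assoc, ← mul_assoc, (hXc Lw).eq]
  have hMD' : Mw * D = x * (Mw * D') := by
    rw [hDx, ← mul_assoc, ← mul_assoc, (hXc Mw).eq]
  -- Both error terms are divisible by `y ^ (j + 1)`, hence invisible to the coefficient of `y ^ j`.
  have hzero : ∀ Y : Matrix (Fin N) (Fin N) (PowerSeries O),
      PowerSeries.coeff j ((x ^ n * Y) i i) = 0 := fun Y => by
    rw [hxapp, PowerSeries.coeff_X_pow_mul', if_neg (by omega)]
  have e4 : PowerSeries.coeff j (((1 - D) * A) i i) = PowerSeries.coeff j (B i i) := by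
    have f1 : a ^ n * ((1 - D) * A) = x ^ n * ((h • (Lw * W')) ^ n * ((1 - D) * A)) := by
      rw [show a ^ n = x ^ n * (h • (Lw * W')) ^ n by rw [ha', (hXc _).mul_pow], mul_assoc]
    have f2 : B * (Mw * D) ^ n = x ^ n * (B * (Mw * D') ^ n) := by
      rw [hMD', (hXc _).mul_pow, ← mul_assoc, ← ((hXc B).pow_left n).eq, mul_assoc]
    have e3' : (1 - D) * A = B + (a ^ n * ((1 - D) * A) - B * (Mw * D) ^ n) := e3
    rw [f1, f2, ← mul_sub] at e3'
    have := congrArg (fun Y => PowerSeries.coeff j (Y i i)) e3'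
    simpa only [Matrix.add_apply, map_add, hzero, add_zero] using this
  have e5 : PowerSeries.coeff j (B i i) = ∑ s ∈ Finset.range (j + 1),
      PowerSeries.coeff j (h ^ s • (PowerSeries.X ^ s * ((Lw * W') ^ s) i i)) := by
    rw [hB, Matrix.sum_apply, map_sum]
    refine Finset.sum_congr rfl fun s _ => ?_
    rw [ha', (hXc _).mul_pow, smul_pow, mul_smul_comm, Matrix.smul_apply, hxapp]
  have hδ : D = (Matrix.diagonal fun _ => μ Z) *
      (Matrix.diagonal fun k => algebraMap K O (tC q qi k i)).map (PowerSeries.C (R := O)) := by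
    rw [Matrix.diagonal_map (map_zero _), Matrix.diagonal_mul_diagonal, hD]
    congr 1
    ext1 k
    rw [map_mul, hμ, PowerSeries.map_C]
  set δ := Matrix.diagonal fun k => algebraMap K O (tC q qi k i) with hδdef
  have hZc : ∀ Y : Matrix (Fin N) (Fin N) (PowerSeries O),
      Commute (Matrix.diagonal fun _ => μ Z) Y := commute_diagonal_const fun a =>
    commute_map_algebraMap Z a
  have hMδ : ∀ m, (Mw * D) ^ m = (Matrix.diagonal fun _ => μ Z) ^ m *
      ((M * δ) ^ m).map (PowerSeries.C (R := O)) := fun m => by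
    have : Mw * D = (Matrix.diagonal fun _ => μ Z) * (M * δ).map (PowerSeries.C (R := O)) := by
      rw [hδ, ← mul_assoc, ← (hZc Mw).eq, mul_assoc]
      congr 1
      exact (map_mul (PowerSeries.C (R := O)).mapMatrix M δ).symm
    rw [this, (hZc _).mul_pow]
    congr 1
    exact (map_pow (PowerSeries.C (R := O)).mapMatrix (M * δ) m).symm
  rw [← e5, ← e4, hA, Finset.mul_sum, Matrix.sum_apply, map_sum]
  refine Finset.sum_congr rfl fun m _ => ?_
  rw [hMδ, hD, ← Matrix.diagonal_one, Matrix.diagonal_sub, Matrix.diagonal_mul, Matrix.diagonal_pow,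
    Matrix.diagonal_mul, Matrix.map_apply]
  have : tC q qi i i = 1 := by simp [tC]
  rw [this, map_one, mul_one, ← map_one μ, ← map_sub, Pi.pow_apply, ← map_pow, ← mul_assoc,
    ← map_mul, hμ, PowerSeries.coeff_mul_C, PowerSeries.coeff_map, Algebra.smul_def]

/-- The factor `h ^ j` comes from the substitution of `h y` for `y` together with `h L` for `L`. The
expansion in powers of `1 + h L` has coefficients in `K`, so nothing is divided by `h`, and any
submodule containing `1` and the twisted traces contains the result. -/
theorem smul_thetaGen_mem {h q qi : K} (hq : q * qi = 1) (hh : q = 1 + h)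
    (L : Matrix (Fin N) (Fin N) O) {V : Submodule K O} (hV1 : 1 ∈ V)
    (hV : ∀ r, ∑ i, chain (Matrix.diagonal fun k => algebraMap K O (tC q qi k i))
      (fun _ => 1 + h • L) r i i ∈ V) {j : ℕ} (hj : 1 ≤ j) :
    h ^ j • thetaGen L (fun k i => PowerSeries.map (algebraMap K O) (hTau q qi k i)) j ∈ V := by
  obtain ⟨Z, Z', hZ, hW⟩ := exists_rescaled_geom (N := N) hq hh
  have key : h ^ j • thetaGen L (fun k i => PowerSeries.map (algebraMap K O) (hTau q qi k i)) j =
      ∑ i, ∑ s ∈ Finset.range (j + 1), PowerSeries.coeff j (h ^ s • (PowerSeries.X ^ s *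
      ((L.map (PowerSeries.C (R := O)) * Matrix.diagonal fun k => PowerSeries.map (algebraMap K O)
        (rescaleHom K h (hTau q qi k i)) : Matrix (Fin N) (Fin N) (PowerSeries O)) ^ s) i i)) := by
    rw [Finset.sum_comm, thetaGen, Finset.smul_sum, Finset.sum_range_eq_add_Ico _ (by omega)]
    have h0 : ∑ i : Fin N, PowerSeries.coeff j (h ^ 0 • (PowerSeries.X ^ 0 *
      ((L.map (PowerSeries.C (R := O)) * Matrix.diagonal fun k => PowerSeries.map (algebraMap K O)
        (rescaleHom K h (hTau q qi k i)) : Matrix (Fin N) (Fin N) (PowerSeries O)) ^ 0) i i)) = 0 := by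
      refine Finset.sum_eq_zero fun i _ => ?_
      simp [PowerSeries.coeff_one, show j ≠ 0 by omega]
    rw [h0, zero_add, show Finset.Icc 1 j = Finset.Ico 1 (j + 1) from rfl]
    refine Finset.sum_congr rfl fun s hs => ?_
    obtain ⟨hs1, hs2⟩ := Finset.mem_Ico.1 hs
    rw [map_sum, Finset.smul_sum]
    refine Finset.sum_congr rfl fun i _ => ?_
    set τ : Matrix (Fin N) (Fin N) (PowerSeries O) :=
      Matrix.diagonal fun k => PowerSeries.map (algebraMap K O) (hTau q qi k i)
    set Lw := L.map (PowerSeries.C (R := O))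
    have e1 : (Matrix.diagonal fun k =>
        PowerSeries.map (algebraMap K O) (rescaleHom K h (hTau q qi k i))) =
        (rescaleHom O h).mapMatrix τ := by
      rw [RingHom.mapMatrix_apply, Matrix.diagonal_map (map_zero _)]
      congr 1
      ext k m
      simp [coeff_rescaleHom, Algebra.smul_def]
    have e2 : Lw = (rescaleHom O h).mapMatrix Lw := by
      ext a b m
      rw [RingHom.mapMatrix_apply, Matrix.map_apply, coeff_rescaleHom]
      simp only [Lw, Matrix.map_apply, PowerSeries.coeff_C]
      split_ifs with hm
      · simp [hm]
      · simp
    have e3 : (Lw * τ) ^ s = (Lw * τ) ^ (s - 1) * Lw * τ := by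
      rw [mul_assoc, ← pow_succ, show s - 1 + 1 = s by omega]
    have e4 : PowerSeries.map (algebraMap K O) (hTau q qi i i) = 1 := by simp [hTau]
    rw [e1]
    conv_rhs => rw [e2, ← map_mul, ← map_pow]
    rw [e3, RingHom.mapMatrix_apply, Matrix.map_apply, Matrix.mul_diagonal, e4, mul_one, PowerSeries.coeff_smul,
      PowerSeries.coeff_X_pow_mul', if_pos (by omega), coeff_rescaleHom, smul_smul, ← pow_add,
      show s + (j - s) = j by omega]
  rw [key]
  simp only [sum_coeff_pow_eq hZ hW]
  rw [Finset.sum_comm]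
  refine V.sum_mem fun m _ => ?_
  rw [← Finset.smul_sum]
  refine V.smul_mem _ ?_
  rcases m with _ | r
  · simp only [pow_zero, Matrix.one_apply_eq]
    exact V.sum_mem fun _ _ => hV1
  · convert hV r using 1
    refine Finset.sum_congr rfl fun i _ => ?_
    rw [chain_const, pow_succ, ← mul_assoc, Matrix.mul_diagonal]
    simp [tC]

end GeneratingFunction

end TrigGaudin

/-! ### Identification of ϑ_m with the generating function of twisted powers -/

namespace TrigGaudin

theorem prod_map_finRange {W : Type*} [Ring W] {n : ℕ} (f : Fin n → W) (g : ℕ → W)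
    (h : ∀ a : Fin n, g a = f a) : ((List.finRange n).map f).prod = prodUp g n := by
  induction n with
  | zero => simp [prodUp]
  | succ n ih =>
    rw [List.finRange_succ_last, List.map_append, List.prod_append, List.map_map, prodUp,
      ih (f ∘ Fin.castSucc) fun a => h a.castSucc]
    simp [← h]

theorem prod_map_reverse_finRange {W : Type*} [Ring W] {n : ℕ} (f : Fin n → W) (g : ℕ → W)
    (h : ∀ a : Fin n, g a = f a) : ((List.finRange n).reverse.map f).prod = prodDown g n := by
  induction n with
  | zero => simp [prodDown]
  | succ n ih =>
    rw [List.finRange_succ_last, List.reverse_append, List.map_append, List.prod_append,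
      ← List.map_reverse, List.map_map, prodDown, ih (f ∘ Fin.castSucc) fun a => h a.castSucc]
    simp [← h]

theorem T_eq_ice (N : ℕ) : T N = ice (fun _ _ => 0) (hTau (1 : ℂ) 1) := by
  have hα : (1 - PowerSeries.X : PowerSeries ℂ)⁻¹ = PowerSeries.mk fun _ => 1 := by
    rw [eq_comm, PowerSeries.eq_inv_iff_mul_eq_one (by simp)]
    simpa [mul_comm] using one_sub_mul_geom (1 : ℂ)
  have hβ : (1 + PowerSeries.X : PowerSeries ℂ)⁻¹ =
      PowerSeries.mk fun n => (-1) ^ n * 1 ^ (n + 1) := by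
    rw [eq_comm, PowerSeries.eq_inv_iff_mul_eq_one (by simp)]
    simpa [mul_comm] using one_sub_mul_geom (-1 : ℂ)
  have hs : ∀ (i j a b c d : Fin N), (Matrix.single i j (1 : PowerSeries ℂ) ⊗ₖ
      Matrix.single j i (1 : PowerSeries ℂ)) (a, b) (c, d) =
      if i = a then (if j = b then (if (c, d) = (b, a) then 1 else 0) else 0) else 0 := by
    intro i j a b c d
    rw [Matrix.kroneckerMap_apply, Matrix.single_apply, Matrix.single_apply]
    by_cases h1 : i = a
    · by_cases h2 : j = b
      · subst h1 h2
        by_cases h3 : (c, d) = (j, i)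
        · obtain ⟨rfl, rfl⟩ := Prod.mk.inj h3
          simp
        · rw [if_pos rfl, if_pos rfl, if_neg h3]
          simp only [true_and, mul_ite, mul_one, mul_zero]
          simp only [Prod.mk.injEq, not_and] at h3
          by_cases h4 : j = c
          · have h5 : ¬ i = d := fun h => h3 h4.symm h.symm
            simp [h5]
          · simp [h4]
      · simp [h2]
    · simp [h1]
  ext1 ⟨a, b⟩ ⟨c, d⟩
  simp only [T, hα, hβ, Matrix.add_apply, Matrix.sum_apply, Matrix.smul_apply, hs, ice, hTau,
    Matrix.of_apply, Prod.swap_prod_mk, ite_self, zero_add]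
  simp only [Finset.sum_filter, Fintype.sum_prod_type]
  have hd : ∀ (P : Fin N → Fin N → Prop) [∀ i j, Decidable (P i j)], (∑ i, ∑ j, if P i j then
      (if i = a then (if j = b then (if (c, d) = (b, a) then (1 : PowerSeries ℂ) else 0) else 0)
        else 0) else 0) = if P a b then (if (c, d) = (b, a) then 1 else 0) else 0 := by
    intro P _
    rw [Finset.sum_eq_single a, Finset.sum_eq_single b]
    · simp
    · intro j _ hj; simp [hj]
    · simp
    · intro i _ hi; simp [hi]
    · simp
  have hd' : (∑ i, if i = a then (if i = b then (if (c, d) = (b, a) then (1 : PowerSeries ℂ)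
      else 0) else 0) else 0) = if a = b then (if (c, d) = (b, a) then 1 else 0) else 0 := by
    rw [Finset.sum_eq_single a]
    · simp
    · intro i _ hi; simp [hi]
    · simp
  rw [hd', hd (fun i j => i < j), hd (fun i j => j < i)]
  by_cases h : (c, d) = (b, a)
  · rw [if_pos h, if_pos h]
    rcases lt_cases a b with ⟨h1, h2, h3, h4⟩ | h1 | ⟨h1, h2, h3, h4⟩
    · simp [h1, h2, h4]
    · simp [h1]
    · simp [h1, h2, h4]
  · simp [h]

/-- `T(y)` is a permutation twisted by the coefficients `hTau 1 1`, so the trace over `s` sites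
collapses to matrix products of `Lbar` and diagonal matrices of central series. -/
theorem vartheta_eq_thetaGen (N m : ℕ) :
    vartheta N m = thetaGen (Lbar N)
      (fun k i => PowerSeries.map (algebraMap ℂ (Op (UPlus N))) (hTau 1 1 k i)) m := by
  rw [vartheta, thetaGen]
  refine Finset.sum_congr rfl fun s hs => ?_
  obtain ⟨hs1, hs2⟩ := Finset.mem_Icc.1 hs
  rw [PowerSeries.coeff_X_pow_mul', if_pos hs2]
  congr 1
  obtain ⟨r, rfl⟩ : ∃ r, s = r + 1 := ⟨s - 1, by omega⟩
  rw [Nat.add_sub_cancel, traceSeries]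
  set t : Fin N → Fin N → PowerSeries (Op (UPlus N)) := fun k i =>
    PowerSeries.map (algebraMap ℂ (Op (UPlus N))) (hTau 1 1 k i) with ht
  have hT : (T N).map (PowerSeries.map (algebraMap ℂ (Op (UPlus N)))) = ice (fun _ _ => 0) t := by
    rw [T_eq_ice]
    ext1 p p'
    simp only [ice, Matrix.map_apply, Matrix.of_apply, ht]
    split_ifs <;> simp
  rw [hT, prod_map_reverse_finRange
      (fun a : Fin r => site₂ a.castSucc a.succ (ice (fun _ _ => 0) t)) (permN (r + 1) t) fun a => permN_of_lt (by omega) t,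
    prod_map_finRange (fun a : Fin (r + 1) => site a ((Lbar N).map (PowerSeries.C (R := Op (UPlus N)))))
      (siteN (r + 1) fun _ => (Lbar N).map (PowerSeries.C (R := Op (UPlus N))))
      fun a => siteN_of_lt a.2 _,
    trace_prodDown_permN_mul_prodUp_siteN t fun i j z => commute_map_algebraMap _ _]
  refine Finset.sum_congr rfl fun i _ => ?_
  rw [chain_const]

end TrigGaudin

namespace TrigGaudin

/-! ### Naturality and rescaling of the exchange relation -/

section Naturality

variable {N : ℕ} {S S' B B' : Type} [CommRing S] [CommRing S'] [Ring B] [Ring B']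
  [Algebra S B] [Algebra S' B']

theorem map_chain (F : B →+* B') (d : Matrix (Fin N) (Fin N) B) (X : ℕ → Matrix (Fin N) (Fin N) B)
    (r : ℕ) : (chain d X r).map F = chain (d.map F) (fun a => (X a).map F) r := by
  induction r with
  | zero => rfl
  | succ r ih => rw [chain, chain, Matrix.map_mul, Matrix.map_mul, ih]

theorem map_powSum (f : S →+* S') (F : B →+* B')
    (hF : ∀ c, F (algebraMap S B c) = algebraMap S' B' (f c)) (q qi : S) (r : ℕ)
    (X : ℕ → Matrix (Fin N) (Fin N) B) :
    F (powSum q qi r X) = powSum (f q) (f qi) r fun a => (X a).map F := by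
  rw [powSum, powSum, map_sum]
  refine Finset.sum_congr rfl fun i _ => ?_
  rw [← Matrix.map_apply (f := F), map_chain, Matrix.diagonal_map (map_zero _)]
  congr 3
  ext1 k
  rw [hF]
  congr 1
  simp only [tC]
  split_ifs <;> simp

theorem RExchange.of_smul {q qi x y c c' : S} {X Y X' Y' : Matrix (Fin N) (Fin N) B}
    (htf : ∀ b : B, (c * c') • b = 0 → b = 0) (hX : ∀ i j, c • X i j = X' i j)
    (hY : ∀ i j, c' • Y i j = Y' i j) (h : RExchange q qi x y X' Y') : RExchange q qi x y X Y := by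
  intro i j k l
  have := h i j k l
  simp only [← hX, ← hY, smul_mul_assoc, mul_smul_comm, smul_smul] at this
  rw [mul_comm c' c] at this
  rw [← sub_eq_zero]
  refine htf _ ?_
  rw [smul_sub, smul_add, smul_add, this, sub_self]

/-- Left multiplication by a diagonal matrix of scalars preserves the exchange relation. -/
theorem RExchange.diagonal_mul {q qi x y : S} {X Y : Matrix (Fin N) (Fin N) B} (D : Fin N → S)
    (h : RExchange q qi x y X Y) :
    RExchange q qi x y (Matrix.of fun i j => D i • X i j) (Matrix.of fun i j => D i • Y i j) := by
  intro i j k l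
  have := congrArg ((D i * D j) • ·) (h i j k l)
  simp only [Matrix.of_apply, smul_mul_assoc, mul_smul_comm, smul_smul, smul_add] at this ⊢
  rw [mul_comm (D j) (D i)]
  exact this

end Naturality

/-! ### Solutions of the exchange relation in power series -/

section SeriesLax

open PowerSeries

variable {N : ℕ} {K n : Type} [CommRing K] [IsDomain K] [Fintype n] [DecidableEq n]

/-- A matrix of series in one variable satisfies the exchange relation. -/
def SeriesExchange (q qi : K) (X : Matrix (Fin N) (Fin N) (Matrix n n K⟦X⟧)) : Prop :=
  ∀ (S : Type) [CommRing S] [IsDomain S] [Algebra K S] (f g : K⟦X⟧ →ₐ[K] S),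
    Function.Injective f → Function.Injective g →
    RExchange (algebraMap K S q) (algebraMap K S qi) (f PowerSeries.X) (g PowerSeries.X)
      (X.map f.mapMatrix) (X.map g.mapMatrix)

/-- The shifted matrices `X(q^{2a} u)`. -/
noncomputable def qShift (q : K) (X : Matrix (Fin N) (Fin N) (Matrix n n K⟦X⟧)) (a : ℕ) :
    Matrix (Fin N) (Fin N) (Matrix n n K⟦X⟧) :=
  X.map (rescaleAlgHom ((q ^ 2) ^ a)).mapMatrix

theorem injective_rescaleAlgHom {c : K} (hc : c ≠ 0) :
    Function.Injective (rescaleAlgHom c) := by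
  rw [injective_iff_map_eq_zero]
  intro f hf
  ext m
  have : coeff m (rescaleAlgHom c f) = c ^ m * coeff m f := by
    have := congrArg (fun F => F f) (coe_rescaleAlgHom c)
    simp only [RingHom.coe_coe] at this
    rw [this, coeff_rescale]
  rw [hf, map_zero, eq_comm, mul_eq_zero] at this
  simpa [pow_ne_zero m hc] using this

theorem rescaleAlgHom_X (c : K) : rescaleAlgHom c (X : K⟦X⟧) = C c * X := by
  have := congrArg (fun F => F X) (coe_rescaleAlgHom c)
  simp only [RingHom.coe_coe] at this
  rw [this, rescale_X]

/-- The embedding of the series in one variable as series in the first of two variables. -/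
noncomputable def embLeft (K : Type) [CommRing K] : K⟦X⟧ →ₐ[K] K⟦X⟧⟦X⟧ :=
  { (C : K⟦X⟧ →+* K⟦X⟧⟦X⟧) with
    commutes' := fun c => by
      rw [PowerSeries.algebraMap_apply (A := K⟦X⟧), PowerSeries.algebraMap_apply]; rfl }

/-- The embedding of the series in one variable as series in the second of two variables. -/
noncomputable def embRight (K : Type) [CommRing K] : K⟦X⟧ →ₐ[K] K⟦X⟧⟦X⟧ :=
  mapAlgHom (Algebra.ofId K K⟦X⟧)

theorem coeff_coeff_embLeft_mul_embRight (f g : K⟦X⟧) (a b : ℕ) :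
    coeff a (coeff b (embLeft K f * embRight K g)) = coeff a f * coeff b g := by
  have h1 : embLeft K f = C f := rfl
  have h2 : coeff b (embRight K g) = C (coeff b g) := by
    exact coeff_map _ _ _
  rw [h1, coeff_C_mul, h2, coeff_mul_C]

theorem rescaleAlgHom_comp_X {S : Type} [CommRing S] [Algebra K S] (e : K⟦X⟧ →ₐ[K] S) (c : K) :
    e.comp (rescaleAlgHom c) X = algebraMap K S c * e X := by
  rw [AlgHom.comp_apply, rescaleAlgHom_X, map_mul, ← e.commutes]
  rfl

/-- The rescalings `u ↦ q^{2a} u` composed with `e` are again embeddings, so the exchange relation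
applies to neighbouring members of the string although only one variable is present. -/
theorem SeriesExchange.isString {q qi : K} (hq : q * qi = 1)
    (hq2 : q ^ 2 - 1 ≠ 0) {X : Matrix (Fin N) (Fin N) (Matrix n n K⟦X⟧)}
    (hX : SeriesExchange q qi X) {S : Type} [CommRing S] [IsDomain S] [Algebra K S]
    {e : K⟦X⟧ →ₐ[K] S} (he : Function.Injective e) :
    IsString (algebraMap K S q) (algebraMap K S qi)
      (fun a => algebraMap K S ((q ^ 2) ^ a) * e PowerSeries.X)
      (fun a => (qShift q X a).map e.mapMatrix) := by
  have hq0 : q ≠ 0 := left_ne_zero_of_mul_eq_one hq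
  have hqa : ∀ a : ℕ, (q ^ 2) ^ a ≠ 0 := fun a => pow_ne_zero _ (pow_ne_zero _ hq0)
  have halg : Function.Injective (algebraMap K S) := by
    have : ⇑(algebraMap K S) = e ∘ C := funext fun c => (e.commutes c).symm
    rw [this]
    exact he.comp C_injective
  have he0 : e PowerSeries.X ≠ 0 := (map_ne_zero_iff e he).2 X_ne_zero
  have hinj : ∀ a : ℕ, Function.Injective (e.comp (rescaleAlgHom ((q ^ 2) ^ a))) := fun a =>
    he.comp (injective_rescaleAlgHom (hqa a))
  refine ⟨fun a => ?_, fun a => mul_ne_zero (mul_ne_zero ?_ he0) ?_, fun a => ?_⟩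
  · rw [pow_succ, map_mul, map_pow _ q]
    ring
  · exact (map_ne_zero_iff _ halg).2 (hqa a)
  · rw [← map_pow, ← map_one (algebraMap K S), ← map_sub]
    exact (map_ne_zero_iff _ halg).2 hq2
  · have := hX S _ _ (hinj a) (hinj (a + 1))
    rwa [rescaleAlgHom_comp_X, rescaleAlgHom_comp_X] at this

theorem SeriesExchange.commute_powSum {q qi : K} (hq : q * qi = 1)
    (hq2 : q ^ 2 - 1 ≠ 0) {X : Matrix (Fin N) (Fin N) (Matrix n n K⟦X⟧)}
    (hX : SeriesExchange q qi X) {S : Type} [CommRing S] [IsDomain S] [Algebra K S] [Algebra ℚ S]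
    {e e' : K⟦X⟧ →ₐ[K] S} (he : Function.Injective e) (he' : Function.Injective e')
    (hg : ∀ c c', c ≠ 0 → c' ≠ 0 →
      algebraMap K S c * e PowerSeries.X - algebraMap K S c' * e' PowerSeries.X ≠ 0) (r r' : ℕ) :
    Commute ((powSum (C q) (C qi) r (qShift q X)).map e)
      ((powSum (C q) (C qi) r' (qShift q X)).map e') := by
  have hq0 : q ≠ 0 := left_ne_zero_of_mul_eq_one hq
  have hqi0 : qi ≠ 0 := right_ne_zero_of_mul_eq_one hq
  have hqa : ∀ a : ℕ, (q ^ 2) ^ a ≠ 0 := fun a => pow_ne_zero _ (pow_ne_zero _ hq0)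
  have hinj : ∀ (e : K⟦X⟧ →ₐ[K] S), Function.Injective e → ∀ a : ℕ,
      Function.Injective (e.comp (rescaleAlgHom ((q ^ 2) ^ a))) := fun e he a =>
    he.comp (injective_rescaleAlgHom (hqa a))
  have hmap : ∀ (e : K⟦X⟧ →ₐ[K] S) (r : ℕ),
      (powSum (C q) (C qi) r (qShift q X)).map e = powSum (algebraMap K S q) (algebraMap K S qi) r
      (fun a => (qShift q X a).map e.mapMatrix) := by
    intro e r
    have := map_powSum e.toRingHom e.mapMatrix.toRingHom ?_ (C q) (C qi) r (qShift q X)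
    · refine Eq.trans this ?_
      congr 1
      · exact e.commutes q
      · exact e.commutes qi
    · intro c
      ext1 i j
      simp [Matrix.algebraMap_matrix_apply, apply_ite e]
  rw [hmap, hmap]
  refine commute_powSum_powSum ?_ ?_ (hX.isString hq hq2 he) (hX.isString hq hq2 he') ?_ ?_ _ _
  · rw [← map_mul, hq, map_one]
  · intro c b hc h
    ext i j : 1
    have := congrFun (congrFun h i) j
    simpa [hc] using this
  · intro a b
    have := hX S _ _ (hinj e he a) (hinj e' he' b)
    rwa [rescaleAlgHom_comp_X, rescaleAlgHom_comp_X] at this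
  · intro a b
    simp only [← mul_assoc, ← map_mul]
    exact mul_ne_zero (fun h => hg (q * (q ^ 2) ^ a) (qi * (q ^ 2) ^ b) (mul_ne_zero hq0 (hqa a))
      (mul_ne_zero hqi0 (hqa b)) (by rw [← neg_sub, h, neg_zero]))
      (hg _ _ (mul_ne_zero hqi0 (hqa a)) (mul_ne_zero hq0 (hqa b)))

/-- The two power sums are placed in independent variables `u`, `v` inside `K⟦X⟧⟦X⟧`. No multiples
of `u` and `v` by nonzero constants coincide there, so unitarity is nondegenerate; the coefficient
of `u^a v^b` then gives the claim. -/
theorem SeriesExchange.commute_coeff_powSum [Algebra ℚ K] {q qi : K} (hq : q * qi = 1)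
    (hq2 : q ^ 2 - 1 ≠ 0) {X : Matrix (Fin N) (Fin N) (Matrix n n K⟦X⟧)}
    (hX : SeriesExchange q qi X) (r r' a b : ℕ) :
    Commute ((powSum (C q) (C qi) r (qShift q X)).map (coeff a))
      ((powSum (C q) (C qi) r' (qShift q X)).map (coeff b)) := by
  have hl : Function.Injective (embLeft K) := C_injective
  have hr : Function.Injective (embRight K) := map_injective _ C_injective
  have halg : ∀ c, algebraMap K K⟦X⟧⟦X⟧ c = C (C c) := fun c => by
    rw [PowerSeries.algebraMap_apply (A := K⟦X⟧), PowerSeries.algebraMap_apply]; rfl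
  have key := hX.commute_powSum hq hq2 hl hr (fun c c' hc hc' h => hc' ?_) r r'
  · set Y := powSum (C q) (C qi) r (qShift q X)
    set Y' := powSum (C q) (C qi) r' (qShift q X)
    ext i j
    have h1 := congrArg (fun M => coeff a (coeff b (M i j))) key.eq
    simp only [Matrix.mul_apply, map_sum, Matrix.map_apply,
      coeff_coeff_embLeft_mul_embRight] at h1 ⊢
    rw [h1]
    refine Finset.sum_congr rfl fun k _ => ?_
    rw [mul_comm, coeff_coeff_embLeft_mul_embRight, mul_comm]
  · have h1 : embLeft K PowerSeries.X = C PowerSeries.X := rfl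
    have h2 : embRight K PowerSeries.X = PowerSeries.X := map_X _
    rw [halg, halg, h1, h2, ← map_mul] at h
    have := congrArg (coeff 0) (congrArg (coeff 1) h)
    rw [map_sub, coeff_C, coeff_C_mul, coeff_one_X] at this
    simpa using this

end SeriesLax

end TrigGaudin

namespace TrigGaudin

/-! ### The shift operator and the deformed differential operators -/

section ShiftOperators

open PowerSeries

variable {N : ℕ} {K n : Type} [CommRing K] [Fintype n] [DecidableEq n]

theorem coeff_rescaleAlgHom (c : K) (f : K⟦X⟧) (m : ℕ) :
    coeff m (rescaleAlgHom c f) = c ^ m * coeff m f := by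
  have := congrArg (fun F => F f) (coe_rescaleAlgHom c)
  simp only [RingHom.coe_coe] at this
  rw [this, coeff_rescale]

/-- The operator `g(u) ↦ g(q² u)` on matrices of power series. -/
noncomputable def shiftOp (n : Type) [Fintype n] [DecidableEq n] (q : K) :
    Module.End K (Matrix n n K⟦X⟧) :=
  (rescaleAlgHom (q ^ 2)).mapMatrix.toLinearMap

theorem shiftOp_pow_apply (q : K) (a : ℕ) (g : Matrix n n K⟦X⟧) :
    (shiftOp n q ^ a) g = (rescaleAlgHom ((q ^ 2) ^ a)).mapMatrix g := by
  induction a with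
  | zero =>
    ext i j m
    rw [AlgHom.mapMatrix_apply, Matrix.map_apply, coeff_rescaleAlgHom]
    simp
  | succ a ih =>
    rw [pow_succ', Module.End.mul_apply, ih]
    ext i j m
    rw [shiftOp, AlgHom.toLinearMap_apply]
    simp only [AlgHom.mapMatrix_apply, Matrix.map_apply, coeff_rescaleAlgHom]
    ring

/-- The quotient of `q^{2m} - 1` by `h`, where `q = 1 + h`. -/
def qNum (h q : K) (m : ℕ) : K := (2 + h) * ∑ k ∈ Finset.range m, (q ^ 2) ^ k

theorem mul_qNum {h q : K} (hh : q = 1 + h) (m : ℕ) : h * qNum h q m = (q ^ 2) ^ m - 1 := by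
  rw [qNum, ← mul_assoc, ← mul_geom_sum, hh]
  ring

/-- The deformation of the Euler operator `2u∂_u`. -/
noncomputable def eulerOp (n : Type) (h q : K) : Module.End K (Matrix n n K⟦X⟧) where
  toFun g := Matrix.of fun i j => mk fun m => qNum h q m * coeff m (g i j)
  map_add' f g := by ext i j m; simp [mul_add]
  map_smul' c g := by
    ext i j m
    simp only [Matrix.of_apply, coeff_mk, Matrix.smul_apply, PowerSeries.coeff_smul, smul_eq_mul,
      RingHom.id_apply]
    ring

theorem coeff_eulerOp (h q : K) (g : Matrix n n K⟦X⟧) (i j : n) (m : ℕ) :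
    coeff m (eulerOp n h q g i j) = qNum h q m * coeff m (g i j) :=
  coeff_mk m fun m => qNum h q m * coeff m (g i j)

theorem shiftOp_eq {h q : K} (hh : q = 1 + h) : shiftOp n q = 1 + h • eulerOp n h q := by
  ext g i j m
  have h1 := congrFun (congrFun (shiftOp_pow_apply q 1 g) i) j
  rw [pow_one, pow_one] at h1
  rw [h1, AlgHom.mapMatrix_apply, Matrix.map_apply, coeff_rescaleAlgHom, LinearMap.add_apply,
    LinearMap.smul_apply, Matrix.add_apply, Matrix.smul_apply, map_add, PowerSeries.coeff_smul,
    coeff_eulerOp, smul_eq_mul, ← mul_assoc, mul_qNum hh]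
  simp
  ring

/-- The operator matrix `Y(u) S + θ`, where `S` is the shift operator and `θ` the deformed Euler
operator. -/
noncomputable def laxOp (h q : K) (Y : Matrix (Fin N) (Fin N) (Matrix n n K⟦X⟧)) :
    Matrix (Fin N) (Fin N) (Module.End K (Matrix n n K⟦X⟧)) :=
  Matrix.of fun i j => LinearMap.mulLeft K (Y i j) * shiftOp n q + if i = j then eulerOp n h q else 0

/-- Since `S = 1 + hθ`, one has `1 + h(YS + θ) = S + hYS = (1 + hY)S`. -/
theorem one_add_smul_laxOp {h q : K} (hh : q = 1 + h)
    {X Y : Matrix (Fin N) (Fin N) (Matrix n n K⟦X⟧)} (hXY : X = 1 + h • Y) :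
    1 + h • laxOp h q Y = Matrix.of fun i j => LinearMap.mulLeft K (X i j) * shiftOp n q := by
  ext1 i j
  have h1 : LinearMap.mulLeft K (X i j) =
      (1 : Matrix (Fin N) (Fin N) (Module.End K (Matrix n n K⟦X⟧))) i j +
        h • LinearMap.mulLeft K (Y i j) := by
    ext1 g
    rw [hXY]
    by_cases hij : i = j
    · subst hij
      simp [add_mul]
    · simp [hij]
  rw [Matrix.of_apply, h1, Matrix.add_apply, Matrix.smul_apply, laxOp, Matrix.of_apply, add_mul,
    smul_add, smul_mul_assoc, add_comm (h • _) (h • _), ← add_assoc]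
  congr 1
  by_cases hij : i = j
  · subst hij
    rw [if_pos rfl, Matrix.one_apply_eq, one_mul, shiftOp_eq hh]
  · rw [if_neg hij, Matrix.one_apply_ne hij, zero_mul, smul_zero, add_zero]

/-- All shifts are pushed to the right through `S X(u) = X(q² u) S`, which turns powers of `X S`
into products along a `q²`-string. -/
theorem chain_mulLeft_shiftOp (q : K) (t : Fin N → K)
    (X : Matrix (Fin N) (Fin N) (Matrix n n K⟦X⟧)) (r : ℕ) (i k : Fin N) (g : Matrix n n K⟦X⟧) :
    chain (Matrix.diagonal fun k => algebraMap K (Module.End K (Matrix n n K⟦X⟧)) (t k))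
      (fun _ => Matrix.of fun i j => LinearMap.mulLeft K (X i j) * shiftOp n q) r i k g =
    chain (Matrix.diagonal fun k => algebraMap K⟦X⟧ (Matrix n n K⟦X⟧) (C (t k))) (qShift q X) r i k *
      (shiftOp n q ^ (r + 1)) g := by
  induction r generalizing k g with
  | zero =>
    simp only [chain, Matrix.of_apply, Module.End.mul_apply, LinearMap.mulLeft_apply, zero_add,
      pow_one]
    congr 1
    ext a b m
    simp only [qShift, Matrix.map_apply, AlgHom.mapMatrix_apply, coeff_rescaleAlgHom]
    simp
  | succ r ih =>
    rw [chain, chain, Matrix.mul_apply, Matrix.mul_apply, LinearMap.sum_apply, Finset.sum_mul]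
    refine Finset.sum_congr rfl fun l _ => ?_
    rw [Matrix.mul_diagonal, Matrix.mul_diagonal, Module.End.mul_apply, Module.End.mul_apply,
      Module.algebraMap_end_apply, map_smul, ih, Matrix.of_apply, Module.End.mul_apply,
      LinearMap.mulLeft_apply, shiftOp_pow_apply, map_mul, pow_succ _ (r + 1), Module.End.mul_apply,
      shiftOp_pow_apply]
    have : algebraMap K⟦X⟧ (Matrix n n K⟦X⟧) (C (t l)) = algebraMap K (Matrix n n K⟦X⟧) (t l) := rfl
    rw [this, ← Algebra.commutes, ← Algebra.smul_def, smul_mul_assoc, smul_mul_assoc, mul_assoc]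
    rfl

/-- The matrix `u^j`. -/
noncomputable def monoMat (K n : Type) [CommRing K] [DecidableEq n] (j : ℕ) : Matrix n n K⟦X⟧ :=
  Matrix.diagonal fun _ => X ^ j

/-- The operators `Y` such that the coefficients of all `Y(u^j)` commute with `z`. -/
def commutingOps (z : Matrix n n K) : Submodule K (Module.End K (Matrix n n K⟦X⟧)) where
  carrier := {Y | ∀ j a, Commute ((Y (monoMat K n j)).map (coeff a)) z}
  zero_mem' j a := by
    have : ((0 : Module.End K (Matrix n n K⟦X⟧)) (monoMat K n j)).map (coeff a) = 0 := by
      ext; simp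
    rw [this]
    exact Commute.zero_left z
  add_mem' {Y Y'} hY hY' j a := by
    have : ((Y + Y') (monoMat K n j)).map (coeff a) =
        (Y (monoMat K n j)).map (coeff a) + (Y' (monoMat K n j)).map (coeff a) := by ext; simp
    rw [this]
    exact (hY j a).add_left (hY' j a)
  smul_mem' c Y hY j a := by
    have : ((c • Y) (monoMat K n j)).map (coeff a) = c • (Y (monoMat K n j)).map (coeff a) := by
      ext; simp
    rw [this]
    exact (hY j a).smul_left c

theorem coeff_mul_monoMat (g : Matrix n n K⟦X⟧) (c : K) (j a : ℕ) :
    (g * c • monoMat K n j).map (coeff a) = if j ≤ a then c • g.map (coeff (a - j)) else 0 := by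
  ext i k
  rw [Matrix.map_apply, mul_smul_comm, Matrix.smul_apply, monoMat, Matrix.mul_diagonal,
    PowerSeries.coeff_smul, coeff_mul_X_pow']
  split_ifs <;> simp

theorem one_mem_commutingOps (z : Matrix n n K) : 1 ∈ commutingOps z := by
  intro j a
  have := coeff_mul_monoMat (1 : Matrix n n K⟦X⟧) 1 j a
  rw [one_mul, one_smul] at this
  rw [Module.End.one_apply, this]
  split_ifs
  · have h1 : (1 : Matrix n n K⟦X⟧).map (coeff (a - j)) = coeff (a - j) (1 : K⟦X⟧) • 1 := by
      ext i k
      by_cases hik : i = k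
      · simp [hik]
      · simp [hik]
    rw [one_smul, h1]
    exact (Commute.one_left z).smul_left _
  · exact Commute.zero_left z

theorem shiftOp_pow_monoMat (q : K) (a j : ℕ) :
    (shiftOp n q ^ a) (monoMat K n j) = ((q ^ 2) ^ a) ^ j • monoMat K n j := by
  rw [shiftOp_pow_apply]
  ext i k m
  rw [AlgHom.mapMatrix_apply, Matrix.map_apply, coeff_rescaleAlgHom, monoMat, Matrix.smul_apply,
    PowerSeries.coeff_smul, Matrix.diagonal_apply]
  split_ifs
  · rw [coeff_X_pow]
    split_ifs with hm
    · rw [hm, smul_eq_mul]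
    · simp
  · simp

/-- The operator is multiplication by a power sum after a power of the shift, and `u^j` is an
eigenvector of the shift; so its value on `u^j` has scalar multiples of the coefficients of the
power sum as coefficients. -/
theorem sum_chain_mem_commutingOps {q qi : K} {X : Matrix (Fin N) (Fin N) (Matrix n n K⟦X⟧)}
    {z : Matrix n n K} (r : ℕ)
    (hz : ∀ a, Commute ((powSum (C q) (C qi) r (qShift q X)).map (coeff a)) z) :
    ∑ i, chain (Matrix.diagonal fun k =>
        algebraMap K (Module.End K (Matrix n n K⟦X⟧)) (tC q qi k i))
      (fun _ => Matrix.of fun i j => LinearMap.mulLeft K (X i j) * shiftOp n q) r i i ∈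
      commutingOps z := by
  intro j a
  have h1 : (∑ i, chain (Matrix.diagonal fun k =>
        algebraMap K (Module.End K (Matrix n n K⟦X⟧)) (tC q qi k i))
      (fun _ => Matrix.of fun i j => LinearMap.mulLeft K (X i j) * shiftOp n q) r i i)
      (monoMat K n j) = powSum (C q) (C qi) r (qShift q X) *
        ((q ^ 2) ^ (r + 1)) ^ j • monoMat K n j := by
    rw [LinearMap.sum_apply, powSum, Finset.sum_mul]
    refine Finset.sum_congr rfl fun i _ => ?_
    rw [chain_mulLeft_shiftOp, shiftOp_pow_monoMat]
    have : ∀ k, C (tC q qi k i) = tC (C q) (C qi) k i := fun k => by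
      simp only [tC]
      split_ifs <;> simp
    simp only [this]
  rw [h1, coeff_mul_monoMat]
  split_ifs
  · exact (hz _).smul_left _
  · exact Commute.zero_left z

/-- The coefficients of the deformed operators commute. -/
theorem SeriesExchange.commute_thetaGen [IsDomain K] [Algebra ℚ K] {h q qi : K} (hq : q * qi = 1)
    (hh : q = 1 + h) (h0 : h ≠ 0) (hq2 : q ^ 2 - 1 ≠ 0)
    {X Y : Matrix (Fin N) (Fin N) (Matrix n n K⟦X⟧)} (hX : SeriesExchange q qi X)
    (hXY : X = 1 + h • Y) {m m' : ℕ} (hm : 1 ≤ m) (hm' : 1 ≤ m') (j j' a a' : ℕ) :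
    Commute ((thetaGen (laxOp h q Y) (fun k i => PowerSeries.map (algebraMap K _) (hTau q qi k i)) m
        (monoMat K n j)).map (coeff a))
      ((thetaGen (laxOp h q Y) (fun k i => PowerSeries.map (algebraMap K _) (hTau q qi k i)) m'
        (monoMat K n j')).map (coeff a')) := by
  -- Passing from power sums to `thetaGen` works against any fixed matrix `z`. It is used once with
  -- `z` a coefficient of a power sum and once with `z` a coefficient of a value of `thetaGen`.
  have step : ∀ z : Matrix n n K,
      (∀ r a, Commute ((powSum (C q) (C qi) r (qShift q X)).map (coeff a)) z) → ∀ {m : ℕ}, 1 ≤ m →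
      thetaGen (laxOp h q Y) (fun k i => PowerSeries.map (algebraMap K _) (hTau q qi k i)) m ∈
        commutingOps z := by
    intro z hz m hm
    have h1 := smul_thetaGen_mem hq hh (laxOp h q Y) (one_mem_commutingOps z) (fun r => by
      rw [one_add_smul_laxOp hh hXY]
      exact sum_chain_mem_commutingOps r (hz r)) hm
    intro j a
    have h2 := h1 j a
    set W := (thetaGen (laxOp h q Y)
      (fun k i => PowerSeries.map (algebraMap K _) (hTau q qi k i)) m (monoMat K n j)) with hW
    have h3 : ((h ^ m • thetaGen (laxOp h q Y)
      (fun k i => PowerSeries.map (algebraMap K _) (hTau q qi k i)) m) (monoMat K n j)).map (coeff a)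
        = h ^ m • W.map (coeff a) := by
      ext; simp [hW]
    rw [h3, commute_iff_eq, smul_mul_assoc, mul_smul_comm] at h2
    exact smul_right_injective _ (pow_ne_zero m h0) h2
  refine step _ (fun r b => (step _ (fun r' b' => ?_) hm' j' a').symm) hm j a
  exact hX.commute_coeff_powSum hq hq2 _ _ _ _

end ShiftOperators

end TrigGaudin

namespace TrigGaudin

/-! ### Specialization at h = 0 -/

section Reduction

open PowerSeries

/-- The ring `ℂ[[h]]` of formal series in the deformation parameter. -/
def FormalRing : Type := ℂ⟦X⟧

noncomputable instance : CommRing FormalRing := inferInstanceAs (CommRing ℂ⟦X⟧)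

instance : IsDomain FormalRing := inferInstanceAs (IsDomain ℂ⟦X⟧)

noncomputable instance : Algebra ℂ FormalRing := inferInstanceAs (Algebra ℂ ℂ⟦X⟧)

noncomputable instance : Algebra ℚ FormalRing := inferInstanceAs (Algebra ℚ ℂ⟦X⟧)

/-- The specialization `h = 0`. -/
noncomputable def spec : FormalRing →ₐ[ℂ] ℂ :=
  { (constantCoeff : ℂ⟦X⟧ →+* ℂ) with
    commutes' := fun c => constantCoeff_C c }

/-- The deformation parameter. -/
noncomputable def hh : FormalRing := (X : ℂ⟦X⟧)

/-- The parameter `q = 1 + h`. -/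
noncomputable def qh : FormalRing := 1 + hh

/-- The inverse of `q = 1 + h`. -/
noncomputable def qih : FormalRing := PowerSeries.inv (1 + X : ℂ⟦X⟧)

theorem qh_mul_qih : qh * qih = 1 := by
  have h : (1 + X : ℂ⟦X⟧) * (1 + X)⁻¹ = 1 := PowerSeries.mul_inv_cancel _ (by simp)
  exact h

theorem hh_ne_zero : hh ≠ 0 := X_ne_zero (R := ℂ)

theorem spec_hh : spec hh = 0 := constantCoeff_X (R := ℂ)

theorem spec_qh : spec qh = 1 := by simp [qh, spec_hh]

theorem spec_qih : spec qih = 1 := by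
  have := congrArg spec qh_mul_qih
  rwa [map_mul, spec_qh, one_mul, map_one] at this

theorem qh_sq_sub_one_ne_zero : qh ^ 2 - 1 ≠ 0 := fun h => by
  have h1 : qh ^ 2 - 1 = hh * (2 + hh) := by rw [qh]; ring
  rw [h1, mul_eq_zero] at h
  rcases h with h | h
  · exact hh_ne_zero h
  · simpa [spec_hh, map_ofNat spec 2] using congrArg spec h

variable {N : ℕ} {n A : Type} [Fintype n] [DecidableEq n] [Ring A] [Algebra ℂ A]

/-- The coefficient of `u^m` at `h = 0`. -/
noncomputable def red (g : Matrix n n FormalRing⟦X⟧) (m : ℕ) : Matrix n n ℂ :=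
  g.map fun f => spec (coeff m f)

theorem red_mul (g g' : Matrix n n FormalRing⟦X⟧) (m : ℕ) :
    red (g * g') m = ∑ p ∈ Finset.HasAntidiagonal.antidiagonal m, red g p.1 * red g' p.2 := by
  ext i j
  simp only [red, Matrix.map_apply, Matrix.mul_apply, Matrix.sum_apply, map_sum,
    PowerSeries.coeff_mul, map_mul]
  exact Finset.sum_comm

theorem red_add (g g' : Matrix n n FormalRing⟦X⟧) (m : ℕ) : red (g + g') m = red g m + red g' m := by
  ext; simp [red]

theorem red_neg (g : Matrix n n FormalRing⟦X⟧) (m : ℕ) : red (-g) m = -red g m := by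
  ext; simp [red]

theorem red_sub (g g' : Matrix n n FormalRing⟦X⟧) (m : ℕ) : red (g - g') m = red g m - red g' m := by
  ext; simp [red]

theorem red_smul (c : FormalRing) (g : Matrix n n FormalRing⟦X⟧) (m : ℕ) :
    red (c • g) m = spec c • red g m := by
  ext; simp [red]

/-- A series `f` and a deformed matrix series `g` agree at `h = 0` under the representation `φ`. -/
def Compat (φ : A →ₐ[ℂ] Matrix n n ℂ) (f : A⟦X⟧) (g : Matrix n n FormalRing⟦X⟧) : Prop :=
  ∀ m, φ (coeff m f) = red g m

theorem Compat.add {φ : A →ₐ[ℂ] Matrix n n ℂ} {f f' : A⟦X⟧} {g g' : Matrix n n FormalRing⟦X⟧}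
    (h : Compat φ f g) (h' : Compat φ f' g') : Compat φ (f + f') (g + g') := fun m => by
  rw [map_add, map_add, h, h', red_add]

theorem Compat.neg {φ : A →ₐ[ℂ] Matrix n n ℂ} {f : A⟦X⟧} {g : Matrix n n FormalRing⟦X⟧}
    (h : Compat φ f g) : Compat φ (-f) (-g) := fun m => by
  rw [map_neg, map_neg, h, red_neg]

theorem Compat.mul {φ : A →ₐ[ℂ] Matrix n n ℂ} {f f' : A⟦X⟧} {g g' : Matrix n n FormalRing⟦X⟧}
    (h : Compat φ f g) (h' : Compat φ f' g') : Compat φ (f * f') (g * g') := fun m => by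
  rw [PowerSeries.coeff_mul, map_sum, red_mul]
  refine Finset.sum_congr rfl fun p _ => ?_
  rw [map_mul, h, h']

theorem Compat.smul {φ : A →ₐ[ℂ] Matrix n n ℂ} {f : A⟦X⟧} {g : Matrix n n FormalRing⟦X⟧}
    (c : FormalRing) (h : Compat φ f g) : Compat φ (spec c • f) (c • g) := fun m => by
  rw [PowerSeries.coeff_smul, map_smul, h, red_smul]

theorem Compat.zero (φ : A →ₐ[ℂ] Matrix n n ℂ) : Compat φ 0 0 := fun m => by
  ext; simp [red]

theorem compat_monoMat (φ : A →ₐ[ℂ] Matrix n n ℂ) (j : ℕ) :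
    Compat φ (X ^ j) (monoMat FormalRing n j) := fun m => by
  ext a b
  rw [red, Matrix.map_apply, monoMat, Matrix.diagonal_apply]
  rw [coeff_X_pow]
  by_cases hm : m = j
  · by_cases hab : a = b
    · simp [hm, hab]
    · simp [hm, hab]
  · by_cases hab : a = b
    · simp [hm, hab, coeff_X_pow]
    · simp [hm, hab]

/-- Pairs of operators which preserve agreement at `h = 0`. -/
noncomputable def fiberRing (φ : A →ₐ[ℂ] Matrix n n ℂ) :
    Subring (Op A × Module.End FormalRing (Matrix n n FormalRing⟦X⟧)) where
  carrier := {p | ∀ f g, Compat φ f g → Compat φ (p.1 f) (p.2 g)}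
  zero_mem' _ _ _ := Compat.zero φ
  one_mem' _ _ h := h
  add_mem' hp hp' f g h := (hp f g h).add (hp' f g h)
  neg_mem' hp f g h := (hp f g h).neg
  mul_mem' hp hp' f g h := hp _ _ (hp' f g h)

theorem mulOp_mem_fiberRing {φ : A →ₐ[ℂ] Matrix n n ℂ} {f : A⟦X⟧} {g : Matrix n n FormalRing⟦X⟧}
    (h : Compat φ f g) : (mulOp A f, LinearMap.mulLeft FormalRing g) ∈ fiberRing φ :=
  fun _ _ h' => h.mul h'

theorem algebraMap_mem_fiberRing (φ : A →ₐ[ℂ] Matrix n n ℂ) (c : FormalRing) :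
    (algebraMap ℂ (Op A) (spec c), algebraMap FormalRing _ c) ∈ fiberRing φ :=
  fun _ _ h => h.smul c

theorem spec_qNum (m : ℕ) : spec (qNum hh qh m) = 2 * (m : ℂ) := by
  simp [qNum, spec_qh, spec_hh, map_ofNat spec 2]

theorem coeff_eulerDiff (f : A⟦X⟧) (m : ℕ) :
    coeff m (((2 : ℂ) • (mulOp A X * dOp A)) f) = (2 * (m : ℂ)) • coeff m f := by
  rw [LinearMap.smul_apply, Module.End.mul_apply, PowerSeries.coeff_smul, mulOp,
    LinearMap.mulLeft_apply, mul_smul]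
  congr 1
  rcases m with _ | m
  · simp
  · rw [coeff_succ_X_mul, dOp]
    simp only [LinearMap.coe_mk, AddHom.coe_mk, coeff_mk]
    rw [Nat.cast_smul_eq_nsmul]

theorem eulerOp_mem_fiberRing (φ : A →ₐ[ℂ] Matrix n n ℂ) :
    ((2 : ℂ) • (mulOp A X * dOp A), eulerOp n hh qh) ∈ fiberRing φ := by
  intro f g h m
  rw [coeff_eulerDiff, map_smul, h]
  ext i j
  rw [red, red, Matrix.map_apply, coeff_eulerOp, map_mul, spec_qNum]
  rfl

theorem shiftOp_mem_fiberRing (φ : A →ₐ[ℂ] Matrix n n ℂ) :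
    ((1 : Op A), shiftOp n qh) ∈ fiberRing φ := by
  rw [shiftOp_eq (h := hh) (q := qh) rfl]
  have h1 := (fiberRing φ).add_mem (fiberRing φ).one_mem
    ((fiberRing φ).mul_mem (algebraMap_mem_fiberRing φ hh) (eulerOp_mem_fiberRing φ))
  convert h1 using 1
  ext1
  · simp [spec_hh]
  · rw [Prod.snd_add, Prod.snd_mul, Algebra.smul_def]; rfl

theorem map_spec_hTau (k i : Fin N) :
    PowerSeries.map (spec : FormalRing →+* ℂ) (hTau qh qih k i) = hTau (1 : ℂ) 1 k i := by
  simp only [hTau]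
  split_ifs
  · simp
  · ext m; simp [spec_qh]
  · ext m; simp [spec_qih]

/-- Agreement of `L` and its deformation at `h = 0` passes to the operators built from them. -/
theorem compat_thetaGen {φ : A →ₐ[ℂ] Matrix n n ℂ} {L : Matrix (Fin N) (Fin N) (Op A)}
    {L' : Matrix (Fin N) (Fin N) (Module.End FormalRing (Matrix n n FormalRing⟦X⟧))}
    (hL : ∀ i j, (L i j, L' i j) ∈ fiberRing φ) (m : ℕ) :
    (thetaGen L (fun k i => PowerSeries.map (algebraMap ℂ (Op A)) (hTau 1 1 k i)) m,
      thetaGen L' (fun k i => PowerSeries.map (algebraMap FormalRing _) (hTau qh qih k i)) m) ∈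
      fiberRing φ := by
  -- The matrix and the twists are lifted to the subring of compatible pairs. Naturality of
  -- `thetaGen` under the two projections then shows that the pair of results lies in this subring.
  let Lt : Matrix (Fin N) (Fin N) (fiberRing φ) := Matrix.of fun i j => ⟨_, hL i j⟩
  let t : Fin N → Fin N → PowerSeries (fiberRing φ) := fun k i => mk fun m =>
    ⟨_, algebraMap_mem_fiberRing φ (coeff m (hTau qh qih k i))⟩
  have h1 := map_thetaGen ((RingHom.fst _ _).comp (fiberRing φ).subtype) Lt t m
  have h2 := map_thetaGen ((RingHom.snd _ _).comp (fiberRing φ).subtype) Lt t m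
  have e1 : (fun k i => PowerSeries.map ((RingHom.fst _ _).comp (fiberRing φ).subtype) (t k i)) =
      fun k i => PowerSeries.map (algebraMap ℂ (Op A)) (hTau 1 1 k i) := by
    ext1 k; ext1 i; ext1 m
    rw [← map_spec_hTau, coeff_map, coeff_map, coeff_map, coeff_mk]
    rfl
  have e2 : (fun k i => PowerSeries.map ((RingHom.snd _ _).comp (fiberRing φ).subtype) (t k i)) =
      fun k i => PowerSeries.map (algebraMap FormalRing _) (hTau qh qih k i) := by
    ext1 k; ext1 i; ext1 m
    rw [coeff_map, coeff_map, coeff_mk]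
    rfl
  rw [e1] at h1
  rw [e2] at h2
  have h3 := (thetaGen Lt t m).2
  convert h3 using 1
  exact Prod.ext h1.symm h2.symm

/-- A representation of `U(ĝ⁺)` that is the limit at `h = 0` of a solution of the exchange relation
for the trigonometric `R`-matrix. -/
structure Quantization (φ : UPlus N →ₐ[ℂ] Matrix n n ℂ) where
  /-- The solution, a matrix of polynomials in the spectral parameter. -/
  lax : Matrix (Fin N) (Fin N) (Matrix n n (Polynomial FormalRing))
  /-- The common denominator. -/
  den : Polynomial FormalRing
  /-- The deformation of the image of `𝓛⁺(u)`. -/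
  gen : Matrix (Fin N) (Fin N) (Matrix n n FormalRing⟦X⟧)
  den_ne_zero : Polynomial.aeval (X : FormalRing⟦X⟧) den ≠ 0
  lax_eq : ∀ i j, Polynomial.aeval (X : FormalRing⟦X⟧) den •
    ((1 : Matrix (Fin N) (Fin N) (Matrix n n FormalRing⟦X⟧)) i j - hh • gen i j) =
      (Polynomial.aeval X).mapMatrix (lax i j)
  red_gen : ∀ i j m, red (gen i j) m = φ (UniversalEnvelopingAlgebra.ι ℂ (lMode i j m))
  exchange : ∀ (S : Type) [CommRing S] [Algebra FormalRing S] (x y : S),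
    RExchange (algebraMap FormalRing S qh) (algebraMap FormalRing S qih) x y
      (lax.map (Polynomial.aeval x).mapMatrix) (lax.map (Polynomial.aeval y).mapMatrix)

namespace Quantization

variable {φ : UPlus N →ₐ[ℂ] Matrix n n ℂ} (Q : Quantization φ)

/-- The deformation of `-ρ - 𝓛⁺(u)`. -/
noncomputable def twisted : Matrix (Fin N) (Fin N) (Matrix n n FormalRing⟦X⟧) :=
  Matrix.of fun i j => -Q.gen i j + (hh * algebraMap ℂ FormalRing (rho N i)) • Q.gen i j -
    (algebraMap ℂ FormalRing (rho N i)) • (1 : Matrix (Fin N) (Fin N) (Matrix n n FormalRing⟦X⟧)) i j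

/-- The correction `h ρ gen` in `twisted` vanishes at `h = 0` and makes `1 + h twisted` factor as
`(1 - hρ)(1 - h gen)`. So `ρ` enters through left multiplication by a scalar diagonal matrix, which
preserves the exchange relation. -/
theorem one_add_smul_twisted (i j : Fin N) :
    (1 + hh • Q.twisted) i j = (1 - hh * algebraMap ℂ FormalRing (rho N i)) •
      ((1 : Matrix (Fin N) (Fin N) (Matrix n n FormalRing⟦X⟧)) i j - hh • Q.gen i j) := by
  rw [Matrix.add_apply, Matrix.smul_apply, twisted, Matrix.of_apply]
  simp only [smul_sub, smul_add, sub_smul, one_smul, smul_neg, smul_smul]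
  rw [sub_mul, one_mul, sub_smul, mul_assoc hh, mul_comm _ hh, mul_smul, mul_smul]
  simp only [smul_smul]
  rw [mul_comm hh (_ * _), mul_comm _ hh]
  abel

/-- The exchange relation for the polynomial solution is evaluated at the images of `u`, divided by
the nonzero denominators, and multiplied by the diagonal matrix `1 - hρ`. -/
theorem seriesExchange : SeriesExchange qh qih (1 + hh • Q.twisted) := by
  intro S _ _ _ f g hf hg
  have h1 := Q.exchange S (f X) (g X)
  have hev : ∀ e : FormalRing⟦X⟧ →ₐ[FormalRing] S, ∀ i j, e (Polynomial.aeval X Q.den) •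
      e.mapMatrix ((1 : Matrix (Fin N) (Fin N) (Matrix n n FormalRing⟦X⟧)) i j - hh • Q.gen i j) =
      (Q.lax.map (Polynomial.aeval (e X)).mapMatrix) i j := by
    intro e i j
    have := congrArg e.mapMatrix (Q.lax_eq i j)
    ext1 a b
    have h2 := congrFun (congrFun this a) b
    simp only [AlgHom.mapMatrix_apply, Matrix.map_apply, Matrix.smul_apply, smul_eq_mul,
      map_mul] at h2 ⊢
    rw [h2, Polynomial.aeval_algHom_apply]
  have h2 : RExchange (algebraMap FormalRing S qh) (algebraMap FormalRing S qih) (f X) (g X)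
      (Matrix.of fun i j => f.mapMatrix
        ((1 : Matrix (Fin N) (Fin N) (Matrix n n FormalRing⟦X⟧)) i j - hh • Q.gen i j))
      (Matrix.of fun i j => g.mapMatrix
        ((1 : Matrix (Fin N) (Fin N) (Matrix n n FormalRing⟦X⟧)) i j - hh • Q.gen i j)) := by
    refine RExchange.of_smul (fun b hb => ?_) (hev f) (hev g) h1
    have h0 : f (Polynomial.aeval X Q.den) * g (Polynomial.aeval X Q.den) ≠ 0 :=
      mul_ne_zero ((map_ne_zero_iff f hf).2 Q.den_ne_zero) ((map_ne_zero_iff g hg).2 Q.den_ne_zero)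
    ext i j : 1
    have := congrFun (congrFun hb i) j
    rw [Matrix.smul_apply, smul_eq_mul] at this
    exact (mul_eq_zero.1 this).resolve_left h0
  have h3 := h2.diagonal_mul fun i => algebraMap FormalRing S (1 - hh * algebraMap ℂ FormalRing (rho N i))
  have hm : ∀ e : FormalRing⟦X⟧ →ₐ[FormalRing] S, (1 + hh • Q.twisted).map e.mapMatrix =
      Matrix.of fun i j => algebraMap FormalRing S (1 - hh * algebraMap ℂ FormalRing (rho N i)) • (Matrix.of fun i j => e.mapMatrix
        ((1 : Matrix (Fin N) (Fin N) (Matrix n n FormalRing⟦X⟧)) i j - hh • Q.gen i j)) i j := by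
    intro e
    ext1 i j
    rw [Matrix.map_apply, one_add_smul_twisted, map_smul, Matrix.of_apply, Matrix.of_apply,
      algebraMap_smul]
  rw [hm, hm]
  exact h3

theorem Lbar_mem_fiberRing (i j : Fin N) :
    (Lbar N i j, laxOp hh qh Q.twisted i j) ∈ fiberRing φ := by
  have hc : Compat φ (-Lplus N i j - rho N i • (1 : Matrix (Fin N) (Fin N) (UPlus N)⟦X⟧) i j)
      (Q.twisted i j) := by
    intro m
    rw [twisted, Matrix.of_apply, red_sub, red_add, red_neg, red_smul, red_smul, Q.red_gen]
    have h1 : red ((1 : Matrix (Fin N) (Fin N) (Matrix n n FormalRing⟦X⟧)) i j) m =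
        φ (coeff m ((1 : Matrix (Fin N) (Fin N) (UPlus N)⟦X⟧) i j)) := by
      by_cases hij : i = j
      · have h2 := compat_monoMat φ 0 m
        rw [pow_zero] at h2
        subst hij
        rw [Matrix.one_apply_eq, Matrix.one_apply_eq, h2]
        congr 1
      · rw [Matrix.one_apply_ne hij, Matrix.one_apply_ne hij, ← Compat.zero φ m]
    rw [h1]
    simp [Lplus, spec_hh]
  have h1 := (fiberRing φ).add_mem ((fiberRing φ).mul_mem (mulOp_mem_fiberRing hc)
    (shiftOp_mem_fiberRing φ)) (show (if i = j then ((2 : ℂ) •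
      (mulOp (UPlus N) X * dOp (UPlus N)), eulerOp n hh qh) else 0) ∈ fiberRing φ by
      split_ifs
      · exact eulerOp_mem_fiberRing φ
      · exact (fiberRing φ).zero_mem)
  convert h1 using 1
  ext1
  · rw [Prod.fst_add, Prod.fst_mul, mul_one, Lbar, Matrix.sub_apply, Matrix.sub_apply]
    ext1 f
    by_cases hij : i = j
    · subst hij
      simp [mulOp, sub_mul]
      abel
    · simp [mulOp, hij]
  · rw [Prod.snd_add, Prod.snd_mul, laxOp, Matrix.of_apply]
    split_ifs <;> rfl

/-- The images of the coefficients of the operators `ϑ_m` under a quantized representation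
commute. -/
theorem commute_coeff_vartheta (Q : Quantization φ) {m m' : ℕ} (hm : 1 ≤ m) (hm' : 1 ≤ m') (j j' a a' : ℕ) :
    Commute (φ (coeff a (vartheta N m (X ^ j)))) (φ (coeff a' (vartheta N m' (X ^ j')))) := by
  have hc : ∀ m j, Compat φ (vartheta N m (X ^ j)) _ := fun m j => by
    rw [vartheta_eq_thetaGen]
    exact compat_thetaGen Q.Lbar_mem_fiberRing m _ _ (compat_monoMat φ j)
  rw [hc m j a, hc m' j' a']
  have := Q.seriesExchange.commute_thetaGen qh_mul_qih rfl hh_ne_zero qh_sq_sub_one_ne_zero rfl hm hm'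
    j j' a a'
  exact this.map spec.mapMatrix

end Quantization

end Reduction

end TrigGaudin

namespace TrigGaudin

/-! ### Products of solutions, and the R-matrix as a solution -/

section Fusion

variable {N : ℕ} {S B B' : Type} [CommRing S] [Ring B] [Algebra S B] [Ring B'] [Algebra S B']

theorem RExchange.map {q qi x y : S} {X Y : Matrix (Fin N) (Fin N) B} (f : B →ₐ[S] B')
    (h : RExchange q qi x y X Y) : RExchange q qi x y (X.map f) (Y.map f) := by
  intro i j k l
  have := congrArg f (h i j k l)
  simpa only [map_add, map_mul, AlgHom.commutes, Matrix.map_apply] using this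

theorem rexchange_one (q qi x y : S) :
    RExchange q qi x y (1 : Matrix (Fin N) (Fin N) B) 1 := by
  intro i j k l
  have h1 : ∀ a b c d : Fin N, (1 : Matrix (Fin N) (Fin N) B) a b * (1 : Matrix (Fin N) (Fin N) B) c d
      = if a = b ∧ c = d then 1 else 0 := fun a b c d => by
    rw [Matrix.one_apply, Matrix.one_apply]
    split_ifs <;> simp_all
  rw [h1, h1, h1]
  congr 1
  · by_cases h : i = k ∧ j = l
    · rw [if_pos h, if_pos h.symm, h.1, h.2]
    · rw [if_neg h, if_neg fun h' => h h'.symm, mul_zero, mul_zero]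
  · by_cases h : j = k ∧ i = l
    · rw [if_pos h, h.1, h.2]
    · rw [if_neg h, mul_zero, mul_zero]

/-- The product of two commuting solutions of the exchange relation is a solution. -/
theorem RExchange.mul {q qi x y : S} {X Y X' Y' : Matrix (Fin N) (Fin N) B}
    (h : RExchange q qi x y X Y) (h' : RExchange q qi x y X' Y')
    (hXY : ∀ i j k l, Commute (X' i j) (Y k l)) (hYX : ∀ i j k l, Commute (Y' i j) (X k l)) :
    RExchange q qi x y (X * X') (Y * Y') := by
  intro i j k l
  set A := fun i j => algebraMap S B (rA q qi x y i j) with hA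
  set C := fun i j => algebraMap S B (rC q qi x y i j) with hC
  have cA : ∀ i j (b : B), A i j * b = b * A i j := fun i j b => Algebra.commutes _ _
  have cC : ∀ i j (b : B), C i j * b = b * C i j := fun i j b => Algebra.commutes _ _
  have e1 : ∀ i k j l, (X * X') i k * (Y * Y') j l =
      ∑ m, ∑ p, X i m * Y j p * (X' m k * Y' p l) := by
    intro i k j l
    rw [Matrix.mul_apply, Matrix.mul_apply, Finset.sum_mul_sum]
    refine Finset.sum_congr rfl fun m _ => Finset.sum_congr rfl fun p _ => ?_
    rw [mul_assoc, ← mul_assoc (X' m k), (hXY m k j p).eq]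
    simp only [mul_assoc]
  have e2 : ∀ i k j l, (Y * Y') j l * (X * X') i k =
      ∑ m, ∑ p, Y j p * X i m * (Y' p l * X' m k) := by
    intro i k j l
    rw [Matrix.mul_apply, Matrix.mul_apply, Finset.sum_mul_sum, Finset.sum_comm]
    refine Finset.sum_congr rfl fun m _ => Finset.sum_congr rfl fun p _ => ?_
    rw [mul_assoc, ← mul_assoc (Y' p l), (hYX p l i m).eq]
    simp only [mul_assoc]
  have f1 : A i j * ((X * X') i k * (Y * Y') j l) + C i j * ((X * X') j k * (Y * Y') i l) =
      ∑ m, ∑ p, (A m p * (Y j p * X i m) + C p m * (Y j m * X i p)) * (X' m k * Y' p l) := by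
    rw [e1, e1, Finset.mul_sum, Finset.mul_sum, ← Finset.sum_add_distrib]
    refine Finset.sum_congr rfl fun m _ => ?_
    rw [Finset.mul_sum, Finset.mul_sum, ← Finset.sum_add_distrib]
    refine Finset.sum_congr rfl fun p _ => ?_
    rw [← h i j m p]
    simp only [add_mul, mul_assoc, hA, hC]
  have f2 : A k l * ((Y * Y') j l * (X * X') i k) + C l k * ((Y * Y') j k * (X * X') i l) =
      ∑ m, ∑ p, Y j p * X i m * (A m p * (X' m k * Y' p l) + C m p * (X' p k * Y' m l)) := by
    rw [e2, e2, Finset.mul_sum, Finset.mul_sum, ← Finset.sum_add_distrib]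
    refine Finset.sum_congr rfl fun m _ => ?_
    rw [Finset.mul_sum, Finset.mul_sum, ← Finset.sum_add_distrib]
    refine Finset.sum_congr rfl fun p _ => ?_
    rw [h' m p k l, mul_add, cA, cC, cA, cC]
    simp only [mul_assoc, hA, hC]
  refine f1.trans (Eq.trans ?_ f2.symm)
  simp only [add_mul, mul_add, Finset.sum_add_distrib]
  congr 1
  · refine Finset.sum_congr rfl fun m _ => Finset.sum_congr rfl fun p _ => ?_
    rw [cA, mul_assoc]
  · rw [Finset.sum_comm]
    refine Finset.sum_congr rfl fun m _ => Finset.sum_congr rfl fun p _ => ?_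
    rw [cC, mul_assoc]

/-- The fundamental solution of the exchange relation, the `R`-matrix `R(t, 1)`. -/
def ell (N : ℕ) (q qi t : S) : Matrix (Fin N) (Fin N) (Matrix (Fin N) (Fin N) S) :=
  Matrix.of fun i k => Matrix.of fun p s =>
    (if i = k ∧ p = s then rA q qi t 1 i p else 0) + (if p = k ∧ s = i then rC q qi t 1 i p else 0)

theorem ell_apply (q qi t : S) (i k p s : Fin N) : ell N q qi t i k p s =
    (if i = k ∧ p = s then rA q qi t 1 i p else 0) +
      (if p = k ∧ s = i then rC q qi t 1 i p else 0) := rfl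

theorem map_ell {S' : Type} [CommRing S'] (f : S →+* S') (q qi t : S) :
    (ell N q qi t).map f.mapMatrix = ell N (f q) (f qi) (f t) := by
  ext i k p s
  rw [Matrix.map_apply, RingHom.mapMatrix_apply, Matrix.map_apply, ell_apply, ell_apply, map_add,
    apply_ite f, apply_ite f]
  congr 2
  · simp only [rA]; split_ifs <;> simp
  · simp
  · simp only [rC]; split_ifs <;> simp
  · simp

theorem ell_mul_apply (q qi t : S) (i k p s : Fin N) (M : Matrix (Fin N) (Fin N) S) :
    (ell N q qi t i k * M) p s = (if i = k then rA q qi t 1 i p * M p s else 0) +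
      (if p = k then rC q qi t 1 i p * M i s else 0) := by
  rw [Matrix.mul_apply]
  simp only [ell_apply, add_mul, Finset.sum_add_distrib, ite_and, ite_mul, zero_mul]
  congr 1
  · split_ifs <;> simp
  · split_ifs <;> simp

/-- This is the Yang–Baxter equation with third parameter `1`, the third tensor factor playing the
role of the representation space. -/
theorem rexchange_ell {q qi : S} (hq : q * qi = 1) (t x y : S) :
    RExchange q qi x y (ell N q qi (t * x)) (ell N q qi (t * y)) := by
  intro i j k l
  ext p s
  -- `F k l` is the indicator of the triple `(k, l, s)`; pairing with it extracts matrix entries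
  -- from the action on vectors.
  let F : Fin N → Fin N → Fin N → Fin N → Fin N → S := fun k l i' j' p' =>
    if i' = k then (if j' = l then (if p' = s then 1 else 0) else 0) else 0
  have m1 : ∀ (z w : S) (i j k l : Fin N), (ell N q qi z i k * ell N q qi w j l) p s =
      rA q qi z 1 i p * (rA q qi w 1 j p * F k l i j p + rC q qi w 1 j p * F k l i p j) +
      rC q qi z 1 i p * (rA q qi w 1 j i * F k l p j i + rC q qi w 1 j i * F k l p i j) := by
    intro z w i j k l
    rw [ell_mul_apply, ell_apply, ell_apply]
    simp only [F, ite_and, eq_comm (a := s)]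
    congr 1
    · by_cases h : i = k
      · simp [h]
      · simp [h]
    · by_cases h : p = k
      · simp [h]
      · simp [h]
  have m2 : ∀ (z w : S) (i j k l : Fin N), (ell N q qi w j l * ell N q qi z i k) p s =
      rA q qi w 1 j p * (rA q qi z 1 i p * F k l i j p + rC q qi z 1 i p * F k l p j i) +
      rC q qi w 1 j p * (rA q qi z 1 i j * F k l i p j + rC q qi z 1 i j * F k l j p i) := by
    intro z w i j k l
    rw [ell_mul_apply, ell_apply, ell_apply]
    simp only [F, ite_and, eq_comm (a := s)]
    congr 1
    · by_cases h : j = l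
      · simp [h]
      · simp [h]
    · by_cases h : p = l
      · simp [h]
      · simp [h]
  -- Against an indicator, the coefficients of the R-matrix at the row indices may be replaced by
  -- those at the column indices `k`, `l`.
  have m3 : ∀ i j p, rA q qi x y i j * F k l i j p + rC q qi x y i j * F k l j i p =
      rA q qi x y k l * F k l i j p + rC q qi x y l k * F l k i j p := by
    intro i j p
    have g1 : rA q qi x y i j * F k l i j p = rA q qi x y k l * F k l i j p := by
      simp only [F]
      by_cases h1 : i = k
      · by_cases h2 : j = l
        · rw [h1, h2]
        · simp [h2]
      · simp [h1]
    have g2 : rC q qi x y i j * F k l j i p = rC q qi x y l k * F l k i j p := by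
      simp only [F]
      by_cases h1 : i = l
      · by_cases h2 : j = k
        · simp [h1, h2]
        · simp [h2]
      · simp [h1]
    rw [g1, g2]
  have key := yang_baxter_scalar hq t x y 1 (F k l) i j p
  rw [m3 i j p, m3 p j i, m3 i p j, m3 j p i] at key
  simp only [← Algebra.smul_def, Matrix.add_apply, Matrix.smul_apply, smul_eq_mul]
  rw [m1 (t * x) (t * y) i j k l, m1 (t * x) (t * y) j i k l, m2 (t * x) (t * y) i j k l,
    m2 (t * x) (t * y) i j l k]
  rw [key]
  ring

end Fusion

end TrigGaudin

namespace TrigGaudin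

/-! ### Tensoring with the dual evaluation representation -/

section Comultiplication

open Polynomial

theorem commute_map_algebraMap_polynomial {A : Type} [Ring A] [Algebra ℂ A] (p : ℂ[X]) (b : A[X]) :
    Commute (p.map (algebraMap ℂ A)) b := by
  ext m
  rw [Polynomial.coeff_mul, Polynomial.coeff_mul, ← Finset.Nat.sum_antidiagonal_swap]
  refine Finset.sum_congr rfl fun p _ => ?_
  simp [Algebra.commutes]

/-- The homomorphism `x ↦ x ⊗ 1 + 1 ⊗ ρ_a(x)`, where `ρ_a` is the dual of the vector representation
with `t⁻¹` acting as the indeterminate `a`. -/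
noncomputable def delta (N : ℕ) : UPlus N →ₐ[ℂ] Matrix (Fin N) (Fin N) (UPlus N)[X] :=
  UniversalEnvelopingAlgebra.lift ℂ
    { toFun := fun y => Matrix.diagonal (fun _ => C (UniversalEnvelopingAlgebra.ι ℂ y)) -
        (y.1.transpose).map (Polynomial.map (algebraMap ℂ (UPlus N)))
      map_add' := fun y z => by
        ext1 i j
        by_cases h : i = j
        · simp [h]
          abel
        · simp [h]
          abel
      map_smul' := fun c y => by
        ext i j m
        by_cases h : i = j
        · simp [h, smul_sub]
        · simp [h]
      map_lie' := by
        intro y z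
        set μ := Polynomial.mapRingHom (algebraMap ℂ (UPlus N))
        have hμ : ∀ Y : Matrix (Fin N) (Fin N) ℂ[X],
          Y.map (Polynomial.map (algebraMap ℂ (UPlus N))) = μ.mapMatrix Y := fun _ => rfl
        simp only [hμ]
        have hc : ∀ (b : (UPlus N)[X]) (Y : Matrix (Fin N) (Fin N) ℂ[X]),
            Matrix.diagonal (fun _ => b) * μ.mapMatrix Y = μ.mapMatrix Y * Matrix.diagonal fun _ => b := by
          intro b Y
          ext1 i j
          rw [Matrix.diagonal_mul, Matrix.mul_diagonal]
          exact (commute_map_algebraMap_polynomial (Y i j) b).eq.symm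
        have h1 : ((⁅y, z⁆ : gHatPlus N) : Matrix (Fin N) (Fin N) ℂ[X]).transpose =
            z.1.transpose * y.1.transpose - y.1.transpose * z.1.transpose := by
          rw [← Matrix.transpose_mul, ← Matrix.transpose_mul, ← Matrix.transpose_sub]
          rfl
        have h2 : (Matrix.diagonal fun _ => C (UniversalEnvelopingAlgebra.ι ℂ ⁅y, z⁆) :
            Matrix (Fin N) (Fin N) (UPlus N)[X]) =
            Matrix.diagonal (fun _ => C (UniversalEnvelopingAlgebra.ι ℂ y)) *
              Matrix.diagonal (fun _ => C (UniversalEnvelopingAlgebra.ι ℂ z)) -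
            Matrix.diagonal (fun _ => C (UniversalEnvelopingAlgebra.ι ℂ z)) *
              Matrix.diagonal (fun _ => C (UniversalEnvelopingAlgebra.ι ℂ y)) := by
          rw [Matrix.diagonal_mul_diagonal, Matrix.diagonal_mul_diagonal, Matrix.diagonal_sub,
            LieHom.map_lie, Ring.lie_def]
          simp
        rw [h1, h2, map_sub, map_mul, map_mul, Ring.lie_def]
        simp only [sub_mul, mul_sub, hc]
        abel }

theorem delta_ι {N : ℕ} (y : gHatPlus N) : delta N (UniversalEnvelopingAlgebra.ι ℂ y) =
    Matrix.diagonal (fun _ => C (UniversalEnvelopingAlgebra.ι ℂ y)) -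
      (y.1.transpose).map (Polynomial.map (algebraMap ℂ (UPlus N))) :=
  UniversalEnvelopingAlgebra.lift_ι_apply ..

/-- Evaluation of polynomials at a scalar, combined with a homomorphism on the coefficients. -/
noncomputable def evalAt {A B : Type} [Ring A] [Algebra ℂ A] [Ring B] [Algebra ℂ B]
    (φ : A →ₐ[ℂ] B) (a : ℂ) : A[X] →ₐ[ℂ] B :=
  eval₂AlgHom φ (algebraMap ℂ B a) fun _ => (Algebra.commutes _ _).symm

theorem evalAt_C {A B : Type} [Ring A] [Algebra ℂ A] [Ring B] [Algebra ℂ B]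
    (φ : A →ₐ[ℂ] B) (a : ℂ) (x : A) : evalAt φ a (C x) = φ x :=
  eval₂_C _ _

theorem evalAt_map {A B : Type} [Ring A] [Algebra ℂ A] [Ring B] [Algebra ℂ B]
    (φ : A →ₐ[ℂ] B) (a : ℂ) (p : ℂ[X]) :
    evalAt φ a (p.map (algebraMap ℂ A)) = algebraMap ℂ B (p.eval a) := by
  have h : ((φ : A →+* B).comp (algebraMap ℂ A)) = algebraMap ℂ B := RingHom.ext φ.commutes
  change eval₂ (φ : A →+* B) (algebraMap ℂ B a) (p.map (algebraMap ℂ A)) = _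
  rw [eval₂_map, h]
  exact aeval_algebraMap_apply B a p

variable {N : ℕ} {n : Type} [Fintype n] [DecidableEq n]

/-- The representation obtained from `φ` by tensoring with `ρ_a`. -/
noncomputable def fuse (φ : UPlus N →ₐ[ℂ] Matrix n n ℂ) (a : ℂ) :
    UPlus N →ₐ[ℂ] Matrix (Fin N × n) (Fin N × n) ℂ :=
  (Matrix.compAlgEquiv (Fin N) n ℂ ℂ).toAlgHom.comp ((evalAt φ a).mapMatrix.comp (delta N))

theorem fuse_apply (φ : UPlus N →ₐ[ℂ] Matrix n n ℂ) (a : ℂ) (x : UPlus N) (p s : Fin N × n) :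
    fuse φ a x p s = evalAt φ a (delta N x p.1 s.1) p.2 s.2 := rfl

theorem fuse_ι (φ : UPlus N →ₐ[ℂ] Matrix n n ℂ) (a : ℂ) (y : gHatPlus N) (p s : Fin N × n) :
    fuse φ a (UniversalEnvelopingAlgebra.ι ℂ y) p s =
      (if p.1 = s.1 then φ (UniversalEnvelopingAlgebra.ι ℂ y) p.2 s.2 else 0) -
        (if p.2 = s.2 then (y.1 s.1 p.1).eval a else 0) := by
  rw [fuse_apply, delta_ι, Matrix.sub_apply, Matrix.diagonal_apply, Matrix.map_apply, map_sub,
    Matrix.sub_apply, evalAt_map, Matrix.algebraMap_matrix_apply, Matrix.transpose_apply]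
  congr 1
  split_ifs
  · rw [evalAt_C]
  · rw [map_zero, Matrix.zero_apply]

end Comultiplication

/-! ### Kronecker factors -/

section Kronecker

variable {ι n S S' R : Type} [Fintype ι] [DecidableEq ι] [Fintype n] [DecidableEq n]
  [CommRing S] [CommRing S'] [CommRing R] [Algebra R S'] [Algebra R S]

/-- The action on the second tensor factor. -/
def kronRight (ι n S : Type) [Fintype ι] [DecidableEq ι] [Fintype n] [DecidableEq n]
    [CommRing S] : Matrix n n S →ₐ[S] Matrix (ι × n) (ι × n) S :=
  AlgHom.ofLinearMap
    { toFun := fun M => 1 ⊗ₖ M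
      map_add' := fun M M' => Matrix.kronecker_add _ _ _
      map_smul' := fun c M => Matrix.kronecker_smul _ _ _ }
    Matrix.one_kronecker_one
    (fun M M' => by
      change (1 : Matrix ι ι S) ⊗ₖ (M * M') = (1 ⊗ₖ M) * (1 ⊗ₖ M')
      rw [← Matrix.mul_kronecker_mul, one_mul])

/-- The action on the first tensor factor. -/
def kronLeft (ι n S : Type) [Fintype ι] [DecidableEq ι] [Fintype n] [DecidableEq n]
    [CommRing S] : Matrix ι ι S →ₐ[S] Matrix (ι × n) (ι × n) S :=
  AlgHom.ofLinearMap
    { toFun := fun M => M ⊗ₖ 1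
      map_add' := fun M M' => Matrix.add_kronecker _ _ _
      map_smul' := fun c M => Matrix.smul_kronecker _ _ _ }
    Matrix.one_kronecker_one
    (fun M M' => by
      change (M * M') ⊗ₖ (1 : Matrix n n S) = (M ⊗ₖ 1) * (M' ⊗ₖ 1)
      rw [← Matrix.mul_kronecker_mul, one_mul])

theorem kronRight_apply (M : Matrix n n S) (p s : ι × n) :
    kronRight ι n S M p s = if p.1 = s.1 then M p.2 s.2 else 0 := by
  change (1 : Matrix ι ι S) p.1 s.1 * M p.2 s.2 = _
  rw [Matrix.one_apply, ite_mul, one_mul, zero_mul]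

theorem kronLeft_apply (M : Matrix ι ι S) (p s : ι × n) :
    kronLeft ι n S M p s = if p.2 = s.2 then M p.1 s.1 else 0 := by
  change M p.1 s.1 * (1 : Matrix n n S) p.2 s.2 = _
  rw [Matrix.one_apply, mul_ite, mul_one, mul_zero]

theorem commute_kronLeft_kronRight (M : Matrix ι ι S) (M' : Matrix n n S) :
    Commute (kronLeft ι n S M) (kronRight ι n S M') := by
  change (M ⊗ₖ 1) * (1 ⊗ₖ M') = (1 ⊗ₖ M') * (M ⊗ₖ 1)
  rw [← Matrix.mul_kronecker_mul, ← Matrix.mul_kronecker_mul, one_mul, one_mul, mul_one, mul_one]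

theorem mapMatrix_kronRight (f : S →ₐ[R] S') (M : Matrix n n S) :
    f.mapMatrix (kronRight ι n S M) = kronRight ι n S' (f.mapMatrix M) := by
  ext p s
  simp only [AlgHom.mapMatrix_apply, Matrix.map_apply, kronRight_apply]
  split_ifs <;> simp

theorem mapMatrix_kronLeft (f : S →ₐ[R] S') (M : Matrix ι ι S) :
    f.mapMatrix (kronLeft ι n S M) = kronLeft ι n S' (f.mapMatrix M) := by
  ext p s
  simp only [AlgHom.mapMatrix_apply, Matrix.map_apply, kronLeft_apply]
  split_ifs <;> simp

theorem map_kron_mul {N : ℕ} (f : S →ₐ[R] S') (M : Matrix (Fin N) (Fin N) (Matrix n n S))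
    (M' : Matrix (Fin N) (Fin N) (Matrix ι ι S)) :
    (M.map (kronRight ι n S) * M'.map (kronLeft ι n S)).map f.mapMatrix =
      (M.map f.mapMatrix).map (kronRight ι n S') * (M'.map f.mapMatrix).map (kronLeft ι n S') := by
  rw [Matrix.map_mul]
  congr 1
  · ext1 i j
    simp only [Matrix.map_apply, mapMatrix_kronRight]
  · ext1 i j
    simp only [Matrix.map_apply, mapMatrix_kronLeft]

end Kronecker

/-! ### Quantized representations -/

section Quantized

open PowerSeries

variable {N : ℕ} {n : Type} [Fintype n] [DecidableEq n]

/-- The coefficient of `h` in the normalized fundamental solution `R(bu, 1)/(1 - bu)`. -/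
noncomputable def ellGen (N : ℕ) (b : FormalRing) :
    Matrix (Fin N) (Fin N) (Matrix (Fin N) (Fin N) FormalRing⟦X⟧) :=
  Matrix.of fun i k => Matrix.of fun p s =>
    (if i = k ∧ p = s then (if i = p then (C qih + C b * X) * mk (fun m => b ^ m) else 0) else 0) +
    (if p = k ∧ s = i then (if i = p then 0 else
      if i < p then C (1 + qih) * mk (fun m => b ^ m)
      else C (1 + qih) * (C b * X * mk fun m => b ^ m)) else 0)

/-- From `q * qi = 1` one gets `1 - h qi = qi` and `q - qi = h (1 + qi)`, so after normalization
every entry differs from the identity by an exact multiple of `h`. -/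
theorem ell_eq_smul (b : FormalRing) : ell N (C qh) (C qih) (C b * X) =
    (1 - C b * X : FormalRing⟦X⟧) • (1 - hh • ellGen N b) := by
  ext1 i k
  ext1 p s
  have hg := one_sub_mul_geom b
  set g := mk fun m => b ^ m
  have hhC : ∀ f : FormalRing⟦X⟧, hh • f = C hh * f := fun f => by
    rw [← smul_eq_C_mul]
  have hone : (1 : Matrix (Fin N) (Fin N) (Matrix (Fin N) (Fin N) FormalRing⟦X⟧)) i k p s =
      if i = k ∧ p = s then 1 else 0 := by
    rw [Matrix.one_apply]
    by_cases h : i = k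
    · simp [h, Matrix.one_apply]
    · simp [h]
  have hq : (C qh : FormalRing⟦X⟧) = 1 + C hh := by simp [qh]
  have hqq : (C qh : FormalRing⟦X⟧) * C qih = 1 := by rw [← map_mul, qh_mul_qih, map_one]
  rw [hq] at hqq
  rw [ell_apply, Matrix.smul_apply, Matrix.smul_apply, Matrix.sub_apply, Matrix.sub_apply,
    Matrix.smul_apply, Matrix.smul_apply, hone, hhC, smul_eq_mul, ellGen, Matrix.of_apply,
    Matrix.of_apply, mul_add, ← sub_sub, mul_sub, sub_eq_add_neg]
  congr 1
  · by_cases h : i = k ∧ p = s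
    · rw [if_pos h, if_pos h, if_pos h, rA]
      by_cases hip : i = p
      · rw [if_pos hip, if_pos hip, hq]
        linear_combination hqq + (C hh * (C qih + C b * X)) * hg
      · rw [if_neg hip, if_neg hip]
        ring
    · rw [if_neg h, if_neg h, if_neg h]
      ring
  · by_cases h : p = k ∧ s = i
    · rw [if_pos h, if_pos h, rC]
      rcases lt_cases i p with ⟨h1, h2, h3, h4⟩ | h1 | ⟨h1, h2, h3, h4⟩
      · rw [if_neg h2, if_pos h1, if_neg h2, if_pos h1, hq, map_add, map_one]
        linear_combination hqq + (C hh * (1 + C qih)) * hg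
      · rw [if_pos h1, if_pos h1]
        ring
      · rw [if_neg h2, if_neg h4, if_neg h2, if_neg h4, hq, map_add, map_one]
        linear_combination (C b * X) * hqq + (C b * X * C hh * (1 + C qih)) * hg
    · rw [if_neg h, if_neg h]
      ring

/-- At `h = 0` the entries are `(1 + au)/(1 - au)`, `2/(1 - au)` and `2au/(1 - au)` for `i = k`, `i
< k` and `i > k`. Their constant terms `1, 2, 0` and higher coefficients `2a^m` are exactly the
negatives of the scalars defining `𝓛⁺`; the sign and the transposition come from the dual. -/
theorem red_ellGen (a : ℂ) (i k : Fin N) (m : ℕ) :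
    red (ellGen N (algebraMap ℂ FormalRing a) i k) m =
      Matrix.of fun p s => -((lMode i k m).1 s p).eval a := by
  have hb : spec (algebraMap ℂ FormalRing a) = a := spec.commutes a
  set b := algebraMap ℂ FormalRing a
  have hX : ∀ m, coeff m (C b * X * mk fun m => b ^ m) = if m = 0 then 0 else b ^ m := by
    intro m
    rw [mul_assoc, coeff_C_mul]
    rcases m with _ | m
    · simp
    · rw [coeff_succ_X_mul, coeff_mk, if_neg (Nat.succ_ne_zero m), pow_succ']
  ext p s
  have hL : ((lMode i k m).1 s p).eval a = lScalar i k m * if i = s ∧ k = p then a ^ m else 0 := by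
    change Polynomial.eval a ((lScalar i k m • Matrix.single i k (Polynomial.X ^ m)) s p) = _
    rw [Matrix.smul_apply, Polynomial.eval_smul, Matrix.single_apply, smul_eq_mul]
    congr 1
    split_ifs <;> simp
  rw [red, Matrix.map_apply, Matrix.of_apply, hL, ellGen, Matrix.of_apply, Matrix.of_apply]
  by_cases h : i = s ∧ k = p
  · obtain ⟨rfl, rfl⟩ := h
    rw [if_pos (⟨rfl, rfl⟩ : i = i ∧ k = k), if_pos (⟨rfl, rfl⟩ : k = k ∧ i = i), lScalar]
    rcases lt_cases i k with ⟨h1, h2, h3, h4⟩ | h1 | ⟨h1, h2, h3, h4⟩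
    · have hs : Int.sign ((k : ℤ) - (i : ℤ)) = 1 :=
        Int.sign_eq_one_of_pos (by have : (i : ℕ) < k := h1; omega)
      rw [if_neg fun h => h2 h.1, if_neg h2, if_pos h1, zero_add, coeff_C_mul, coeff_mk, map_mul,
        map_pow, hb, map_add, spec_qih, map_one, hs]
      split_ifs <;> push_cast <;> ring
    · subst h1
      rw [if_pos ⟨rfl, rfl⟩, if_pos rfl, if_pos rfl, add_zero, add_mul, map_add, coeff_C_mul, hX,
        coeff_mk, map_add, map_mul, map_pow, hb, spec_qih, sub_self, Int.sign_zero]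
      split_ifs with hm
      · simp [hm]
      · rw [map_pow, hb]; ring
    · have hs : Int.sign ((k : ℤ) - (i : ℤ)) = -1 :=
        Int.sign_eq_neg_one_of_neg (by have : (k : ℕ) < i := h1; omega)
      rw [if_neg fun h => h2 h.1, if_neg h2, if_neg h4, zero_add, coeff_C_mul, hX, map_mul,
        map_add, spec_qih, map_one, hs]
      split_ifs with hm
      · simp
      · rw [map_pow, hb]; ring
  · have h' : ¬ (p = k ∧ s = i) := fun h' => h ⟨h'.2.symm, h'.1.symm⟩
    rw [if_neg h, if_neg h']
    split_ifs with h1 h2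
    · exact absurd ⟨h2.trans h1.2, h1.1.symm.trans h2⟩ h
    · simp
    · simp

theorem map_aeval_ell {S : Type} [CommRing S] [Algebra FormalRing S] (x : S) (b : FormalRing) :
    (ell N (Polynomial.C qh) (Polynomial.C qih) (Polynomial.C b * Polynomial.X)).map
      (Polynomial.aeval x).mapMatrix = ell N (algebraMap FormalRing S qh)
        (algebraMap FormalRing S qih) (algebraMap FormalRing S b * x) := by
  refine (map_ell (Polynomial.aeval x : Polynomial FormalRing →ₐ[FormalRing] S).toRingHom _ _ _).trans ?_
  simp

theorem red_kronRight {ι : Type} [Fintype ι] [DecidableEq ι] (g : Matrix n n FormalRing⟦X⟧) (m : ℕ) :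
    red (kronRight ι n _ g) m = kronRight ι n _ (red g m) := by
  ext p s
  simp only [red, Matrix.map_apply, kronRight_apply]
  split_ifs <;> simp

theorem red_kronLeft {ι : Type} [Fintype ι] [DecidableEq ι] (g : Matrix ι ι FormalRing⟦X⟧) (m : ℕ) :
    red (kronLeft ι n _ g) m = kronLeft ι n _ (red g m) := by
  ext p s
  simp only [red, Matrix.map_apply, kronLeft_apply]
  split_ifs <;> simp

/-- The tensor product of a quantized representation with `ρ_a` is quantized. -/
noncomputable def Quantization.fuse {φ : UPlus N →ₐ[ℂ] Matrix n n ℂ} (Q : Quantization φ) (a : ℂ) :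
    Quantization (fuse φ a) where
  lax := Q.lax.map (kronRight (Fin N) n _) *
    (ell N (Polynomial.C qh) (Polynomial.C qih)
      (Polynomial.C (algebraMap ℂ FormalRing a) * Polynomial.X)).map (kronLeft (Fin N) n _)
  den := Q.den * (1 - Polynomial.C (algebraMap ℂ FormalRing a) * Polynomial.X)
  -- This is the `P''` with `(1 - hP)(1 - hP') = 1 - hP''`. At `h = 0` only the sum `P + P'`
  -- remains, which is the action on a tensor product.
  gen := Q.gen.map (kronRight (Fin N) n _) +
    (ellGen N (algebraMap ℂ FormalRing a)).map (kronLeft (Fin N) n _) -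
    hh • (Q.gen.map (kronRight (Fin N) n _) *
      (ellGen N (algebraMap ℂ FormalRing a)).map (kronLeft (Fin N) n _))
  den_ne_zero := by
    rw [map_mul]
    refine mul_ne_zero Q.den_ne_zero fun h => ?_
    have := congrArg (coeff 0) h
    simp at this
  lax_eq i j := by
    have h1 : Q.lax.map (Polynomial.aeval (X : FormalRing⟦X⟧)).mapMatrix =
        Polynomial.aeval (X : FormalRing⟦X⟧) Q.den • (1 - hh • Q.gen) := by
      ext1 i j
      exact (Q.lax_eq i j).symm
    have h2 := map_kron_mul (Polynomial.aeval (R := FormalRing) (X : FormalRing⟦X⟧)) Q.lax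
      (ell N (Polynomial.C qh) (Polynomial.C qih)
      (Polynomial.C (algebraMap ℂ FormalRing a) * Polynomial.X))
    rw [h1, map_aeval_ell] at h2
    have h3 : ell N (algebraMap FormalRing FormalRing⟦X⟧ qh) (algebraMap FormalRing FormalRing⟦X⟧ qih)
        (algebraMap FormalRing FormalRing⟦X⟧ (algebraMap ℂ FormalRing a) * X) =
        (1 - C (algebraMap ℂ FormalRing a) * X : FormalRing⟦X⟧) •
          (1 - hh • ellGen N (algebraMap ℂ FormalRing a)) :=
      ell_eq_smul (N := N) (algebraMap ℂ FormalRing a)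
    rw [h3] at h2
    have h4 := congrFun (congrFun h2 i) j
    rw [Matrix.map_apply] at h4
    rw [h4, map_mul]
    set d := Polynomial.aeval (X : FormalRing⟦X⟧) Q.den
    have hd : Polynomial.aeval (X : FormalRing⟦X⟧)
        (1 - Polynomial.C (algebraMap ℂ FormalRing a) * Polynomial.X) =
        1 - C (algebraMap ℂ FormalRing a) * X := by
      simp
    rw [hd]
    set e := ellGen N (algebraMap ℂ FormalRing a)
    have g1 : ∀ (c : FormalRing⟦X⟧) (M : Matrix (Fin N) (Fin N) (Matrix n n FormalRing⟦X⟧)),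
        (c • (1 - hh • M)).map (kronRight (Fin N) n FormalRing⟦X⟧) =
        c • (1 - hh • M.map (kronRight (Fin N) n FormalRing⟦X⟧)) := by
      intro c M
      ext1 i j
      simp only [Matrix.map_apply, Matrix.smul_apply, Matrix.sub_apply, map_smul, map_sub]
      rw [← AlgHom.toLinearMap_apply _ (hh • M i j), LinearMap.map_smul_of_tower, Matrix.one_apply,
        Matrix.one_apply]
      split_ifs <;> simp
    have g2 : ∀ (c : FormalRing⟦X⟧) (M : Matrix (Fin N) (Fin N) (Matrix (Fin N) (Fin N) FormalRing⟦X⟧)),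
        (c • (1 - hh • M)).map (kronLeft (Fin N) n FormalRing⟦X⟧) =
        c • (1 - hh • M.map (kronLeft (Fin N) n FormalRing⟦X⟧)) := by
      intro c M
      ext1 i j
      simp only [Matrix.map_apply, Matrix.smul_apply, Matrix.sub_apply, map_smul, map_sub]
      rw [← AlgHom.toLinearMap_apply _ (hh • M i j), LinearMap.map_smul_of_tower, Matrix.one_apply,
        Matrix.one_apply]
      split_ifs <;> simp
    have g3 : ∀ P P' : Matrix (Fin N) (Fin N) (Matrix (Fin N × n) (Fin N × n) FormalRing⟦X⟧),
        (1 - hh • P) * (1 - hh • P') = 1 - hh • (P + P' - hh • (P * P')) := by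
      intro P P'
      simp only [sub_mul, mul_sub, one_mul, mul_one, smul_mul_assoc, mul_smul_comm, smul_sub, smul_add]
      abel
    rw [g1, g2, smul_mul_smul_comm, g3]
    rfl
  red_gen i j m := by
    rw [Matrix.sub_apply, Matrix.add_apply, Matrix.smul_apply, red_sub, red_add, red_smul, spec_hh,
      zero_smul, sub_zero, Matrix.map_apply, Matrix.map_apply, red_kronRight, red_kronLeft,
      red_ellGen, Q.red_gen]
    ext p s
    rw [Matrix.add_apply, kronRight_apply, kronLeft_apply, fuse_ι, sub_eq_add_neg, Matrix.of_apply]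
    congr 1
    split_ifs <;> simp
  exchange S _ _ x y := by
    rw [map_kron_mul, map_kron_mul, map_aeval_ell, map_aeval_ell]
    refine RExchange.mul ((Q.exchange S x y).map _) ((rexchange_ell ?_ _ x y).map _) ?_ ?_
    · rw [← map_mul, qh_mul_qih, map_one]
    · exact fun _ _ _ _ => commute_kronLeft_kronRight _ _
    · exact fun _ _ _ _ => commute_kronLeft_kronRight _ _

/-- The trivial representation. -/
noncomputable def trivialRep (N : ℕ) : UPlus N →ₐ[ℂ] Matrix Unit Unit ℂ :=
  UniversalEnvelopingAlgebra.lift ℂ 0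

/-- The trivial representation is quantized. -/
noncomputable def trivialQuantization (N : ℕ) : Quantization (trivialRep N) where
  lax := 1
  den := 1
  gen := 0
  den_ne_zero := by simp
  lax_eq i j := by
    rw [map_one, one_smul, Matrix.zero_apply, smul_zero, sub_zero, Matrix.one_apply, Matrix.one_apply]
    split_ifs <;> simp
  red_gen i j m := by
    rw [trivialRep, UniversalEnvelopingAlgebra.lift_ι_apply]
    ext
    simp [red]
  exchange S _ _ x y := by
    rw [Matrix.map_one _ (map_zero _) (map_one _), Matrix.map_one _ (map_zero _) (map_one _)]
    exact rexchange_one _ _ _ _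

end Quantized

end TrigGaudin

namespace TrigGaudin

/-! ### Separation of points by quantized representations -/

section Faithful

open Polynomial

variable {N : ℕ}

/-- The canonical map to the universal enveloping algebra. -/
noncomputable abbrev inc (y : gHatPlus N) : UPlus N := UniversalEnvelopingAlgebra.ι ℂ y

/-- The filtration of the universal enveloping algebra; `filt N d` consists of the elements of order
less than `d`. -/
noncomputable def filt (N : ℕ) : ℕ → Submodule ℂ (UPlus N)
  | 0 => ⊥
  | d + 1 => Submodule.span ℂ ({1} ∪ {x | ∃ y : gHatPlus N, ∃ w ∈ filt N d, x = inc y * w})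

theorem one_mem_filt (d : ℕ) : 1 ∈ filt N (d + 1) :=
  Submodule.subset_span (Or.inl rfl)

theorem inc_mul_mem_filt {d : ℕ} (y : gHatPlus N) {w : UPlus N} (hw : w ∈ filt N d) :
    inc y * w ∈ filt N (d + 1) :=
  Submodule.subset_span (Or.inr ⟨y, w, hw, rfl⟩)

theorem filt_le_succ (d : ℕ) : filt N d ≤ filt N (d + 1) := by
  induction d with
  | zero => exact bot_le
  | succ d ih =>
    refine Submodule.span_le.2 ?_
    rintro x (rfl | ⟨y, w, hw, rfl⟩)
    · exact one_mem_filt _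
    · exact inc_mul_mem_filt y (ih hw)

theorem filt_mono {d e : ℕ} (h : d ≤ e) : filt N d ≤ filt N e :=
  monotone_nat_of_le_succ filt_le_succ h

theorem exists_mem_filt (x : UPlus N) : ∃ d, x ∈ filt N d := by
  let S : Subalgebra ℂ (UPlus N) := Algebra.adjoin ℂ (Set.range inc)
  have hS : x ∈ S := by
    let f : gHatPlus N →ₗ⁅ℂ⁆ S :=
      { toFun := fun y => ⟨inc y, Algebra.subset_adjoin ⟨y, rfl⟩⟩
        map_add' := fun y z => Subtype.ext (map_add _ y z)
        map_smul' := fun c y => Subtype.ext (map_smul _ c y)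
        map_lie' := fun {y z} => Subtype.ext (LieHom.map_lie _ y z) }
    have h : S.val.comp (UniversalEnvelopingAlgebra.lift ℂ f) = AlgHom.id ℂ _ := by
      refine UniversalEnvelopingAlgebra.hom_ext ℂ (LieHom.ext fun y => ?_)
      change S.val (UniversalEnvelopingAlgebra.lift ℂ f (UniversalEnvelopingAlgebra.ι ℂ y)) = inc y
      rw [UniversalEnvelopingAlgebra.lift_ι_apply]
      rfl
    have hx := congrArg (fun g => g x) h
    simp only [AlgHom.comp_apply, AlgHom.id_apply] at hx
    rw [← hx]
    exact (UniversalEnvelopingAlgebra.lift ℂ f x).2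
  -- The filtration is built by left multiplication, so the claim is strengthened to products `x *
  -- w`, which is stable under multiplication in `x`.
  suffices h : ∀ w, (∃ d, w ∈ filt N d) → ∃ d, x * w ∈ filt N d by
    simpa using h 1 ⟨1, one_mem_filt 0⟩
  induction hS using Algebra.adjoin_induction with
  | mem x hx =>
    obtain ⟨y, rfl⟩ := hx
    rintro w ⟨d, hw⟩
    exact ⟨d + 1, inc_mul_mem_filt y hw⟩
  | algebraMap c =>
    rintro w ⟨d, hw⟩
    exact ⟨d, by rw [← Algebra.smul_def]; exact Submodule.smul_mem _ _ hw⟩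
  | add x y _ _ hx hy =>
    intro w hw
    obtain ⟨d, hd⟩ := hx w hw
    obtain ⟨e, he⟩ := hy w hw
    refine ⟨max d e, ?_⟩
    rw [add_mul]
    exact Submodule.add_mem _ (filt_mono (le_max_left _ _) hd) (filt_mono (le_max_right _ _) he)
  | mul x y _ _ hx hy =>
    intro w hw
    rw [mul_assoc]
    exact hx _ (hy w hw)

/-- The element `E_{ij} t⁻ⁿ`, or zero if it is not in `ĝ⁺`. -/
noncomputable def unitMode (i j : Fin N) (m : ℕ) : gHatPlus N := (lScalar i j m)⁻¹ • lMode i j m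

theorem sum_coeff_unitMode (y : gHatPlus N) (D : ℕ) (hD : ∀ i j, (y.1 i j).natDegree < D) :
    ∑ i, ∑ j, ∑ m ∈ Finset.range D, (y.1 i j).coeff m • unitMode i j m = y := by
  refine Subtype.ext ?_
  have h0 : ∀ i j m, (((y.1 i j).coeff m • unitMode i j m : gHatPlus N) :
      Matrix (Fin N) (Fin N) ℂ[X]) = Matrix.single i j (monomial m ((y.1 i j).coeff m)) := by
    intro i j m
    change (y.1 i j).coeff m • (lScalar i j m)⁻¹ • lScalar i j m • Matrix.single i j (X ^ m) = _
    -- The scalar vanishes only for `j < i` and `m = 0`, where membership in `ĝ⁺` forces the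
    -- coefficient to vanish too.
    by_cases hs : lScalar i j m = 0
    · have : (y.1 i j).coeff m = 0 := by
        rw [lScalar] at hs
        split_ifs at hs with hm
        · rcases lt_cases i j with ⟨h1, -⟩ | h1 | ⟨h1, -⟩
          · rw [Int.sign_eq_one_of_pos (by have : (i : ℕ) < j := h1; omega)] at hs
            norm_num at hs
          · simp [h1] at hs
          · rw [hm]
            exact y.2 i j h1
        · norm_num at hs
      rw [this, zero_smul, map_zero, Matrix.single_zero]
    · rw [inv_smul_smul₀ hs, Matrix.smul_single, ← C_mul_X_pow_eq_monomial, smul_eq_C_mul]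
  simp only [AddSubmonoidClass.coe_finsetSum, h0]
  have h1 : ∀ i j, ∑ m ∈ Finset.range D, Matrix.single i j (monomial m ((y.1 i j).coeff m)) =
      Matrix.single i j (y.1 i j) := by
    intro i j
    conv_rhs => rw [as_sum_range' (y.1 i j) D (hD i j)]
    exact (map_sum (Matrix.singleAddMonoidHom (α := ℂ[X]) i j) _ _).symm
  simp only [h1]
  exact (Matrix.matrix_eq_sum_single y.1).symm

/-- The contraction of a matrix of polynomials with the modes `E_{ij} t⁻ⁿ`. -/
noncomputable def contract (M : Matrix (Fin N) (Fin N) (UPlus N)[X]) : UPlus N :=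
  ∑ i, ∑ j, (M j i).sum fun m u => inc (unitMode i j m) * u

theorem contract_eq_sum_range (M : Matrix (Fin N) (Fin N) (UPlus N)[X]) (D : ℕ)
    (hD : ∀ i j, (M i j).natDegree < D) :
    contract M = ∑ i, ∑ j, ∑ m ∈ Finset.range D, inc (unitMode i j m) * (M j i).coeff m := by
  refine Finset.sum_congr rfl fun i _ => Finset.sum_congr rfl fun j _ => ?_
  exact sum_over_range' _ (fun _ => mul_zero _) D (hD j i)

theorem exists_natDegree_lt {R : Type} [Semiring R] (M : Matrix (Fin N) (Fin N) R[X]) :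
    ∃ D, ∀ i j, (M i j).natDegree < D :=
  ⟨(∑ i, ∑ j, (M i j).natDegree) + 1, fun i j => Nat.lt_succ_of_le <|
    (Finset.single_le_sum (f := fun j => (M i j).natDegree) (fun _ _ => Nat.zero_le _)
      (Finset.mem_univ j)).trans
    (Finset.single_le_sum (f := fun i => ∑ j, (M i j).natDegree) (fun _ _ => Nat.zero_le _)
      (Finset.mem_univ i))⟩

theorem contract_add (M M' : Matrix (Fin N) (Fin N) (UPlus N)[X]) :
    contract (M + M') = contract M + contract M' := by
  simp only [contract, ← Finset.sum_add_distrib]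
  refine Finset.sum_congr rfl fun i _ => Finset.sum_congr rfl fun j _ => ?_
  exact sum_add_index _ _ _ (fun _ => mul_zero _) fun _ _ _ => mul_add _ _ _

theorem contract_smul (c : ℂ) (M : Matrix (Fin N) (Fin N) (UPlus N)[X]) :
    contract (c • M) = c • contract M := by
  obtain ⟨D, hD⟩ := exists_natDegree_lt M
  rw [contract_eq_sum_range M D hD, contract_eq_sum_range (c • M) D fun i j =>
    (natDegree_smul_le c (M i j)).trans_lt (hD i j)]
  simp only [Finset.smul_sum]
  refine Finset.sum_congr rfl fun i _ => Finset.sum_congr rfl fun j _ =>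
    Finset.sum_congr rfl fun m _ => ?_
  rw [Matrix.smul_apply, coeff_smul, mul_smul_comm]

theorem contract_mem {d : ℕ} {M : Matrix (Fin N) (Fin N) (UPlus N)[X]}
    (hM : ∀ i j m, (M i j).coeff m ∈ filt N d) : contract M ∈ filt N (d + 1) :=
  Submodule.sum_mem _ fun i _ => Submodule.sum_mem _ fun j _ => Submodule.sum_mem _ fun m _ =>
    inc_mul_mem_filt _ (hM j i m)

/-- Moving `inc y` past a mode produces the bracket of two elements of `ĝ⁺`, a single factor, so the
error is one order lower than the product. -/
theorem contract_inc_mul {d : ℕ} (y : gHatPlus N) {M : Matrix (Fin N) (Fin N) (UPlus N)[X]}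
    (hM : ∀ i j m, (M i j).coeff m ∈ filt N d) :
    contract ((Matrix.diagonal fun _ => C (inc y)) * M) - inc y * contract M ∈ filt N (d + 1) := by
  obtain ⟨D, hD⟩ := exists_natDegree_lt M
  rw [contract_eq_sum_range M D hD, contract_eq_sum_range _ D fun i j => by
    rw [Matrix.diagonal_mul]; exact (natDegree_C_mul_le _ _).trans_lt (hD i j)]
  simp only [Finset.mul_sum, ← Finset.sum_sub_distrib]
  refine Submodule.sum_mem _ fun i _ => Submodule.sum_mem _ fun j _ => Submodule.sum_mem _ fun m _ => ?_
  rw [Matrix.diagonal_mul, coeff_C_mul, ← mul_assoc, ← mul_assoc, ← sub_mul]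
  have : inc (unitMode i j m) * inc y - inc y * inc (unitMode i j m) = inc ⁅unitMode i j m, y⁆ := by
    rw [inc, inc, inc, LieHom.map_lie, Ring.lie_def]
  rw [this]
  exact inc_mul_mem_filt _ (hM j i m)

theorem contract_transpose (y : gHatPlus N) (w : UPlus N) :
    contract ((y.1.transpose).map (Polynomial.map (algebraMap ℂ (UPlus N))) *
      Matrix.diagonal fun _ => C w) = inc y * w := by
  obtain ⟨D, hD⟩ := exists_natDegree_lt y.1
  rw [contract_eq_sum_range _ D fun i j => by
    rw [Matrix.mul_diagonal]
    exact (natDegree_mul_C_le _ _).trans_lt (natDegree_map_le.trans_lt (hD j i))]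
  conv_rhs => rw [← sum_coeff_unitMode y D hD]
  simp only [inc, map_sum, Finset.sum_mul]
  refine Finset.sum_congr rfl fun i _ => Finset.sum_congr rfl fun j _ =>
    Finset.sum_congr rfl fun m _ => ?_
  rw [Matrix.mul_diagonal, coeff_mul_C, Matrix.map_apply, coeff_map, Matrix.transpose_apply,
    ← Algebra.smul_def, mul_smul_comm, map_smul, smul_mul_assoc]

/-- The nontrivial part of the comultiplication. -/
noncomputable def deltaRed (x : UPlus N) : Matrix (Fin N) (Fin N) (UPlus N)[X] :=
  delta N x - Matrix.diagonal fun _ => C x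

theorem deltaRed_inc_mul (y : gHatPlus N) (w : UPlus N) : deltaRed (inc y * w) =
    (Matrix.diagonal fun _ => C (inc y)) * deltaRed w +
      (-1 : ℂ) • ((y.1.transpose).map (Polynomial.map (algebraMap ℂ (UPlus N))) *
        Matrix.diagonal fun _ => C w) +
      (-1 : ℂ) • ((y.1.transpose).map (Polynomial.map (algebraMap ℂ (UPlus N))) * deltaRed w) := by
  have h : (Matrix.diagonal fun _ => C (inc y * w) : Matrix (Fin N) (Fin N) (UPlus N)[X]) =
      (Matrix.diagonal fun _ => C (inc y)) * Matrix.diagonal fun _ => C w := by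
    rw [Matrix.diagonal_mul_diagonal]
    simp
  rw [deltaRed, deltaRed, h, map_mul, delta_ι]
  simp only [neg_smul, one_smul, mul_sub, sub_mul]
  abel

theorem deltaRed_one : deltaRed (1 : UPlus N) = 0 := by
  rw [deltaRed, map_one, map_one, Matrix.diagonal_one, sub_self]

theorem coeff_smul_mem {d m : ℕ} (c : ℂ) {p : (UPlus N)[X]} (h : p.coeff m ∈ filt N d) :
    (c • p).coeff m ∈ filt N d := by
  rw [coeff_smul]
  exact Submodule.smul_mem _ _ h

theorem coeff_transpose_mul_mem {d : ℕ} (Y : Matrix (Fin N) (Fin N) ℂ[X])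
    {M : Matrix (Fin N) (Fin N) (UPlus N)[X]} (hM : ∀ i j m, (M i j).coeff m ∈ filt N d)
    (i j : Fin N) (m : ℕ) :
    ((Y.map (Polynomial.map (algebraMap ℂ (UPlus N))) * M) i j).coeff m ∈ filt N d := by
  rw [Matrix.mul_apply, finsetSum_coeff]
  refine Submodule.sum_mem _ fun k _ => ?_
  rw [Polynomial.coeff_mul]
  refine Submodule.sum_mem _ fun p _ => ?_
  rw [Matrix.map_apply, coeff_map, ← Algebra.smul_def]
  exact Submodule.smul_mem _ _ (hM _ _ _)

/-- The elements on which the comultiplication has the expected leading term. -/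
noncomputable def goodSub (N d : ℕ) : Submodule ℂ (UPlus N) where
  carrier := {x | (∀ i j m, (deltaRed x i j).coeff m ∈ filt N d) ∧
    contract (deltaRed x) + (d : ℂ) • x ∈ filt N d}
  zero_mem' := by
    have h : deltaRed (0 : UPlus N) = 0 := by
      simp [deltaRed]
    constructor
    · intro i j m
      rw [h]
      simp
    · rw [h]
      simp [contract]
  add_mem' := by
    rintro x x' ⟨h1, h2⟩ ⟨h1', h2'⟩
    have h : deltaRed (x + x') = deltaRed x + deltaRed x' := by
      have : (Matrix.diagonal fun _ => C (x + x') : Matrix (Fin N) (Fin N) (UPlus N)[X]) =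
          (Matrix.diagonal fun _ => C x) + Matrix.diagonal fun _ => C x' := by
        rw [Matrix.diagonal_add]; simp
      simp only [deltaRed, map_add (delta N), this]
      abel
    constructor
    · intro i j m
      rw [h, Matrix.add_apply, coeff_add]
      exact Submodule.add_mem _ (h1 i j m) (h1' i j m)
    · rw [h, contract_add, smul_add, add_add_add_comm]
      exact Submodule.add_mem _ h2 h2'
  smul_mem' := by
    rintro c x ⟨h1, h2⟩
    have h : deltaRed (c • x) = c • deltaRed x := by
      have : (Matrix.diagonal fun _ => C (c • x) : Matrix (Fin N) (Fin N) (UPlus N)[X]) =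
          c • Matrix.diagonal fun _ => C x := by
        rw [← Matrix.diagonal_smul]
        congr 1
        ext1
        exact (smul_C c x).symm
      simp only [deltaRed, map_smul, this, smul_sub]
    constructor
    · intro i j m
      rw [h]
      exact coeff_smul_mem c (h1 i j m)
    · rw [h, contract_smul, smul_comm _ c, ← smul_add]
      exact Submodule.smul_mem _ _ h2

/-- On a product of `d` generators the reduced coproduct splits off one or more factors. The terms
with one factor split off give the product back `d` times with a minus sign when contracted, up to
reordering; the others have lower order. It plays the role of an Euler operator on symbols, without
a basis of `U(ĝ⁺)`. -/
theorem filt_le_goodSub (d : ℕ) : filt N (d + 1) ≤ goodSub N d := by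
  induction d with
  | zero =>
    refine Submodule.span_le.2 ?_
    rintro x (rfl | ⟨y, w, hw, rfl⟩)
    · constructor
      · intro i j m
        rw [deltaRed_one]
        simp
      · rw [deltaRed_one]
        simp [contract]
    · rw [show w = 0 from hw, mul_zero]
      exact Submodule.zero_mem _
  | succ e ih =>
    refine Submodule.span_le.2 ?_
    rintro x (rfl | ⟨y, w, hw, rfl⟩)
    · constructor
      · intro i j m
        rw [deltaRed_one]
        simp
      · rw [deltaRed_one]
        simpa [contract] using Submodule.smul_mem _ _ (one_mem_filt e)
    · obtain ⟨h1, h2⟩ := ih hw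
      have h3 := deltaRed_inc_mul y w
      constructor
      · intro i j m
        rw [h3, Matrix.add_apply, Matrix.add_apply, coeff_add, coeff_add]
        refine Submodule.add_mem _ (Submodule.add_mem _ ?_ (coeff_smul_mem _ ?_)) (coeff_smul_mem _ ?_)
        · rw [Matrix.diagonal_mul, coeff_C_mul]
          exact inc_mul_mem_filt _ (h1 i j m)
        · refine coeff_transpose_mul_mem _ (fun i j m => ?_) i j m
          rw [Matrix.diagonal_apply]
          split_ifs
          · rw [coeff_C]
            split_ifs
            · exact hw
            · exact Submodule.zero_mem _
          · exact Submodule.zero_mem _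
        · exact coeff_transpose_mul_mem _ (fun i j m => filt_le_succ _ (h1 i j m)) i j m
      · rw [h3, contract_add, contract_add, contract_smul, contract_smul, contract_transpose]
        -- Modulo `filt N (e + 1)` the first term contributes `-e (inc y * w)` by induction, the
        -- middle term gives `-(inc y * w)`, and the last one vanishes.
        have g1 := contract_inc_mul y h1
        have g2 := inc_mul_mem_filt y h2
        have g3 := contract_mem fun i j m => coeff_transpose_mul_mem y.1.transpose h1 i j m
        have := Submodule.add_mem _ (Submodule.add_mem _ g1 g2) (Submodule.smul_mem _ (-1 : ℂ) g3)
        convert this using 1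
        rw [mul_add, mul_smul_comm]
        push_cast
        rw [add_smul, one_smul, neg_smul, neg_smul, one_smul, one_smul]
        abel

/-- A polynomial over a complex vector space that vanishes at all points is zero. -/
theorem eq_zero_of_evalAt_eq_zero {A : Type} [Ring A] [Algebra ℂ A] {p : A[X]}
    (h : ∀ a, evalAt (AlgHom.id ℂ A) a p = 0) : p = 0 := by
  ext m
  rw [coeff_zero, ← Module.forall_dual_apply_eq_zero_iff ℂ]
  intro f
  by_cases hm : m < p.natDegree + 1
  · have hq : ∑ k ∈ Finset.range (p.natDegree + 1), monomial k (f (p.coeff k)) = 0 := by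
      refine Polynomial.funext fun a => ?_
      have h1 : evalAt (AlgHom.id ℂ A) a p =
          ∑ k ∈ Finset.range (p.natDegree + 1), a ^ k • p.coeff k := by
        change eval₂ _ _ p = _
        rw [eval₂_eq_sum_range]
        refine Finset.sum_congr rfl fun k _ => ?_
        rw [← map_pow, ← Algebra.commutes, ← Algebra.smul_def]
        rfl
      have h2 := congrArg f (h1.symm.trans (h a))
      rw [map_sum, map_zero] at h2
      rw [eval_finsetSum, eval_zero, ← h2]
      refine Finset.sum_congr rfl fun k _ => ?_
      rw [eval_monomial, map_smul, smul_eq_mul, mul_comm]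
    have h3 := congrArg (fun q => coeff q m) hq
    simp only [finsetSum_coeff, coeff_monomial, coeff_zero] at h3
    rwa [Finset.sum_ite_eq', if_pos (Finset.mem_range.2 hm)] at h3
  · rw [coeff_eq_zero_of_natDegree_lt (by omega), map_zero]

theorem map_evalAt_id {A B : Type} [Ring A] [Algebra ℂ A] [Ring B] [Algebra ℂ B] (φ : A →ₐ[ℂ] B)
    (a : ℂ) (p : A[X]) : φ (evalAt (AlgHom.id ℂ A) a p) = evalAt φ a p := by
  change (φ : A →+* B) (eval₂ _ _ p) = eval₂ _ _ p
  rw [hom_eval₂]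
  congr 1
  exact φ.commutes a

/-- The quantized representations separate the elements of `U(ĝ⁺)`. -/
theorem eq_zero_of_quantized {x : UPlus N}
    (hx : ∀ (n : Type) [Fintype n] [DecidableEq n] (φ : UPlus N →ₐ[ℂ] Matrix n n ℂ),
      Quantization φ → φ x = 0) : x = 0 := by
  obtain ⟨d, hd⟩ := exists_mem_filt x
  induction d generalizing x with
  | zero => exact hd
  | succ d ih =>
    obtain ⟨h1, h2⟩ := filt_le_goodSub d hd
    -- The values of `deltaRed x` have lower order. They are killed by every quantized `φ`, because
    -- tensoring `φ` with a dual evaluation representation is again quantized; so the induction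
    -- hypothesis applies.
    have h3 : deltaRed x = 0 := by
      ext1 i j
      refine eq_zero_of_evalAt_eq_zero fun a => ih ?_ ?_
      · intro n _ _ φ Q
        have g1 := hx _ _ (Q.fuse a)
        have g2 : evalAt φ a (delta N x i j) = 0 := by
          ext α β
          have := congrFun (congrFun g1 (i, α)) (j, β)
          rwa [fuse_apply] at this
        rw [map_evalAt_id, deltaRed, Matrix.sub_apply, map_sub, g2, zero_sub, neg_eq_zero,
          Matrix.diagonal_apply]
        split_ifs
        · rw [evalAt_C]
          exact hx n φ Q
        · exact map_zero _
      · change eval₂ _ _ _ ∈ _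
        rw [eval₂_eq_sum_range]
        refine Submodule.sum_mem _ fun k _ => ?_
        rw [← map_pow, ← Algebra.commutes, ← Algebra.smul_def]
        exact Submodule.smul_mem _ _ (h1 i j k)
    rcases d with _ | d
    -- In order zero `x` is a scalar, which the trivial representation detects.
    · obtain ⟨c, rfl⟩ : ∃ c : ℂ, c • (1 : UPlus N) = x := by
        refine Submodule.mem_span_singleton.1 (Submodule.span_le.2 ?_ hd)
        rintro x (rfl | ⟨y, w, hw, rfl⟩)
        · exact Submodule.mem_span_singleton_self _
        · rw [show w = 0 from hw, mul_zero]
          exact Submodule.zero_mem _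
      have g := hx _ _ (trivialQuantization N)
      rw [map_smul, map_one] at g
      have := congrFun (congrFun g ()) ()
      simp only [Matrix.smul_apply, Matrix.one_apply_eq, smul_eq_mul, mul_one, Matrix.zero_apply] at this
      rw [this, zero_smul]
    -- With `deltaRed x = 0` the leading-term formula leaves a nonzero multiple of `x` in the lower
    -- step of the filtration, so `x` lies there.
    · refine ih hx ?_
      rw [h3] at h2
      have g : contract (0 : Matrix (Fin N) (Fin N) (UPlus N)[X]) = 0 := by simp [contract]
      rw [g, zero_add] at h2
      have := Submodule.smul_mem _ ((d + 1 : ℕ) : ℂ)⁻¹ h2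
      rwa [inv_smul_smul₀ (by exact_mod_cast Nat.succ_ne_zero d)] at this

end Faithful

end TrigGaudin

namespace TrigGaudin

/-! ### Coefficients of differential operators and the conclusion -/

section DifferentialOperators

open PowerSeries

variable {A : Type} [Ring A] [Algebra ℂ A]

theorem mulOp_apply (f g : A⟦X⟧) : mulOp A f g = f * g := rfl

theorem coeff_dOp (f : A⟦X⟧) (m : ℕ) : coeff m (dOp A f) = (m + 1) • coeff (m + 1) f :=
  coeff_mk m fun m => (m + 1) • coeff (m + 1) f

theorem dOp_X_pow (r : ℕ) : dOp A (X ^ r) = r • X ^ (r - 1) := by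
  ext m
  rw [coeff_dOp, map_nsmul, coeff_X_pow, coeff_X_pow]
  rcases r with _ | r
  · simp
  · rw [Nat.add_sub_cancel]
    by_cases h : m = r
    · simp [h]
    · simp [h]

theorem dOp_pow_X_pow (l j : ℕ) : (dOp A ^ l) (X ^ j) = j.descFactorial l • X ^ (j - l) := by
  induction l with
  | zero => simp
  | succ l ih =>
    rw [pow_succ', Module.End.mul_apply, ih, map_nsmul, dOp_X_pow, smul_smul,
      Nat.descFactorial_succ, mul_comm, Nat.sub_sub]

theorem dOp_mul (f g : A⟦X⟧) : dOp A (f * g) = dOp A f * g + f * dOp A g := by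
  ext m
  rw [coeff_dOp, map_add, PowerSeries.coeff_mul, PowerSeries.coeff_mul, PowerSeries.coeff_mul]
  simp only [coeff_dOp, smul_mul_assoc, mul_smul_comm, Finset.smul_sum]
  have h1 := Finset.Nat.sum_antidiagonal_succ (n := m)
    (f := fun p : ℕ × ℕ => p.1 • (coeff p.1 f * coeff p.2 g))
  have h2 := Finset.Nat.sum_antidiagonal_succ' (n := m)
    (f := fun p : ℕ × ℕ => p.2 • (coeff p.1 f * coeff p.2 g))
  simp only [zero_smul, zero_add] at h1 h2
  rw [← h1, ← h2, ← Finset.sum_add_distrib]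
  refine Finset.sum_congr rfl fun p hp => ?_
  rw [← add_smul, Finset.HasAntidiagonal.mem_antidiagonal.1 hp]

theorem diffOp_eq_sum_rev {m : ℕ} (c : Fin (m + 1) → A⟦X⟧) :
    diffOp A c = ∑ l : Fin (m + 1), mulOp A (c l.rev) * dOp A ^ (l : ℕ) := by
  rw [diffOp, ← Equiv.sum_comp Fin.revPerm]
  refine Finset.sum_congr rfl fun l _ => ?_
  rw [Fin.revPerm_apply, Fin.val_rev]
  congr 2
  omega

/-- The coefficients of a differential operator lie in any subspace that contains the coefficients
of its values on the powers of `u`. -/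
theorem coeff_mem_of_diffOp {m : ℕ} {c : Fin (m + 1) → A⟦X⟧} {W : Submodule ℂ A}
    (h : ∀ j a, coeff a (diffOp A c (X ^ j)) ∈ W) (k : Fin (m + 1)) (a : ℕ) :
    coeff a (c k) ∈ W := by
  suffices H : ∀ (l : Fin (m + 1)) a, coeff a (c l.rev) ∈ W by simpa using H k.rev a
  intro l
  induction hl : (l : ℕ) using Nat.strong_induction_on generalizing l with
  | _ j ih =>
    subst hl
    intro a
    -- On `u^l` derivatives of order above `l` vanish, those of lower order involve coefficients
    -- already treated, and the order `l` leaves `l!` times the wanted coefficient.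
    have h1 := h l a
    rw [diffOp_eq_sum_rev, LinearMap.sum_apply, map_sum,
      ← Finset.add_sum_erase _ _ (Finset.mem_univ l)] at h1
    have h2 : ∑ i ∈ Finset.univ.erase l,
        coeff a ((mulOp A (c i.rev) * dOp A ^ (i : ℕ)) (X ^ (l : ℕ))) ∈ W := by
      refine Submodule.sum_mem _ fun i hi => ?_
      rw [Module.End.mul_apply, mulOp_apply, dOp_pow_X_pow, mul_smul_comm, map_nsmul]
      rcases lt_trichotomy (i : ℕ) l with h3 | h3 | h3
      · rw [coeff_mul_X_pow']
        refine Submodule.smul_of_tower_mem _ _ ?_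
        split_ifs
        · exact ih i h3 i rfl _
        · exact Submodule.zero_mem _
      · exact absurd (Fin.ext h3) (Finset.ne_of_mem_erase hi)
      · rw [Nat.descFactorial_of_lt h3, zero_smul]
        exact Submodule.zero_mem _
    have h3 := (Submodule.add_mem_iff_left _ h2).1 h1
    rw [Module.End.mul_apply, mulOp_apply, dOp_pow_X_pow, Nat.sub_self, pow_zero,
      Nat.descFactorial_self, mul_smul_comm, mul_one, map_nsmul, ← Nat.cast_smul_eq_nsmul ℂ] at h3
    exact (Submodule.smul_mem_iff _ (by exact_mod_cast Nat.factorial_ne_zero _)).1 h3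

/-- The zero operator has all its values in the zero subspace, so by `coeff_mem_of_diffOp` its
coefficients lie there as well. -/
theorem diffOp_injective (m : ℕ) :
    Function.Injective (diffOp A : (Fin (m + 1) → A⟦X⟧) → Op A) := by
  intro c c' h
  have h1 : diffOp A (c - c') = 0 := by
    rw [← sub_eq_zero] at h
    rw [← h]
    simp only [diffOp, ← Finset.sum_sub_distrib, ← sub_mul]
    refine Finset.sum_congr rfl fun k _ => ?_
    congr 1
    ext1 f
    simp [mulOp, sub_mul]
  have h2 : ∀ k a, coeff a ((c - c') k) ∈ (⊥ : Submodule ℂ A) := fun k a =>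
    coeff_mem_of_diffOp (fun j a => by rw [h1]; simp) k a
  ext k a
  have := h2 k a
  rwa [Submodule.mem_bot, Pi.sub_apply, map_sub, sub_eq_zero] at this

/-- The differential operators of order at most `m`. -/
noncomputable def opsLE (A : Type) [Ring A] [Algebra ℂ A] (m : ℕ) : Submodule ℂ (Op A) :=
  Submodule.span ℂ {P | ∃ (f : A⟦X⟧) (k : ℕ), k ≤ m ∧ P = mulOp A f * dOp A ^ k}

theorem mulOp_mul_dOp_pow_mem (f : A⟦X⟧) {k m : ℕ} (h : k ≤ m) :
    mulOp A f * dOp A ^ k ∈ opsLE A m :=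
  Submodule.subset_span ⟨f, k, h, rfl⟩

theorem opsLE_mono {m m' : ℕ} (h : m ≤ m') : opsLE A m ≤ opsLE A m' :=
  Submodule.span_mono fun _ ⟨f, k, hk, hP⟩ => ⟨f, k, hk.trans h, hP⟩

theorem exists_diffOp_of_mem {m : ℕ} {P : Op A} (h : P ∈ opsLE A m) :
    ∃ c : Fin (m + 1) → A⟦X⟧, P = diffOp A c := by
  induction h using Submodule.span_induction with
  | mem P hP =>
    obtain ⟨f, k, hk, rfl⟩ := hP
    refine ⟨fun l => if l = Fin.rev ⟨k, by omega⟩ then f else 0, ?_⟩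
    rw [diffOp_eq_sum_rev, Finset.sum_eq_single ⟨k, by omega⟩]
    · simp
    · intro l _ hl
      rw [if_neg fun h => hl (Fin.rev_injective h)]
      simp [mulOp]
    · simp
  | zero => exact ⟨0, by simp [diffOp, mulOp]⟩
  | add P P' _ _ hP hP' =>
    obtain ⟨c, rfl⟩ := hP
    obtain ⟨c', rfl⟩ := hP'
    refine ⟨c + c', ?_⟩
    simp only [diffOp, ← Finset.sum_add_distrib, ← add_mul]
    refine Finset.sum_congr rfl fun k _ => ?_
    congr 1
    ext1 f
    simp [mulOp, add_mul]
  | smul a P _ hP =>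
    obtain ⟨c, rfl⟩ := hP
    refine ⟨a • c, ?_⟩
    simp only [diffOp, Finset.smul_sum, ← smul_mul_assoc]
    refine Finset.sum_congr rfl fun k _ => ?_
    congr 1
    ext1 f
    simp [mulOp]

theorem mulOp_mul_mem (g : A⟦X⟧) {m : ℕ} {P : Op A} (h : P ∈ opsLE A m) :
    mulOp A g * P ∈ opsLE A m := by
  induction h using Submodule.span_induction with
  | mem P hP =>
    obtain ⟨f, k, hk, rfl⟩ := hP
    have : mulOp A g * (mulOp A f * dOp A ^ k) = mulOp A (g * f) * dOp A ^ k := by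
      rw [← mul_assoc]
      congr 1
      ext1 z
      simp [mulOp]
    rw [this]
    exact mulOp_mul_dOp_pow_mem _ hk
  | zero => rw [mul_zero]; exact Submodule.zero_mem _
  | add P P' _ _ hP hP' => rw [mul_add]; exact Submodule.add_mem _ hP hP'
  | smul a P _ hP => rw [mul_smul_comm]; exact Submodule.smul_mem _ _ hP

theorem dOp_mul_mem {m : ℕ} {P : Op A} (h : P ∈ opsLE A m) : dOp A * P ∈ opsLE A (m + 1) := by
  induction h using Submodule.span_induction with
  | mem P hP =>
    obtain ⟨f, k, hk, rfl⟩ := hP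
    have : dOp A * (mulOp A f * dOp A ^ k) =
        mulOp A (dOp A f) * dOp A ^ k + mulOp A f * dOp A ^ (k + 1) := by
      rw [← mul_assoc, pow_succ', ← mul_assoc, ← add_mul]
      congr 1
      ext1 z
      exact dOp_mul f z
    rw [this]
    exact Submodule.add_mem _ (mulOp_mul_dOp_pow_mem _ (by omega)) (mulOp_mul_dOp_pow_mem _ (by omega))
  | zero => rw [mul_zero]; exact Submodule.zero_mem _
  | add P P' _ _ hP hP' => rw [mul_add]; exact Submodule.add_mem _ hP hP'
  | smul a P _ hP => rw [mul_smul_comm]; exact Submodule.smul_mem _ _ hP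

theorem Lbar_mul_mem {N m : ℕ} (i j : Fin N) {P : Op (UPlus N)} (h : P ∈ opsLE (UPlus N) m) :
    Lbar N i j * P ∈ opsLE (UPlus N) (m + 1) := by
  have h' := opsLE_mono (Nat.le_succ m) h
  rw [Lbar, Matrix.sub_apply, Matrix.sub_apply, Matrix.map_apply, Matrix.diagonal_apply,
    Matrix.diagonal_apply, sub_mul, sub_mul]
  refine Submodule.sub_mem _ (Submodule.sub_mem _ ?_ ?_) (mulOp_mul_mem _ h')
  · split_ifs
    · rw [smul_mul_assoc, mul_assoc]
      exact Submodule.smul_mem _ _ (mulOp_mul_mem _ (dOp_mul_mem h))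
    · rw [zero_mul]; exact Submodule.zero_mem _
  · split_ifs
    · rw [← Algebra.smul_def]
      exact Submodule.smul_mem _ _ h'
    · rw [zero_mul]; exact Submodule.zero_mem _

theorem vartheta_mem_opsLE (N m : ℕ) : vartheta N m ∈ opsLE (UPlus N) m := by
  rw [vartheta_eq_thetaGen, thetaGen]
  refine Submodule.sum_mem _ fun s hs => ?_
  obtain ⟨hs1, hs2⟩ := Finset.mem_Icc.1 hs
  rw [map_sum]
  refine Submodule.sum_mem _ fun i _ => opsLE_mono hs2 ?_
  obtain ⟨r, rfl⟩ : ∃ r, s = r + 1 := ⟨s - 1, by omega⟩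
  rw [Nat.add_sub_cancel]
  -- The order bound is proved for all entries and all coefficients in `y`, since a product of
  -- matrices mixes them. The twists contribute only scalars.
  suffices H : ∀ a j b, coeff b ((((Lbar N).map (C (R := Op (UPlus N))) * Matrix.diagonal fun k =>
      PowerSeries.map (algebraMap ℂ (Op (UPlus N))) (hTau 1 1 k i)) ^ r *
      (Lbar N).map (C (R := Op (UPlus N)))) a j) ∈ opsLE (UPlus N) (r + 1) from H _ _ _
  clear hs hs1 hs2
  induction r with
  | zero =>
    intro a j b
    rw [pow_zero, one_mul, Matrix.map_apply, coeff_C]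
    split_ifs
    · have h1 : (1 : Op (UPlus N)) ∈ opsLE (UPlus N) 0 := by
        have := mulOp_mul_dOp_pow_mem (A := UPlus N) 1 le_rfl (k := 0)
        rwa [pow_zero, mul_one, show mulOp (UPlus N) 1 = 1 by ext1 z; simp [mulOp]] at this
      simpa using Lbar_mul_mem a j h1
    · exact Submodule.zero_mem _
  | succ r ih =>
    intro a j b
    rw [pow_succ', mul_assoc, Matrix.mul_apply, map_sum]
    refine Submodule.sum_mem _ fun k _ => ?_
    rw [Matrix.mul_diagonal, Matrix.map_apply, mul_assoc, coeff_C_mul, PowerSeries.coeff_mul,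
      Finset.mul_sum]
    refine Submodule.sum_mem _ fun p _ => ?_
    rw [coeff_map, ← Algebra.smul_def, mul_smul_comm]
    exact Submodule.smul_mem _ _ (Lbar_mul_mem a k (ih k j p.2))

/-- The coefficients of the values of the operators `ϑ_m` on the powers of `u` commute. -/
theorem commute_coeff_vartheta {N m m' : ℕ} (hm : 1 ≤ m) (hm' : 1 ≤ m') (j j' a a' : ℕ) :
    Commute (coeff a (vartheta N m (X ^ j))) (coeff a' (vartheta N m' (X ^ j'))) := by
  rw [commute_iff_eq, ← sub_eq_zero]
  refine eq_zero_of_quantized fun n _ _ φ Q => ?_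
  rw [map_sub, map_mul, map_mul, sub_eq_zero]
  exact Q.commute_coeff_vartheta hm hm' j j' a a'

/-- The centralizer of `z` is a linear subspace, so `coeff_mem_of_diffOp` passes from the values on
powers of `u` to the coefficients. -/
theorem mem_centralizer_of_diffOp {N : ℕ} {θ : (m : ℕ) → Fin (m + 1) → (UPlus N)⟦X⟧}
    (hθ : ∀ m : ℕ, 1 ≤ m → vartheta N m = diffOp (UPlus N) (θ m)) {z : UPlus N}
    (hz : ∀ m j a, 1 ≤ m → Commute z (coeff a (vartheta N m (X ^ j)))) {m : ℕ} (hm : 1 ≤ m)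
    (k : Fin (m + 1)) (a : ℕ) : Commute z (coeff a (θ m k)) := by
  have h := coeff_mem_of_diffOp (c := θ m)
    (W := Subalgebra.toSubmodule (Subalgebra.centralizer ℂ {z})) (fun j a => ?_) k a
  · exact Subalgebra.mem_centralizer_iff ℂ |>.1 h z rfl
  · rw [← hθ m hm]
    refine Subalgebra.mem_centralizer_iff ℂ |>.2 fun g hg => ?_
    rw [Set.mem_singleton_iff.1 hg]
    exact hz m j a hm

end DifferentialOperators

end TrigGaudin
theorem corollary3p4 (N : ℕ) :
    -- each `ϑ_m` has the form `ϑ_m^{(0)} ∂_u^m + ⋯ + ϑ_m^{(m)}`, in a unique way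
    (∀ m : ℕ, 1 ≤ m → ∃! c : Fin (m + 1) → PowerSeries (TrigGaudin.UPlus N),
      TrigGaudin.vartheta N m = TrigGaudin.diffOp (TrigGaudin.UPlus N) c) ∧
    -- the coefficients of all the series `ϑ_m^{(k)}` generate a commutative subalgebra
    (∀ θ : (m : ℕ) → Fin (m + 1) → PowerSeries (TrigGaudin.UPlus N),
      (∀ m : ℕ, 1 ≤ m →
        TrigGaudin.vartheta N m = TrigGaudin.diffOp (TrigGaudin.UPlus N) (θ m)) →
      ∀ x ∈ Algebra.adjoin ℂ {z : TrigGaudin.UPlus N | ∃ (m : ℕ) (k : Fin (m + 1)) (n : ℕ),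
          1 ≤ m ∧ z = PowerSeries.coeff n (θ m k)},
      ∀ y ∈ Algebra.adjoin ℂ {z : TrigGaudin.UPlus N | ∃ (m : ℕ) (k : Fin (m + 1)) (n : ℕ),
          1 ≤ m ∧ z = PowerSeries.coeff n (θ m k)},
        x * y = y * x) := by
  refine ⟨fun m hm => ?_, fun θ hθ x hx y hy => ?_⟩
  · obtain ⟨c, hc⟩ := TrigGaudin.exists_diffOp_of_mem (TrigGaudin.vartheta_mem_opsLE N m)
    exact ⟨c, hc, fun c' hc' => TrigGaudin.diffOp_injective m (hc'.symm.trans hc)⟩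
  -- Values are replaced by coefficients in one argument of the commutator and afterwards in the
  -- other.
  · have h1 : ∀ (m j a m' : ℕ) (k' : Fin (m' + 1)) (a' : ℕ), 1 ≤ m → 1 ≤ m' →
        Commute (PowerSeries.coeff a' (θ m' k'))
          (PowerSeries.coeff a (TrigGaudin.vartheta N m (PowerSeries.X ^ j))) :=
      fun m j a m' k' a' hm hm' => (TrigGaudin.mem_centralizer_of_diffOp hθ
        (fun m' j' a' hm' => TrigGaudin.commute_coeff_vartheta hm hm' j j' a a') hm' k' a').symm
    have h2 : ∀ (m : ℕ) (k : Fin (m + 1)) (a m' : ℕ) (k' : Fin (m' + 1)) (a' : ℕ), 1 ≤ m → 1 ≤ m' →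
        Commute (PowerSeries.coeff a' (θ m' k')) (PowerSeries.coeff a (θ m k)) :=
      fun m k a m' k' a' hm hm' => TrigGaudin.mem_centralizer_of_diffOp hθ
        (fun m j a hm => h1 m j a m' k' a' hm hm') hm k a
    have hc : x ∈ Subalgebra.centralizer ℂ {z : TrigGaudin.UPlus N | ∃ (m : ℕ) (k : Fin (m + 1))
        (n : ℕ), 1 ≤ m ∧ z = PowerSeries.coeff n (θ m k)} := by
      refine Algebra.adjoin_le ?_ hx
      rintro _ ⟨m, k, n, hm, rfl⟩
      refine Subalgebra.mem_centralizer_iff ℂ |>.2 ?_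
      rintro _ ⟨m', k', n', hm', rfl⟩
      exact h2 m k n m' k' n' hm hm'
    exact Subalgebra.mem_centralizer_iff ℂ |>.1 (Algebra.adjoin_le_centralizer_centralizer ℂ _ hy) x hc
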